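/- **Setting and notation.** Let $d\ge 2$ and $1\le r\le n$ be integers and let $\mathcal X\in\mathbb R^{n\times\cdots\times n}$ be a real $d$-mode tensor with all side lengths $n$. Let $X_{[j]}\in\mathbb R^{n\times n^{d-1}}$ be its mode-$j$ unfolding (whose columns are the mode-$j$ fibers), $\|\cdot\|_2$ the Euclidean norm of the vector of entries, $\mathcal X\times_1A_1\cdots\times_dA_d$ the modewise product, $[\![\mathcal H,Q_1,\dots,Q_d]\!]=\mathcal H\times_1Q_1\cdots\times_dQ_d$, $A^\dagger$ the Moore–Penrose pseudoinverse, and $$\Delta_{r,j}=\sum_{i=r+1}^{\min\{n,\,n^{d-1}\}}\sigma_i(X_{[j]})^2,$$ where $\sigma_1\ge\sigma_2\ge\cdots$ are the singular values. A random variable $\xi$ is called sub-gaussian with parameter $K$ if $\mathbb E\,e^{t\xi}\le e^{Kt^2/2}$ for all $t\in\mathbb R$. **Algorithm (one-pass, Kronecker-structured).** Given matrices $\Omega_{(i,i)}\in\mathbb R^{n\times n}$, $\Omega_{(i,j)}\in\mathbb R^{m\times n}$ ($i\ne j$) and $\Phi_i\in\mathbb R^{m_c\times n}$ ($i,j\in\{1,\dots,d\}$),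 the measurements of $\mathcal X$ are $$B_i=\Omega_{(i,i)}X_{[i]}\Big(\bigotimes_{j\ne i}\Omega_{(i,j)}\Big)^T\quad(1\le i\le d),\qquad \mathcal B_c=\mathcal X\times_1\Phi_1\cdots\times_d\Phi_d .$$ From these one solves $\Omega_{(i,i)}F_i=B_i$, lets the columns of $Q_i\in\mathbb R^{n\times r}$ be the $r$ leading left singular vectors from a full singular value decomposition of $F_i$ (as chosen by any fixed deterministic Borel measurable SVD routine), computes the core by mode-by-mode least squares, $\mathcal H=\mathcal B_c\times_1(\Phi_1Q_1)^\dagger\cdots\times_d(\Phi_dQ_d)^\dagger$, and outputs $\mathcal X_1=[\![\mathcal H,Q_1,\dots,Q_d]\!]$. **Theorem** (Error bound for one-pass Kronecker-structured sub-gaussian measurements). For every $K\ge0$ there are constants $C_1,C_2,C_3,C_4>0$, depending only on $K$, such that the following holds for all $d,n,r,\mathcal X$ as above, all $\epsilon\in(0,1)$ and all $\delta\in(0,\tfrac13)$. Let 1. $\Omega_{(i,i)}\in\mathbb R^{n\times n}$ be arbitrary full-rank matrices; 2. $\Omega_{(i,j)}\in\mathbb R^{m\times n}$, $i\neq j$,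 be random matrices whose entries have mean zero and variance $m^{-1}$ and, multiplied by $\sqrt m$, are sub-gaussian with parameter $K$, with $$m\ge\max\left\{\frac{C_1r(d-1)^2}{\epsilon^2}\ln\left(\frac{n^dd^2}{\delta}\right),\ \frac{C_2(d-1)^2}{\epsilon^2}\ln\left(\left(\frac{141}{\epsilon}\right)^r\frac{n^{d-2}d^2}{\delta}\right)\right\};$$ 3. $\Phi_i\in\mathbb R^{m_c\times n}$ be random matrices whose entries have mean zero and variance $m_c^{-1}$ and, multiplied by $\sqrt{m_c}$, are sub-gaussian with parameter $K$, with $$m_c\ge\max\left\{C_3\ln\left(\frac{94^rd}{\delta}\right),\ \frac{C_4rd^2}{\epsilon^2}\ln\left(\frac{d\,(r+n^{d-1})^2}{\delta}\right)\right\};$$ and let all the entries of all the $\Omega_{(i,j)}$ ($i\ne j$) and all the $\Phi_i$ be mutually independent. Then the output $\mathcal X_1$ of the algorithm satisfies $$\|\mathcal X_1-\mathcal X\|_2\le(1+e^{\epsilon})\sqrt{\frac{1+\epsilon}{1-\epsilon}\sum_{j=1}^d\Delta_{r,j}}$$ with probability at least $1-3\delta$. -/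

import Mathlib

open MeasureTheory ProbabilityTheory
open scoped NNReal

noncomputable section

namespace OnePassTucker

/-! ### Tensors with `d` modes of equal side length, unfoldings, modewise products -/

/-- Real `d`-mode tensors with all side lengths equal to `n`. -/
abbrev Tensor (d n : ℕ) : Type := (Fin d → Fin n) → ℝ

/-- Multi-indices of all the modes but mode `j`, each ranging over `Fin n`. -/
abbrev OtherModes {d : ℕ} (j : Fin d) (n : ℕ) : Type := {k : Fin d // k ≠ j} → Fin n

/-- The Euclidean norm of a tensor. -/
def tensorNorm {d n : ℕ} (X : Tensor d n) : ℝ := √(∑ i, X i ^ 2)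

/-- The mode-`j` unfolding: its columns are the mode-`j` fibers, indexed by the values of the
remaining indices. -/
def unfold {d n : ℕ} (j : Fin d) (X : Tensor d n) : Matrix (Fin n) (OtherModes j n) ℝ :=
  Matrix.of fun a b => X fun k => if h : k = j then a else b ⟨k, h⟩

/-- The product `X ×₁ A₁ ×₂ ⋯ ×_d A_d` of a tensor with one matrix along each mode. -/
def modeProd {d p q : ℕ} (X : Tensor d q) (A : Fin d → Matrix (Fin p) (Fin q) ℝ) : Tensor d p :=
  fun l => ∑ i : Fin d → Fin q, (∏ j, A j (l j) (i j)) * X i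

/-- The Kronecker product of a finite family of matrices, with multi-indices as row and column
indices. -/
def kroneckerFamily {ι : Type*} [Fintype ι] {p q : ℕ} (A : ι → Matrix (Fin p) (Fin q) ℝ) :
    Matrix (ι → Fin p) (ι → Fin q) ℝ :=
  Matrix.of fun a b => ∏ k, A k (a k) (b k)

/-! ### Singular values and singular vectors -/

/-- The tail energy `Δ_{r,j}`: the sum of the squared singular values of the mode-`j` unfolding
from the `(r+1)`-st largest on (`LinearMap.singularValues` is decreasing and starts at index
`0`). -/
def tailEnergy {d n : ℕ} (X : Tensor d n) (r : ℕ) (j : Fin d) : ℝ :=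
  ∑ i ∈ Finset.Ico r (min n (n ^ (d - 1))),
    (Matrix.toEuclideanLin (unfold j X)).singularValues i ^ 2

/-- `Q` consists of the first `r` left singular vectors in some full singular value
decomposition `F = U Σ Vᵀ`. -/
def IsLeadingLeftSingularVectors {n r : ℕ} {κ : Type*} [Fintype κ] [DecidableEq κ]
    (F : Matrix (Fin n) κ ℝ) (Q : Matrix (Fin n) (Fin r) ℝ) : Prop :=
  ∃ (U : Matrix (Fin n) (Fin n) ℝ) (V : Matrix κ (Fin (Fintype.card κ)) ℝ) (σ : ℕ → ℝ),
    U.transpose * U = 1 ∧ V.transpose * V = 1 ∧ V * V.transpose = 1 ∧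
    Antitone σ ∧ (∀ k, 0 ≤ σ k) ∧
    F = U * (Matrix.of fun (a : Fin n) (b : Fin (Fintype.card κ)) =>
      if a.val = b.val then σ a.val else 0) * V.transpose ∧
    ∀ (a : Fin n) (k : Fin r) (k' : Fin n), k.val = k'.val → Q a k = U a k'

/-- A deterministic Borel measurable routine that returns the `r` leading left singular vectors
of every `n × κ` matrix. -/
structure IsSVDRoutine {n r : ℕ} {κ : Type*} [Fintype κ] [DecidableEq κ]
    (f : Matrix (Fin n) κ ℝ → Matrix (Fin n) (Fin r) ℝ) : Prop where
  spec : ∀ F, IsLeadingLeftSingularVectors F (f F)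
  measurable : ∀ a k, Measurable fun F : Fin n → κ → ℝ => f (Matrix.of F) a k

/-! ### The Moore–Penrose pseudoinverse -/

/-- The four Penrose equations. -/
structure IsMoorePenrose {p q : ℕ} (A : Matrix (Fin p) (Fin q) ℝ)
    (P : Matrix (Fin q) (Fin p) ℝ) : Prop where
  mul_mul_left : A * P * A = A
  mul_mul_right : P * A * P = P
  symm_left : (A * P).transpose = A * P
  symm_right : (P * A).transpose = P * A

theorem exists_isMoorePenrose {p q : ℕ} (A : Matrix (Fin p) (Fin q) ℝ) :
    ∃ P, IsMoorePenrose A P := by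
  obtain ⟨N, hNs, hMNM, hNMN, hNM⟩ : ∃ N : Matrix (Fin q) (Fin q) ℝ, N.transpose = N ∧
      (A.transpose * A) * N * (A.transpose * A) = A.transpose * A ∧
      N * (A.transpose * A) * N = N ∧
      (N * (A.transpose * A)).transpose = N * (A.transpose * A) := by
    have hM : (A.transpose * A).IsHermitian := by
      simpa using Matrix.isHermitian_conjTranspose_mul_self A
    obtain ⟨U, D, hU, hD⟩ : ∃ (U : Matrix (Fin q) (Fin q) ℝ) (D : Fin q → ℝ),
        U.transpose * U = 1 ∧ A.transpose * A = U * Matrix.diagonal D * U.transpose := by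
      refine ⟨hM.eigenvectorUnitary, hM.eigenvalues, ?_, ?_⟩
      · have := Unitary.coe_star_mul_self hM.eigenvectorUnitary
        simpa [Matrix.star_eq_conjTranspose] using this
      · have := hM.spectral_theorem
        simpa [Unitary.conjStarAlgAut_apply, Matrix.star_eq_conjTranspose, Function.comp_def]
          using this
    have key : ∀ a b : Fin q → ℝ, (U * Matrix.diagonal a * U.transpose) *
        (U * Matrix.diagonal b * U.transpose) =
          U * Matrix.diagonal (fun i => a i * b i) * U.transpose := by
      intro a b
      calc _ = U * Matrix.diagonal a * (U.transpose * U) * Matrix.diagonal b * U.transpose := by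
            simp only [Matrix.mul_assoc]
        _ = _ := by rw [hU, Matrix.mul_one, Matrix.mul_assoc U, Matrix.diagonal_mul_diagonal]
    refine ⟨U * Matrix.diagonal (fun i => (D i)⁻¹) * U.transpose, ?_, ?_, ?_, ?_⟩
    · simp [Matrix.transpose_mul, Matrix.mul_assoc]
    · rw [hD, key, key]
      congr 3
      ext i
      by_cases h : D i = 0 <;> simp [h]
    · rw [hD, key, key]
      congr 3
      ext i
      by_cases h : D i = 0 <;> simp [h]
    · rw [hD, key]
      simp [Matrix.transpose_mul, Matrix.mul_assoc]
  have hA : A * N * (A.transpose * A) = A := by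
    have h0 : (A * N * (A.transpose * A) - A).transpose * (A * N * (A.transpose * A) - A) = 0 := by
      have e : (A * N * (A.transpose * A) - A).transpose =
          (A.transpose * A) * N * A.transpose - A.transpose := by
        simp [Matrix.transpose_mul, hNs, Matrix.mul_assoc]
      have e2 : ((A.transpose * A) * N * A.transpose - A.transpose) *
          (A * N * (A.transpose * A) - A) =
          (A.transpose * A) * N * ((A.transpose * A) * N * (A.transpose * A))
            - (A.transpose * A) * N * (A.transpose * A)
            - ((A.transpose * A) * N * (A.transpose * A) - A.transpose * A) := by
        simp only [Matrix.sub_mul, Matrix.mul_sub, Matrix.mul_assoc]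
      rw [e, e2, hMNM, hMNM]
      simp
    have h1 : A * N * (A.transpose * A) - A = 0 := by
      rw [← Matrix.conjTranspose_mul_self_eq_zero]
      simpa using h0
    exact sub_eq_zero.mp h1
  refine ⟨N * A.transpose, ?_, ?_, ?_, ?_⟩
  · simpa only [Matrix.mul_assoc] using hA
  · calc N * A.transpose * A * (N * A.transpose)
        = N * (A.transpose * A) * N * A.transpose := by simp only [Matrix.mul_assoc]
      _ = _ := by rw [hNMN]
  · simp [Matrix.transpose_mul, hNs, Matrix.mul_assoc]
  · simpa only [Matrix.mul_assoc] using hNM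

/-- The Moore–Penrose pseudoinverse `A†`. -/
def pinv {p q : ℕ} (A : Matrix (Fin p) (Fin q) ℝ) : Matrix (Fin q) (Fin p) ℝ :=
  Classical.choose (exists_isMoorePenrose A)

theorem pinv_spec {p q : ℕ} (A : Matrix (Fin p) (Fin q) ℝ) : IsMoorePenrose A (pinv A) :=
  Classical.choose_spec (exists_isMoorePenrose A)

/-! ### The one-pass algorithm with Kronecker-structured measurements

`D i` is the square matrix `Ω_(i,i)` of the uncompressed mode, `Ω i j` (for `j ≠ i`) the
compressing matrix `Ω_(i,j)`, and `Φ i` the core measurement matrix of mode `i`. -/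

/-- The flattened leave-one-out measurements
`B_i = Ω_(i,i) X_[i] (⨂_{j ≠ i} Ω_(i,j))ᵀ`. -/
def looMeasurement {d n m : ℕ} (X : Tensor d n) (i : Fin d) (Di : Matrix (Fin n) (Fin n) ℝ)
    (Ωi : {j : Fin d // j ≠ i} → Matrix (Fin m) (Fin n) ℝ) :
    Matrix (Fin n) (OtherModes i m) ℝ :=
  Di * unfold i X * (kroneckerFamily Ωi).transpose

/-- The core measurements `X ×₁ Φ₁ ×₂ ⋯ ×_d Φ_d`. -/
def coreMeasurement {d n mc : ℕ} (X : Tensor d n) (Φ : Fin d → Matrix (Fin mc) (Fin n) ℝ) :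
    Tensor d mc :=
  modeProd X Φ

/-- Factor recovery for one mode: solve `Ω_(i,i) F_i = B_i` and keep the `r` leading left
singular vectors of `F_i`, as returned by the routine `svd`. -/
def recoverFactor {n r : ℕ} {κ : Type*}
    (svd : Matrix (Fin n) κ ℝ → Matrix (Fin n) (Fin r) ℝ)
    (Di : Matrix (Fin n) (Fin n) ℝ) (Bi : Matrix (Fin n) κ ℝ) : Matrix (Fin n) (Fin r) ℝ :=
  svd (Di⁻¹ * Bi)

/-- Core recovery: the mode-by-mode least squares solution
`H = B_c ×₁ (Φ₁ Q₁)† ×₂ ⋯ ×_d (Φ_d Q_d)†`. -/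
def recoverCore {d n r mc : ℕ} (Bc : Tensor d mc) (Φ : Fin d → Matrix (Fin mc) (Fin n) ℝ)
    (Q : Fin d → Matrix (Fin n) (Fin r) ℝ) : Tensor d r :=
  modeProd Bc fun i => pinv (Φ i * Q i)

/-- The output `X₁ = ⟦H, Q₁, …, Q_d⟧` of the one-pass algorithm with Kronecker-structured
leave-one-out measurements; it sees `X` only through the measurements. -/
def kroneckerOnePass {d n r m mc : ℕ}
    (svd : ∀ i : Fin d, Matrix (Fin n) (OtherModes i m) ℝ → Matrix (Fin n) (Fin r) ℝ)
    (D : Fin d → Matrix (Fin n) (Fin n) ℝ)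
    (Ω : ∀ i : Fin d, {j : Fin d // j ≠ i} → Matrix (Fin m) (Fin n) ℝ)
    (Φ : Fin d → Matrix (Fin mc) (Fin n) ℝ) (X : Tensor d n) : Tensor d n :=
  let Q : Fin d → Matrix (Fin n) (Fin r) ℝ := fun i =>
    recoverFactor (svd i) (D i) (looMeasurement X i (D i) (Ω i))
  let H : Tensor d r := recoverCore (coreMeasurement X Φ) Φ Q
  modeProd H Q

/-! ### The random measurement matrices -/

/-- `f` is a mean zero random variable of variance `1 / k` whose normalization `√k f` is
sub-gaussian with parameter `K`, that is `E exp (t √k f) ≤ exp (K t² / 2)` for all real `t`. -/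
structure IsNormalizedSubgaussian {S : Type*} [MeasurableSpace S] (μ : Measure S) (K : ℝ≥0)
    (k : ℕ) (f : S → ℝ) : Prop where
  measurable : Measurable f
  mean_zero : ∫ ω, f ω ∂μ = 0
  variance_eq : variance f μ = 1 / (k : ℝ)
  subgaussian : HasSubgaussianMGF (fun ω => √(k : ℝ) * f ω) K μ

/-- The family of all the entries of all the matrices `Ω_(i,j)`, `i ≠ j`, and `Φ_i`. -/
def allEntries {S : Type*} {d n m mc : ℕ}
    (Ω : ∀ i : Fin d, {j : Fin d // j ≠ i} → S → Matrix (Fin m) (Fin n) ℝ)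
    (Φ : Fin d → S → Matrix (Fin mc) (Fin n) ℝ) :
    ((Σ i : Fin d, {j : Fin d // j ≠ i}) × Fin m × Fin n) ⊕ (Fin d × Fin mc × Fin n) → S → ℝ
  | .inl (p, a, b) => fun ω => Ω p.1 p.2 ω a b
  | .inr (i, a, b) => fun ω => Φ i ω a b

end OnePassTucker

end

noncomputable section

namespace OnePassTucker

open scoped Matrix

/-! ### Squares of sub-gaussian random variables -/

/-! Write `P_i = Q_i Q_iᵀ` and `R_i = Q_i (Φ_i Q_i)† Φ_i`. The output is `X` multiplied by `R_i` in
every mode. On the good event `R_i P_i = P_i`, so with `Y = X - X ×₁ P₁ ⋯ ×_d P_d` the error equals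
`Y ×₁ R₁ ⋯ ×_d R_d - Y`. It remains to bound `Y` and the growth caused by the `R_i`.

Size of `Y`: Pythagoras in one mode after another gives `‖Y‖² ≤ ∑ ‖X_[j] - P_j X_[j]‖²`
(`tensorSq_sub_modeProd_le`). Each summand is at most `(1 + ε) / (1 - ε)` times the tail energy,
because the Kronecker sketch nearly preserves the cost of every rank `r` projection
(`frobSq_sub_le_of_sketch`). This bound is uniform in the projection, so the dependence of `Q_j` on
the sketch is harmless.

Growth: `R_k` is an oblique projection without a good uniform norm bound, but on one fixed tensor it
expands the norm by at most `1 + ε / d` with high probability (`leastSquares_stable`). The tensor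
met by `R_k` depends only on the `Ω_(i,j)` and on the `Φ_j` with `j < k`, hence is independent of
`Φ_k` and may be frozen (`measure_le_of_forall_piecewise`). The `d` factors multiply to at most `exp
ε`.

All random input is the property `IsJL`: the norm of one fixed vector is nearly preserved.
Polarization gives inner products, union bounds give approximate matrix products, and a net gives
subspace embeddings. For one sub-gaussian matrix the property is a Chernoff bound over its
independent rows, since squares of sub-gaussian variables are sub-exponential. Kronecker products
are handled by peeling off one factor at a time (`kroneckerFamily_concentration`); the single-matrix
bound is proved for Frobenius norms of whole matrices, so that peeling needs no union bound over
columns. -/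

lemma lintegral_exp_sq_div_four_gaussianReal :
    ∫⁻ x, ENNReal.ofReal (Real.exp (x ^ 2 / 4)) ∂(gaussianReal 0 1) ≤ ENNReal.ofReal 2 := by
  have h1 : (1 : ℝ≥0) ≠ 0 := one_ne_zero
  rw [gaussianReal_of_var_ne_zero _ h1,
    lintegral_withDensity_eq_lintegral_mul _ (measurable_gaussianPDF _ _) (by fun_prop)]
  have h2 : ∀ x : ℝ, (gaussianPDF 0 1 * fun x => ENNReal.ofReal (Real.exp (x ^ 2 / 4))) x =
      ENNReal.ofReal ((√(2 * Real.pi))⁻¹ * Real.exp (-(1 / 4) * x ^ 2)) := by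
    intro x
    simp only [Pi.mul_apply, gaussianPDF]
    rw [← ENNReal.ofReal_mul (gaussianPDFReal_nonneg _ _ _), gaussianPDFReal]
    congr 1
    simp only [NNReal.coe_one, mul_one, sub_zero]
    rw [mul_assoc, ← Real.exp_add]
    congr 2
    ring
  simp_rw [h2]
  rw [← ofReal_integral_eq_lintegral_ofReal
    ((integrable_exp_neg_mul_sq (by norm_num : (0 : ℝ) < 1 / 4)).const_mul _)
    (ae_of_all _ fun x => by positivity), integral_const_mul, integral_gaussian]
  apply ENNReal.ofReal_le_ofReal
  have hpi := Real.pi_pos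
  rw [inv_mul_le_iff₀ (by positivity)]
  have : (2 : ℝ) = √4 := by
    rw [show (4 : ℝ) = 2 ^ 2 by norm_num, Real.sqrt_sq (by norm_num)]
  calc √(Real.pi / (1 / 4)) ≤ √(2 * Real.pi * 4) := Real.sqrt_le_sqrt (by linarith)
    _ = √(2 * Real.pi) * 2 := by rw [Real.sqrt_mul (by positivity)]; rw [← this]

variable {S : Type*} [MeasurableSpace S] {μ : Measure S}

/-- Gaussian linearization: `exp (g² / (4K))` is the mean of `exp (s g x)` over a standard normal
`x` with `s² = 1 / (2K)`. After Tonelli the sub-gaussian bound on `g` leaves `exp (x² / 4)`, whose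
Gaussian mean is `√2`. -/
lemma lintegral_exp_sq_le_of_subgaussian [IsProbabilityMeasure μ] {g : S → ℝ} {K : ℝ≥0}
    (hK : 0 < K) (hg : Measurable g) (h : HasSubgaussianMGF g K μ) :
    ∫⁻ ω, ENNReal.ofReal (Real.exp (g ω ^ 2 / (4 * K))) ∂μ ≤ ENNReal.ofReal 2 := by
  have hK' : (0 : ℝ) < K := hK
  set s : ℝ := (√(2 * K))⁻¹ with hs
  have hs2 : s ^ 2 = (2 * K : ℝ)⁻¹ := by
    rw [hs, inv_pow, Real.sq_sqrt (by positivity)]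
  have h1 : ∀ ω, ENNReal.ofReal (Real.exp (g ω ^ 2 / (4 * K))) =
      ∫⁻ x, ENNReal.ofReal (Real.exp (s * g ω * x)) ∂(gaussianReal 0 1) := by
    intro ω
    have hm : mgf id (gaussianReal 0 1) (s * g ω) = Real.exp (g ω ^ 2 / (4 * K)) := by
      rw [mgf_gaussianReal (Measure.map_id)]
      congr 1
      simp only [zero_mul, zero_add, NNReal.coe_one, one_mul, mul_pow, hs2]
      field_simp
      ring
    have hi : Integrable (fun x => Real.exp (s * g ω * x)) (gaussianReal 0 1) :=
      integrable_exp_mul_gaussianReal (s * g ω)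
    rw [← hm, ← ofReal_integral_eq_lintegral_ofReal hi (ae_of_all _ fun x => by positivity)]
    rfl
  simp_rw [h1]
  rw [lintegral_lintegral_swap]
  · refine le_trans (lintegral_mono fun x => ?_) lintegral_exp_sq_div_four_gaussianReal
    have h2 := h.mgf_le (s * x)
    have hi := h.integrable_exp_mul (s * x)
    have h3 : ∀ ω, s * g ω * x = s * x * g ω := fun ω => by ring
    simp_rw [h3]
    rw [← ofReal_integral_eq_lintegral_ofReal hi (ae_of_all _ fun x => by positivity)]
    apply ENNReal.ofReal_le_ofReal
    refine h2.trans (le_of_eq ?_)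
    congr 1
    rw [mul_pow, hs2]
    field_simp
    ring
  · apply Measurable.aemeasurable
    fun_prop

lemma exp_le_one_add_add_sq_mul_exp_abs (x : ℝ) :
    Real.exp x ≤ 1 + x + x ^ 2 * Real.exp |x| := by
  have h := Complex.norm_exp_sub_sum_le_norm_mul_exp (x : ℂ) 2
  have h2 : Complex.exp x - ∑ m ∈ Finset.range 2, (x : ℂ) ^ m / m.factorial =
      ((Real.exp x - (1 + x) : ℝ) : ℂ) := by
    simp [Finset.sum_range_succ]
  rw [h2, Complex.norm_real, Complex.norm_real, Real.norm_eq_abs, Real.norm_eq_abs, sq_abs] at h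
  linarith [le_abs_self (Real.exp x - (1 + x))]

/-- The linear term is kept exactly because it integrates to zero when `g` has second moment 1. One
factor `exp (c |y|)` comes from the Taylor remainder and another absorbs `y²`; the choice `c = 1 /
(8K)` makes their product fit into `exp (g² / (4K))`. -/
lemma exp_mul_sq_sub_one_le {K l : ℝ} (hK : 1 ≤ K) (hl : |l| ≤ 1 / (8 * K)) (g : ℝ) :
    Real.exp (l * (g ^ 2 - 1)) ≤
      1 + l * (g ^ 2 - 1) + l ^ 2 * (256 * K ^ 2) * Real.exp (g ^ 2 / (4 * K)) := by
  set y := g ^ 2 - 1 with hy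
  set c := 1 / (8 * K) with hc
  have hc0 : 0 < c := by positivity
  have hc8 : 4 * c ≤ 1 := by
    rw [hc, mul_one_div, div_le_one (by positivity)]; linarith
  have hy1 : |y| ≤ g ^ 2 + 1 := by
    rw [abs_le]; constructor <;> nlinarith [sq_nonneg g]
  have h1 : (c * |y|) ^ 2 / 2 ≤ Real.exp (c * |y|) := by
    have := Real.quadratic_le_exp_of_nonneg (x := c * |y|) (by positivity)
    have : 0 ≤ c * |y| := by positivity
    linarith
  have h2 : y ^ 2 ≤ 128 * K ^ 2 * Real.exp (c * |y|) := by
    have : (c * |y|) ^ 2 = y ^ 2 / (64 * K ^ 2) := by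
      rw [mul_pow, sq_abs, hc]; field_simp; ring
    rw [this, div_div, div_le_iff₀ (by positivity)] at h1
    linarith
  have h3 : Real.exp |l * y| ≤ Real.exp (c * |y|) := by
    rw [abs_mul]; gcongr
  have h4 : Real.exp (c * |y|) * Real.exp (c * |y|) ≤ 2 * Real.exp (g ^ 2 / (4 * K)) := by
    rw [← Real.exp_add]
    have : c * |y| + c * |y| ≤ 1 / 2 + g ^ 2 / (4 * K) := by
      have e : g ^ 2 / (4 * K) = 2 * c * g ^ 2 := by rw [hc]; field_simp; ring
      rw [e]
      nlinarith
    refine (Real.exp_le_exp.2 this).trans ?_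
    rw [Real.exp_add]
    gcongr
    have h5 : Real.exp (1 / 2) ^ 2 ≤ 2 ^ 2 := by
      rw [← Real.exp_nat_mul]
      norm_num
      linarith [Real.exp_one_lt_d9]
    exact (pow_le_pow_iff_left₀ (Real.exp_pos _).le (by norm_num) (by norm_num)).1 h5
  have h5 := exp_le_one_add_add_sq_mul_exp_abs (l * y)
  have h6 : (l * y) ^ 2 * Real.exp |l * y| ≤
      l ^ 2 * (256 * K ^ 2) * Real.exp (g ^ 2 / (4 * K)) :=
    calc (l * y) ^ 2 * Real.exp |l * y| = l ^ 2 * (y ^ 2 * Real.exp |l * y|) := by ring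
      _ ≤ l ^ 2 * ((128 * K ^ 2 * Real.exp (c * |y|)) * Real.exp (c * |y|)) := by gcongr
      _ = l ^ 2 * (128 * K ^ 2) * (Real.exp (c * |y|) * Real.exp (c * |y|)) := by ring
      _ ≤ l ^ 2 * (128 * K ^ 2) * (2 * Real.exp (g ^ 2 / (4 * K))) := by gcongr
      _ = _ := by ring
  linarith

lemma integrable_exp_mul_sq_sub_one [IsProbabilityMeasure μ] {g : S → ℝ} {K : ℝ≥0}
    (hK : 1 ≤ K) (hg : Measurable g) (h : HasSubgaussianMGF g K μ)
    (hsq : ∫ ω, g ω ^ 2 ∂μ = 1) {l : ℝ} (hl : |l| ≤ 1 / (8 * K)) :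
    Integrable (fun ω => Real.exp (l * (g ω ^ 2 - 1))) μ ∧
      ∫ ω, Real.exp (l * (g ω ^ 2 - 1)) ∂μ ≤ Real.exp (512 * K ^ 2 * l ^ 2) := by
  have hK1 : (1 : ℝ) ≤ K := hK
  have hlin := lintegral_exp_sq_le_of_subgaussian (lt_of_lt_of_le one_pos hK) hg h
  have hi : Integrable (fun ω => Real.exp (g ω ^ 2 / (4 * K))) μ := by
    refine ⟨by fun_prop, ?_⟩
    rw [hasFiniteIntegral_iff_ofReal (ae_of_all _ fun ω => by positivity)]
    exact hlin.trans_lt ENNReal.ofReal_lt_top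
  have hi2 : ∫ ω, Real.exp (g ω ^ 2 / (4 * K)) ∂μ ≤ 2 := by
    rw [← ofReal_integral_eq_lintegral_ofReal hi (ae_of_all _ fun ω => by positivity)] at hlin
    exact (ENNReal.ofReal_le_ofReal_iff (by norm_num)).1 hlin
  -- The integral of a non-integrable function is 0 by convention, so the value 1 forces
  -- integrability.
  have hg2 : Integrable (fun ω => g ω ^ 2) μ := by
    by_contra hn
    rw [integral_undef hn] at hsq
    norm_num at hsq
  have hb : Integrable (fun ω => 1 + l * (g ω ^ 2 - 1) +
      l ^ 2 * (256 * (K : ℝ) ^ 2) * Real.exp (g ω ^ 2 / (4 * K))) μ :=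
    ((integrable_const _).add ((hg2.sub (integrable_const _)).const_mul _)).add (hi.const_mul _)
  have hint : Integrable (fun ω => Real.exp (l * (g ω ^ 2 - 1))) μ := by
    refine hb.mono' (by fun_prop) (ae_of_all _ fun ω => ?_)
    rw [Real.norm_eq_abs, abs_of_pos (Real.exp_pos _)]
    exact exp_mul_sq_sub_one_le hK1 hl _
  refine ⟨hint, (integral_mono hint hb fun ω => exp_mul_sq_sub_one_le hK1 hl _).trans ?_⟩
  rw [integral_add (by fun_prop) (by fun_prop), integral_add (by fun_prop) (by fun_prop),
    integral_const_mul, integral_const_mul, integral_sub (by fun_prop) (by fun_prop), hsq]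
  simp only [integral_const, probReal_univ, smul_eq_mul, mul_one, sub_self, mul_zero, add_zero]
  have : l ^ 2 * (256 * (K : ℝ) ^ 2) * ∫ ω, Real.exp (g ω ^ 2 / (4 * K)) ∂μ ≤
      512 * K ^ 2 * l ^ 2 := by
    calc _ ≤ l ^ 2 * (256 * (K : ℝ) ^ 2) * 2 := by gcongr
      _ = _ := by ring
  linarith [Real.add_one_le_exp (512 * (K : ℝ) ^ 2 * l ^ 2)]

/-! ### Concentration of the Frobenius norm -/

/-- The squared Frobenius norm. -/
def frobSq {α β : Type*} [Fintype α] [Fintype β] (A : Matrix α β ℝ) : ℝ := ∑ a, ∑ b, A a b ^ 2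

lemma frobSq_nonneg {α β : Type*} [Fintype α] [Fintype β] (A : Matrix α β ℝ) : 0 ≤ frobSq A :=
  Finset.sum_nonneg fun _ _ => Finset.sum_nonneg fun _ _ => sq_nonneg _

lemma frobSq_eq_zero {α β : Type*} [Fintype α] [Fintype β] {A : Matrix α β ℝ}
    (h : frobSq A = 0) : A = 0 := by
  ext a b
  have h1 := (Finset.sum_eq_zero_iff_of_nonneg
    fun _ _ => Finset.sum_nonneg fun _ _ => sq_nonneg _).1 h a (Finset.mem_univ _)
  have h2 := (Finset.sum_eq_zero_iff_of_nonneg fun _ _ => sq_nonneg _).1 h1 b (Finset.mem_univ _)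
  exact pow_eq_zero_iff two_ne_zero |>.1 h2

/-- Independence is read as the joint law being a product measure; currying turns a product over
pairs into a product of products. -/
lemma iIndepFun_rows {α β : Type*} {W : α → β → S → ℝ}
    (hW : ∀ a b, Measurable (W a b)) (h : iIndepFun (fun (p : α × β) ω => W p.1 p.2 ω) μ) :
    iIndepFun (fun a ω => (W a · ω)) μ := by
  have := h.isProbabilityMeasure
  have : ∀ a b, IsProbabilityMeasure (μ.map (W a b)) :=
    fun a b => Measure.isProbabilityMeasure_map (hW a b).aemeasurable
  have h' : iIndepFun (fun (p : (_ : α) × β) ω => W p.1 p.2 ω) μ :=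
    h.precomp (g := fun p : (_ : α) × β => (p.1, p.2)) fun p q hpq => by
      cases p; cases q; simpa using hpq
  rw [iIndepFun_iff_map_fun_eq_infinitePi_map (by fun_prop)] at h' ⊢
  have e : (fun ω a => (W a · ω)) =
      (MeasurableEquiv.piCurry fun _ _ => ℝ) ∘ (fun ω (p : (_ : α) × β) => W p.1 p.2 ω) := by
    ext; simp [Sigma.curry]
  rw [e, ← Measure.map_map (by fun_prop) (by fun_prop), h',
    Measure.infinitePi_map_piCurry (fun a b => μ.map (W a b))]
  congr 1
  funext a
  have h2 : iIndepFun (W a) μ := h.precomp (g := fun b => (a, b)) fun b c hbc => by simpa using hbc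
  rw [(iIndepFun_iff_map_fun_eq_infinitePi_map (by fun_prop)).1 h2]

lemma IsNormalizedSubgaussian.mono {K K' : ℝ≥0} {k : ℕ} {f : S → ℝ}
    (h : IsNormalizedSubgaussian μ K k f) (hK : K ≤ K') : IsNormalizedSubgaussian μ K' k f := by
  refine ⟨h.measurable, h.mean_zero, h.variance_eq, h.subgaussian.integrable_exp_mul, fun t => ?_⟩
  refine (h.subgaussian.mgf_le t).trans ?_
  have : (K : ℝ) ≤ K' := hK
  gcongr

/-- Sub-gaussian parameters and variances of independent summands both add with weights `u b ^ 2`,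
which sum to 1. So a row applied to a unit vector is again normalized with the same `K`. -/
lemma IsNormalizedSubgaussian.linear_combination {n k : ℕ} (hk : 0 < k) {K : ℝ≥0}
    {w : Fin n → S → ℝ} (hind : iIndepFun w μ) (hw : ∀ b, IsNormalizedSubgaussian μ K k (w b))
    {u : Fin n → ℝ} (hu : ∑ b, u b ^ 2 = 1) :
    HasSubgaussianMGF (fun ω => √k * ∑ b, w b ω * u b) K μ ∧
      ∫ ω, (√k * ∑ b, w b ω * u b) ^ 2 ∂μ = 1 := by
  have := hind.isProbabilityMeasure
  have hmeas := fun b => (hw b).measurable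
  have e : (fun ω => √k * ∑ b, w b ω * u b) = fun ω => ∑ b, u b * (√k * w b ω) := by
    funext ω
    rw [Finset.mul_sum]
    exact Finset.sum_congr rfl fun b _ => by ring
  have hind' : iIndepFun (fun b ω => u b * (√k * w b ω)) μ :=
    hind.comp (fun b x => u b * (√k * x)) fun b => by fun_prop
  let c : Fin n → ℝ≥0 := fun b => ⟨u b ^ 2, sq_nonneg _⟩
  have hsub : ∀ b, HasSubgaussianMGF (fun ω => u b * (√k * w b ω))
      (c b * K) μ := fun b => (hw b).subgaussian.const_mul (u b)
  have hsum := HasSubgaussianMGF.sum_of_iIndepFun hind' (s := Finset.univ) fun b _ => hsub b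
  have hc : ∑ b, c b * K = K := by
    rw [← Finset.sum_mul]
    have : ∑ b, c b = 1 := by
      apply NNReal.eq
      rw [NNReal.coe_sum]
      exact hu
    rw [this, one_mul]
  rw [hc] at hsum
  refine ⟨e ▸ hsum, ?_⟩
  have e2 : (∑ b, fun ω => u b * (√k * w b ω)) = fun ω => √k * ∑ b, w b ω * u b := by
    rw [e]; ext ω; simp
  have hvar := IndepFun.variance_sum (μ := μ) (s := Finset.univ)
    (X := fun b ω => u b * (√k * w b ω)) (fun b _ => (hsub b).memLp 2)
    fun i _ j _ hij => hind'.indepFun hij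
  rw [e2, variance_of_integral_eq_zero (by fun_prop)] at hvar
  · rw [hvar, ← hu]
    refine Finset.sum_congr rfl fun b _ => ?_
    rw [variance_const_mul, variance_const_mul, (hw b).variance_eq, Real.sq_sqrt (by positivity)]
    have : (k : ℝ) ≠ 0 := by positivity
    field_simp
  · rw [e, integral_finsetSum _ fun b _ => (hsub b).integrable]
    refine Finset.sum_eq_zero fun b _ => ?_
    rw [integral_const_mul, integral_const_mul, (hw b).mean_zero]
    simp

lemma exists_unit_vector {n : ℕ} (hn : 0 < n) (t : Fin n → ℝ) :
    ∃ (u : Fin n → ℝ) (s : ℝ), ∑ b, u b ^ 2 = 1 ∧ ∀ b, t b = s * u b := by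
  by_cases h : ∑ b, t b ^ 2 = 0
  -- A zero vector has scale 0, and then any unit vector serves.
  · refine ⟨Pi.single ⟨0, hn⟩ 1, 0, ?_, fun b => ?_⟩
    · simp [Pi.single_apply]
    · rw [Finset.sum_eq_zero_iff_of_nonneg fun _ _ => sq_nonneg _] at h
      simpa using h b
  · have h0 : 0 < ∑ b, t b ^ 2 := lt_of_le_of_ne (Finset.sum_nonneg fun _ _ => sq_nonneg _) (Ne.symm h)
    refine ⟨fun b => t b / √(∑ b, t b ^ 2), √(∑ b, t b ^ 2), ?_, fun b => ?_⟩
    · simp_rw [div_pow]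
      rw [← Finset.sum_div, Real.sq_sqrt h0.le, div_self h]
    · rw [mul_div_cancel₀]
      positivity

/-- The moment generating function of the normalized contribution of one row. -/
lemma mgf_row_le {m n : ℕ} (hm : 0 < m) {β : Type*} [Fintype β] {K : ℝ≥0} (hK : 1 ≤ K)
    {w : Fin n → S → ℝ} (hind : iIndepFun w μ) (hw : ∀ b, IsNormalizedSubgaussian μ K m (w b))
    {T : Matrix (Fin n) β ℝ} (hT : 0 < frobSq T) {l : ℝ} (hl : |l| ≤ 1 / (8 * K)) :
    Integrable (fun ω => Real.exp (l * (m * (∑ c, (∑ b, w b ω * T b c) ^ 2) / frobSq T - 1))) μ ∧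
      mgf (fun ω => m * (∑ c, (∑ b, w b ω * T b c) ^ 2) / frobSq T - 1) μ l ≤
        Real.exp (512 * K ^ 2 * l ^ 2) := by
  have := hind.isProbabilityMeasure
  have hmeas := fun b => (hw b).measurable
  have hn : 0 < n := by
    rcases Nat.eq_zero_or_pos n with rfl | h
    · simp [frobSq] at hT
    · exact h
  choose u s hu hs using fun c => exists_unit_vector hn fun b => T b c
  have hτ : frobSq T = ∑ c, s c ^ 2 := by
    rw [frobSq, Finset.sum_comm]
    refine Finset.sum_congr rfl fun c _ => ?_
    simp_rw [hs c, mul_pow]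
    rw [← Finset.mul_sum, hu, mul_one]
  set g : β → S → ℝ := fun c ω => √m * ∑ b, w b ω * u c b with hg
  have hgm : ∀ c, Measurable (g c) := fun c => by fun_prop
  have hgs := fun c => IsNormalizedSubgaussian.linear_combination hm hind hw (hu c)
  have hgi := fun c => integrable_exp_mul_sq_sub_one hK (hgm c) (hgs c).1 (hgs c).2 hl
  -- The columns contribute with weights proportional to their squared norms, so the exponent is a
  -- convex combination of the terms `l * (g c ^ 2 - 1)`. Jensen for `exp` then needs no
  -- independence between columns, which all see the same row.
  set v : β → ℝ := fun c => s c ^ 2 / frobSq T with hv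
  have hv0 : ∀ c, 0 ≤ v c := fun c => by positivity
  have hv1 : ∑ c, v c = 1 := by
    rw [hv, ← Finset.sum_div, ← hτ, div_self hT.ne']
  have key : ∀ ω, l * (m * (∑ c, (∑ b, w b ω * T b c) ^ 2) / frobSq T - 1) =
      ∑ c, v c • (l * (g c ω ^ 2 - 1)) := by
    intro ω
    have h1 : ∀ c, v c • (l * (g c ω ^ 2 - 1)) =
        l * (m * (∑ b, w b ω * T b c) ^ 2 / frobSq T) - l * v c := by
      intro c
      have h2 : ∑ b, w b ω * T b c = s c * ∑ b, w b ω * u c b := by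
        rw [Finset.mul_sum]
        exact Finset.sum_congr rfl fun b _ => by rw [hs c b]; ring
      rw [h2, hg, hv, smul_eq_mul]
      simp only [mul_pow]
      rw [Real.sq_sqrt (by positivity)]
      ring
    simp_rw [h1]
    rw [Finset.sum_sub_distrib, ← Finset.mul_sum, ← Finset.mul_sum, hv1, ← Finset.sum_div,
      ← Finset.mul_sum]
    ring
  have hpt : ∀ ω, Real.exp (l * (m * (∑ c, (∑ b, w b ω * T b c) ^ 2) / frobSq T - 1)) ≤
      ∑ c, v c * Real.exp (l * (g c ω ^ 2 - 1)) := by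
    intro ω
    rw [key]
    exact convexOn_exp.map_sum_le (fun c _ => hv0 c) hv1 fun c _ => Set.mem_univ _
  have hb : Integrable (fun ω => ∑ c, v c * Real.exp (l * (g c ω ^ 2 - 1))) μ :=
    integrable_finsetSum _ fun c _ => (hgi c).1.const_mul _
  have hint : Integrable (fun ω => Real.exp (l * (m * (∑ c, (∑ b, w b ω * T b c) ^ 2) /
      frobSq T - 1))) μ := by
    refine hb.mono' (by fun_prop) (ae_of_all _ fun ω => ?_)
    rw [Real.norm_eq_abs, abs_of_pos (Real.exp_pos _)]
    exact hpt ω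
  refine ⟨hint, (integral_mono hint hb hpt).trans ?_⟩
  rw [integral_finsetSum _ fun c _ => (hgi c).1.const_mul _]
  calc ∑ c, ∫ ω, v c * Real.exp (l * (g c ω ^ 2 - 1)) ∂μ
      ≤ ∑ c, v c * Real.exp (512 * K ^ 2 * l ^ 2) := by
        refine Finset.sum_le_sum fun c _ => ?_
        rw [integral_const_mul]
        exact mul_le_mul_of_nonneg_left (hgi c).2 (hv0 c)
    _ = _ := by rw [← Finset.sum_mul, hv1, one_mul]

/-- A two-sided Chernoff bound for sums of independent sub-exponential variables. -/
lemma measure_abs_sum_ge_le {m : ℕ} {K : ℝ≥0} (hK : 1 ≤ K) {Z : Fin m → S → ℝ}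
    (hind : iIndepFun Z μ) (hZ : ∀ a, Measurable (Z a))
    (hmgf : ∀ a (l : ℝ), |l| ≤ 1 / (8 * K) → Integrable (fun ω => Real.exp (l * Z a ω)) μ ∧
      mgf (Z a) μ l ≤ Real.exp (512 * K ^ 2 * l ^ 2))
    {η : ℝ} (hη : 0 < η) (hη1 : η ≤ 1) :
    μ {ω | η * m ≤ |∑ a, Z a ω|} ≤
      ENNReal.ofReal (2 * Real.exp (-(η ^ 2 * m / (2048 * K ^ 2)))) := by
  have := hind.isProbabilityMeasure
  have hK1 : (1 : ℝ) ≤ K := hK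
  -- The minimizer of `-l η + 512 K² l²`; the minimum is `-η² / (2048 K²)`. The bounds `η ≤ 1 ≤ K`
  -- keep `l` in the admissible range.
  set l := η / (1024 * K ^ 2) with hl
  have hl0 : 0 < l := by positivity
  have hlb : l ≤ 1 / (8 * K) := by
    rw [hl, div_le_div_iff₀ (by positivity) (by positivity)]
    nlinarith
  have hB : ∀ t : ℝ, |t| ≤ 1 / (8 * K) → Integrable (fun ω => Real.exp (t * (∑ a, Z a) ω)) μ ∧
      mgf (∑ a, Z a) μ t ≤ Real.exp (m * (512 * K ^ 2 * t ^ 2)) := by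
    intro t ht
    refine ⟨hind.integrable_exp_mul_sum hZ fun a _ => (hmgf a t ht).1, ?_⟩
    rw [hind.mgf_sum hZ]
    calc ∏ a, mgf (Z a) μ t ≤ ∏ _a : Fin m, Real.exp (512 * K ^ 2 * t ^ 2) :=
          Finset.prod_le_prod (fun a _ => mgf_nonneg) fun a _ => (hmgf a t ht).2
      _ = _ := by simp [← Real.exp_nat_mul]
  have hexp : Real.exp (-l * (η * m)) * Real.exp (m * (512 * K ^ 2 * l ^ 2)) =
      Real.exp (-(η ^ 2 * m / (2048 * K ^ 2))) := by
    rw [← Real.exp_add, hl]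
    congr 1
    field_simp
    ring
  have h1 := measure_ge_le_exp_mul_mgf (η * m) hl0.le (hB l (by rwa [abs_of_pos hl0])).1
  have h2 := measure_le_le_exp_mul_mgf (-(η * m)) (neg_nonpos.2 hl0.le)
    (hB (-l) (by rwa [abs_neg, abs_of_pos hl0])).1
  have h1' := h1.trans (mul_le_mul_of_nonneg_left (hB l (by rwa [abs_of_pos hl0])).2
    (Real.exp_pos _).le)
  have h2' := h2.trans (mul_le_mul_of_nonneg_left (hB (-l) (by rwa [abs_neg, abs_of_pos hl0])).2
    (Real.exp_pos _).le)
  rw [hexp] at h1'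
  rw [neg_sq, show -(-l) * -(η * m) = -l * (η * m) by ring, hexp] at h2'
  have hsub : {ω | η * m ≤ |∑ a, Z a ω|} ⊆
      {ω | η * m ≤ (∑ a, Z a) ω} ∪ {ω | (∑ a, Z a) ω ≤ -(η * m)} := by
    intro ω hω
    simp only [Set.mem_ofPred_eq, Set.mem_union, Finset.sum_apply] at hω ⊢
    rcases le_abs.1 hω with h | h
    · exact Or.inl h
    · exact Or.inr (by linarith)
  refine (measure_mono hsub).trans ((measure_union_le _ _).trans ?_)
  rw [two_mul, ENNReal.ofReal_add (by positivity) (by positivity)]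
  refine add_le_add ?_ ?_ <;>
    rw [← ofReal_measureReal] <;> apply ENNReal.ofReal_le_ofReal <;> assumption

/-- The squared Frobenius norm of a fixed matrix is preserved by a random sub-gaussian matrix. -/
theorem frobSq_mul_concentration {m n : ℕ} (hm : 0 < m) {β : Type*} [Fintype β] {K : ℝ≥0}
    (hK : 1 ≤ K) {W : S → Matrix (Fin m) (Fin n) ℝ}
    (hind : iIndepFun (fun (p : Fin m × Fin n) ω => W ω p.1 p.2) μ)
    (hW : ∀ a b, IsNormalizedSubgaussian μ K m fun ω => W ω a b)
    (T : Matrix (Fin n) β ℝ) {η : ℝ} (hη : 0 < η) (hη1 : η ≤ 1) :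
    μ {ω | η * frobSq T < |frobSq (W ω * T) - frobSq T|} ≤
      ENNReal.ofReal (2 * Real.exp (-(η ^ 2 * m / (2048 * K ^ 2)))) := by
  have hm' : (0 : ℝ) < m := by exact_mod_cast hm
  -- For `T = 0` the event is empty because its inequality is strict; otherwise one may divide by
  -- `frobSq T`.
  rcases (frobSq_nonneg T).eq_or_lt with h0 | hT
  · have hTz : T = 0 := frobSq_eq_zero h0.symm
    subst hTz
    simp [frobSq]
  · have hmeas := fun a b => (hW a b).measurable
    have hrow := iIndepFun_rows (W := fun a b ω => W ω a b) hmeas hind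
    set F : (Fin n → ℝ) → ℝ := fun y =>
      m * (∑ c, (∑ b, y b * T b c) ^ 2) / frobSq T - 1 with hF
    have hZind : iIndepFun (fun a ω => F fun b => W ω a b) μ :=
      hrow.comp (fun _ => F) fun _ => by fun_prop
    refine le_trans (measure_mono ?_) (measure_abs_sum_ge_le hK hZind
      (fun a => by simp only [hF]; fun_prop)
      (fun a l hl => mgf_row_le hm hK (w := fun b ω => W ω a b)
        (hind.precomp (g := fun b => (a, b)) fun b c hbc => by simpa using hbc) (hW a) hT hl)
      hη hη1)
    intro ω hω
    simp only [Set.mem_ofPred_eq] at hω ⊢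
    have e : ∑ a, F (fun b => W ω a b) = m / frobSq T * (frobSq (W ω * T) - frobSq T) := by
      simp only [hF]
      rw [Finset.sum_sub_distrib, ← Finset.sum_div, ← Finset.mul_sum, mul_sub,
        div_mul_cancel₀ _ hT.ne']
      have e1 : frobSq (W ω * T) = ∑ a, ∑ c, (∑ b, W ω a b * T b c) ^ 2 := rfl
      rw [e1]
      simp only [Finset.sum_const, Finset.card_univ, Fintype.card_fin, nsmul_eq_mul, mul_one]
      ring
    rw [e, abs_mul, abs_of_pos (by positivity), div_mul_eq_mul_div, le_div_iff₀ hT]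
    nlinarith

/-! ### Conditioning on independent coordinates -/

/-- If an event has probability at most `p` once the coordinates outside `F` are frozen at any
values, then it has probability at most `p`. -/
lemma measure_le_of_forall_piecewise {ι : Type*} [Fintype ι] {ξ : ι → S → ℝ}
    (hind : iIndepFun ξ μ) (hξ : ∀ i, Measurable (ξ i)) (F : Set ι)
    [DecidablePred (· ∈ F)] {B : Set (ι → ℝ)}
    (hB : MeasurableSet B) {p : ENNReal}
    (h : ∀ x : ι → ℝ, μ {ω | F.piecewise (fun i => ξ i ω) x ∈ B} ≤ p) :
    μ {ω | (fun i => ξ i ω) ∈ B} ≤ p := by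
  have := hind.isProbabilityMeasure
  have hprob : ∀ i, IsProbabilityMeasure (μ.map (ξ i)) :=
    fun i => Measure.isProbabilityMeasure_map (hξ i).aemeasurable
  have hm : Measurable fun ω i => ξ i ω := by fun_prop
  have hlaw := (iIndepFun_iff_map_fun_eq_pi_map fun i => (hξ i).aemeasurable).1 hind
  set P := Measure.pi fun i => μ.map (ξ i) with hP
  -- Splicing two independent copies of the family along `F` reproduces the product law, so Fubini
  -- integrates first over the copy that keeps the coordinates in `F`.
  let G : (ι → ℝ) × (ι → ℝ) → ι → ℝ := fun z => F.piecewise z.2 z.1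
  have hG : Measurable G := by
    refine measurable_pi_lambda _ fun i => ?_
    by_cases hi : i ∈ F
    · simp only [G, Set.piecewise_eq_of_mem _ _ _ hi]; fun_prop
    · simp only [G, Set.piecewise_eq_of_notMem _ _ _ hi]; fun_prop
  have hGP : (P.prod P).map G = P := by
    refine (Measure.pi_eq fun s hs => ?_).symm
    rw [Measure.map_apply hG (MeasurableSet.univ_pi hs)]
    have e : G ⁻¹' (Set.univ.pi s) =
        (Set.univ.pi fun i => if i ∈ F then Set.univ else s i) ×ˢ
          (Set.univ.pi fun i => if i ∈ F then s i else Set.univ) := by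
      ext z
      simp only [Set.mem_preimage, Set.mem_pi, Set.mem_univ, true_implies, Set.mem_prod, G,
        ← forall_and]
      refine forall_congr' fun i => ?_
      by_cases hi : i ∈ F <;> simp [hi]
    rw [e, Measure.prod_prod, Measure.pi_pi, Measure.pi_pi, ← Finset.prod_mul_distrib]
    refine Finset.prod_congr rfl fun i _ => ?_
    by_cases hi : i ∈ F <;> simp [hi]
  have h1 : μ {ω | (fun i => ξ i ω) ∈ B} = P B := by
    rw [← hlaw, Measure.map_apply hm hB]; rfl
  rw [h1, ← hGP, Measure.map_apply hG hB, Measure.prod_apply (hG hB)]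
  have h2 : ∀ x, P (Prod.mk x ⁻¹' (G ⁻¹' B)) ≤ p := by
    intro x
    rw [← hlaw, Measure.map_apply hm (measurable_prodMk_left (hG hB))]
    exact h x
  calc ∫⁻ x, P (Prod.mk x ⁻¹' (G ⁻¹' B)) ∂P ≤ ∫⁻ _x, p ∂P := lintegral_mono h2
    _ = p := by simp

/-! ### Kronecker products of random matrices -/

/-- The matrix formed by the coordinates of `x` at the indices `e`. -/
def coordMatrix {ι : Type*} {m n : ℕ} (e : Fin m × Fin n → ι) (x : ι → ℝ) :
    Matrix (Fin m) (Fin n) ℝ :=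
  Matrix.of fun a b => x (e (a, b))

lemma measurable_frobSq {α β Ω : Type*} [Fintype α] [Fintype β] [MeasurableSpace Ω]
    {A : Ω → Matrix α β ℝ} (hA : ∀ a b, Measurable fun ω => A ω a b) :
    Measurable fun ω => frobSq (A ω) :=
  Finset.measurable_sum _ fun a _ => Finset.measurable_sum _ fun b _ => (hA a b).pow_const 2

lemma measurable_mul_apply {α β γ Ω : Type*} [Fintype β] [MeasurableSpace Ω]
    {A : Ω → Matrix α β ℝ} {B : Ω → Matrix β γ ℝ} (hA : ∀ a b, Measurable fun ω => A ω a b)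
    (hB : ∀ a b, Measurable fun ω => B ω a b) (a : α) (c : γ) :
    Measurable fun ω => (A ω * B ω) a c :=
  Finset.measurable_sum _ fun b _ => (hA a b).mul (hB b c)

lemma measurable_kroneckerFamily_apply {κ Ω : Type*} [Fintype κ] [MeasurableSpace Ω] {p q : ℕ}
    {A : Ω → κ → Matrix (Fin p) (Fin q) ℝ} (hA : ∀ k a b, Measurable fun ω => A ω k a b)
    (a : κ → Fin p) (b : κ → Fin q) :
    Measurable fun ω => kroneckerFamily (A ω) a b :=
  Finset.measurable_prod _ fun k _ => hA k _ _

/-- The first Kronecker factor acts on the first mode only. Moving all other indices into the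
columns turns it into a left multiplication of the matrix already compressed by the remaining
factors. -/
lemma frobSq_mul_kroneckerFamily_succ {q m n : ℕ} {β : Type*} [Fintype β]
    (A : Fin (q + 1) → Matrix (Fin m) (Fin n) ℝ) (X : Matrix β (Fin (q + 1) → Fin n) ℝ) :
    frobSq (X * (kroneckerFamily A).transpose) =
      frobSq (A 0 * Matrix.of fun (a : Fin n) (c : β × (Fin q → Fin m)) =>
        ((Matrix.of fun (p : β × Fin n) (f : Fin q → Fin n) => X p.1 (Fin.cons p.2 f)) *
          (kroneckerFamily fun k : Fin q => A k.succ).transpose) (c.1, a) c.2) := by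
  have e1 : ∀ (b : β) (a : Fin m) (g : Fin q → Fin m),
      (X * (kroneckerFamily A).transpose) b (Fin.cons a g) =
      (A 0 * Matrix.of fun (a : Fin n) (c : β × (Fin q → Fin m)) =>
        ((Matrix.of fun (p : β × Fin n) (f : Fin q → Fin n) => X p.1 (Fin.cons p.2 f)) *
          (kroneckerFamily fun k : Fin q => A k.succ).transpose) (c.1, a) c.2) a (b, g) := by
    intro b a g
    simp only [Matrix.mul_apply, Matrix.transpose_apply, kroneckerFamily, Matrix.of_apply,
      Finset.mul_sum]
    rw [← Fintype.sum_prod_type',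
      ← (Fin.consEquiv fun _ : Fin (q + 1) => Fin n).sum_comp]
    refine Finset.sum_congr rfl fun z _ => ?_
    simp only [Fin.consEquiv, Equiv.coe_fn_mk, Fin.prod_univ_succ, Fin.cons_zero, Fin.cons_succ]
    ring
  rw [frobSq, frobSq, Finset.sum_comm, ← (Fin.consEquiv fun _ : Fin (q + 1) => Fin m).sum_comp,
    Fintype.sum_prod_type]
  refine Finset.sum_congr rfl fun a _ => ?_
  rw [Fintype.sum_prod_type, Finset.sum_comm]
  refine Finset.sum_congr rfl fun b _ => Finset.sum_congr rfl fun g _ => ?_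
  rw [← e1]
  rfl

lemma frobSq_cons {q n : ℕ} {β : Type*} [Fintype β] (X : Matrix β (Fin (q + 1) → Fin n) ℝ) :
    frobSq (Matrix.of fun (p : β × Fin n) (f : Fin q → Fin n) => X p.1 (Fin.cons p.2 f)) =
      frobSq X := by
  rw [frobSq, frobSq, Fintype.sum_prod_type]
  refine Finset.sum_congr rfl fun b _ => ?_
  rw [← (Fin.consEquiv fun _ : Fin (q + 1) => Fin n).sum_comp, Fintype.sum_prod_type]
  rfl

lemma frobSq_regroup {α β γ : Type*} [Fintype α] [Fintype β] [Fintype γ]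
    (Y : Matrix (β × α) γ ℝ) :
    frobSq (Matrix.of fun (a : α) (c : β × γ) => Y (c.1, a) c.2) = frobSq Y := by
  rw [frobSq, frobSq, Fintype.sum_prod_type]
  simp_rw [Fintype.sum_prod_type]
  exact Finset.sum_comm

open scoped Classical in
/-- The squared Frobenius norm of a fixed matrix is preserved by a Kronecker product of `q`
independent sub-gaussian matrices. -/
theorem kroneckerFamily_concentration {ι : Type*} [Fintype ι] {ξ : ι → S → ℝ}
    (hind : iIndepFun ξ μ) (hξ : ∀ i, Measurable (ξ i)) {K : ℝ≥0} (hK : 1 ≤ K)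
    {m n : ℕ} (hm : 0 < m) {η : ℝ} (hη : 0 < η) (hη1 : η ≤ 1) (q : ℕ) :
    ∀ {β : Type} [Fintype β] (e : Fin q → Fin m × Fin n → ι)
      (_ : Function.Injective fun z : Fin q × (Fin m × Fin n) => e z.1 z.2)
      (_ : ∀ k z, IsNormalizedSubgaussian μ K m (ξ (e k z)))
      (X : Matrix β (Fin q → Fin n) ℝ),
      μ {ω | ((1 + η) ^ q - 1) * frobSq X <
          |frobSq (X * (kroneckerFamily fun k =>
            coordMatrix (e k) fun i => ξ i ω).transpose) - frobSq X|} ≤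
        q * ENNReal.ofReal (2 * Real.exp (-(η ^ 2 * m / (2048 * K ^ 2)))) := by
  induction q with
  | zero =>
    intro β _ e _ _ X
    have : ∀ ω, frobSq (X * (kroneckerFamily fun k =>
        coordMatrix (e k) fun i => ξ i ω).transpose) = frobSq X := by
      intro ω
      simp only [frobSq]
      refine Finset.sum_congr rfl fun b _ => ?_
      rw [Fintype.sum_unique, Fintype.sum_unique, Matrix.mul_apply, Fintype.sum_unique]
      simp [kroneckerFamily]
    simp [this]
  | succ q ih =>
    -- The row type varies in the induction: peeling off a factor moves its mode into the rows.
    intro β _ e he hs X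
    set p := ENNReal.ofReal (2 * Real.exp (-(η ^ 2 * m / (2048 * K ^ 2))))
    set X' : Matrix (β × Fin n) (Fin q → Fin n) ℝ :=
      Matrix.of fun (p : β × Fin n) (f : Fin q → Fin n) => X p.1 (Fin.cons p.2 f) with hX'
    let Y : (ι → ℝ) → Matrix (β × Fin n) (Fin q → Fin m) ℝ := fun x =>
      X' * (kroneckerFamily fun k : Fin q => coordMatrix (e k.succ) x).transpose
    let T : (ι → ℝ) → Matrix (Fin n) (β × (Fin q → Fin m)) ℝ := fun x =>
      Matrix.of fun a c => Y x (c.1, a) c.2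
    let B : Set (ι → ℝ) := {x | η * frobSq (T x) <
      |frobSq (coordMatrix (e 0) x * T x) - frobSq (T x)|}
    have hcoord : ∀ k a b, Measurable fun x : ι → ℝ => coordMatrix (e k) x a b :=
      fun k a b => measurable_pi_apply _
    have hTm : ∀ a c, Measurable fun x => T x a c := fun a c =>
      measurable_mul_apply (A := fun _ => X') (fun _ _ => measurable_const)
        (fun f g => measurable_kroneckerFamily_apply
          (A := fun x (k : Fin q) => coordMatrix (e k.succ) x)
          (fun k a b => hcoord k.succ a b) g f) (c.1, a) c.2
    have hB : MeasurableSet B :=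
      measurableSet_lt ((measurable_frobSq hTm).const_mul _)
        (((measurable_frobSq (measurable_mul_apply (hcoord 0) hTm)).sub
          (measurable_frobSq hTm)).abs)
    have h1 := ih (fun k => e k.succ) (fun z w hzw => by
      have := @he (z.1.succ, z.2) (w.1.succ, w.2) hzw
      simpa [Prod.ext_iff] using this) (fun k z => hs _ _) X'
    have h2 : μ {ω | (fun i => ξ i ω) ∈ B} ≤ p := by
      -- By injectivity of `e` the matrix `T` uses no entry of the first factor, so it is constant
      -- once the coordinates outside the range of `e 0` are frozen.
      refine measure_le_of_forall_piecewise hind hξ (Set.range (e 0)) hB fun x => ?_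
      have hT : ∀ y, T ((Set.range (e 0)).piecewise y x) = T x := by
        intro y
        have : ∀ k : Fin q, coordMatrix (e k.succ) ((Set.range (e 0)).piecewise y x) =
            coordMatrix (e k.succ) x := by
          intro k
          ext a b
          simp only [coordMatrix, Matrix.of_apply]
          refine Set.piecewise_eq_of_notMem _ _ _ ?_
          rintro ⟨z, hz⟩
          have := @he (0, z) (k.succ, (a, b)) hz
          exact (Fin.succ_ne_zero k (Prod.ext_iff.1 this).1.symm)
        simp only [T, Y, this]
      have hC : ∀ y, coordMatrix (e 0) ((Set.range (e 0)).piecewise y x) =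
          coordMatrix (e 0) y := by
        intro y
        ext a b
        simp only [coordMatrix, Matrix.of_apply]
        exact Set.piecewise_eq_of_mem _ _ _ ⟨_, rfl⟩
      have hinj : Function.Injective (e 0) := fun z w hzw => by
        simpa using @he (0, z) (0, w) hzw
      have := frobSq_mul_concentration hm hK (W := fun ω => coordMatrix (e 0) fun i => ξ i ω)
        (hind.precomp hinj) (fun a b => hs 0 (a, b)) (T x) hη hη1
      refine le_trans (measure_mono fun ω hω => ?_) this
      simp only [B, Set.mem_ofPred_eq] at hω ⊢
      rwa [hT, hC] at hω
    -- The errors compose through `(1 + η) ^ (q + 1) - 1 = η (1 + η) ^ q + ((1 + η) ^ q - 1)`.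
    have hsub : {ω | ((1 + η) ^ (q + 1) - 1) * frobSq X <
          |frobSq (X * (kroneckerFamily fun k =>
            coordMatrix (e k) fun i => ξ i ω).transpose) - frobSq X|} ⊆
        {ω | ((1 + η) ^ q - 1) * frobSq X' <
          |frobSq (X' * (kroneckerFamily fun k : Fin q =>
            coordMatrix (e k.succ) fun i => ξ i ω).transpose) - frobSq X'|} ∪
        {ω | (fun i => ξ i ω) ∈ B} := by
      intro ω hω
      by_contra hn
      simp only [Set.mem_union, Set.mem_ofPred_eq, not_or, not_lt, B] at hn hω
      obtain ⟨hn1, hn2⟩ := hn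
      rw [frobSq_mul_kroneckerFamily_succ] at hω
      have hr : frobSq (T fun i => ξ i ω) = frobSq (Y fun i => ξ i ω) := frobSq_regroup _
      rw [frobSq_cons] at hn1
      rw [hr] at hn2
      change |frobSq (Y fun i => ξ i ω) - frobSq X| ≤ _ at hn1
      change _ < |frobSq (coordMatrix (e 0) (fun i => ξ i ω) * T fun i => ξ i ω) - _| at hω
      refine absurd hω (not_lt.2 ?_)
      have h3 := abs_sub_le (frobSq (coordMatrix (e 0) (fun i => ξ i ω) * T fun i => ξ i ω))
        (frobSq (Y fun i => ξ i ω)) (frobSq X)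
      have h4 := (abs_le.1 hn1).2
      have h5 : η * frobSq (Y fun i => ξ i ω) ≤ η * ((1 + η) ^ q * frobSq X) := by
        gcongr; linarith
      calc _ ≤ _ := h3
        _ ≤ η * ((1 + η) ^ q * frobSq X) + ((1 + η) ^ q - 1) * frobSq X := by linarith
        _ = _ := by ring
    refine (measure_mono hsub).trans ((measure_union_le _ _).trans ?_)
    rw [Nat.cast_succ, add_mul, one_mul]
    exact add_le_add h1 h2

/-! ### Random matrices that preserve norms of fixed vectors -/

/-- The random matrix `A` preserves the squared norm of every fixed vector up to a factor
`1 ± η`, except on an event of probability at most `p`. -/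
def IsJL {κ κ' : Type*} [Fintype κ] [Fintype κ'] (μ : Measure S) (A : S → Matrix κ' κ ℝ) (η : ℝ)
    (p : ENNReal) : Prop :=
  ∀ x : κ → ℝ, μ {ω | η * (x ⬝ᵥ x) < |(A ω *ᵥ x) ⬝ᵥ (A ω *ᵥ x) - x ⬝ᵥ x|} ≤ p

lemma dotProduct_self_nonneg' {κ : Type*} [Fintype κ] (x : κ → ℝ) : 0 ≤ x ⬝ᵥ x :=
  Finset.sum_nonneg fun i _ => mul_self_nonneg (x i)

lemma frobSq_eq_sum_dotProduct {κ α : Type*} [Fintype κ] [Fintype α] (U : Matrix κ α ℝ) :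
    frobSq U = ∑ a, (U.col a) ⬝ᵥ (U.col a) := by
  rw [frobSq, Finset.sum_comm]
  simp [dotProduct, Matrix.col, sq]

section IsJL

variable {κ κ' : Type*} [Fintype κ] [Fintype κ'] {A : S → Matrix κ' κ ℝ} {η : ℝ} {p : ENNReal}

/-- Polarization applied to `t • x ± s • y` with `s = ‖x‖` and `t = ‖y‖`. This balancing makes the
two squared norms sum to `4 s² t²`, so the error in the inner product is `η s t`; the two vectors
account for `2 * p`. -/
lemma IsJL.pair (h : IsJL μ A η p) (x y : κ → ℝ) :
    μ {ω | η ^ 2 * ((x ⬝ᵥ x) * (y ⬝ᵥ y)) < ((A ω *ᵥ x) ⬝ᵥ (A ω *ᵥ y) - x ⬝ᵥ y) ^ 2} ≤ 2 * p := by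
  by_cases hx : x = 0
  · subst hx; simp
  by_cases hy : y = 0
  · subst hy; simp
  have hx0 : 0 < x ⬝ᵥ x := lt_of_le_of_ne (dotProduct_self_nonneg' x)
    fun h => hx (dotProduct_self_eq_zero.1 h.symm)
  have hy0 : 0 < y ⬝ᵥ y := lt_of_le_of_ne (dotProduct_self_nonneg' y)
    fun h => hy (dotProduct_self_eq_zero.1 h.symm)
  set s := √(x ⬝ᵥ x) with hs
  set t := √(y ⬝ᵥ y) with ht
  have hs0 : 0 < s := Real.sqrt_pos.2 hx0
  have ht0 : 0 < t := Real.sqrt_pos.2 hy0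
  have hs2 : s ^ 2 = x ⬝ᵥ x := Real.sq_sqrt hx0.le
  have ht2 : t ^ 2 = y ⬝ᵥ y := Real.sq_sqrt hy0.le
  refine (measure_mono ?_).trans ((measure_union_le _ _).trans
    ((add_le_add (h (t • x + s • y)) (h (t • x - s • y))).trans (two_mul p).ge))
  intro ω hω
  by_contra hn
  simp only [Set.mem_union, Set.mem_ofPred_eq, not_or, not_lt] at hn hω
  obtain ⟨h1, h2⟩ := hn
  refine absurd hω (not_lt.2 ?_)
  simp only [Matrix.mulVec_add, Matrix.mulVec_sub, Matrix.mulVec_smul, dotProduct_add,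
    add_dotProduct, dotProduct_sub, sub_dotProduct, dotProduct_smul, smul_dotProduct,
    smul_eq_mul] at h1 h2
  rw [dotProduct_comm y x, dotProduct_comm (A ω *ᵥ y) (A ω *ᵥ x), ← hs2, ← ht2] at h1 h2
  rw [← hs2, ← ht2]
  set b := (A ω *ᵥ x) ⬝ᵥ (A ω *ᵥ y) - x ⬝ᵥ y with hb
  rw [abs_le] at h1 h2
  have hst : 0 < s * t := mul_pos hs0 ht0
  have h3 : (s * t) * b ≤ (s * t) * (η * (s * t)) := by
    rw [hb]; nlinarith [h1.2, h2.1]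
  have h4 : (s * t) * (-b) ≤ (s * t) * (η * (s * t)) := by
    rw [hb]; nlinarith [h1.1, h2.2]
  have h5 := le_of_mul_le_mul_left h3 hst
  have h6 := le_of_mul_le_mul_left h4 hst
  calc b ^ 2 ≤ (η * (s * t)) ^ 2 := sq_le_sq' (by linarith) h5
    _ = _ := by ring

lemma IsJL.frobSq_mul (h : IsJL μ A η p) {α : Type*} [Fintype α] (U : Matrix κ α ℝ) :
    μ {ω | η * frobSq U < |frobSq (A ω * U) - frobSq U|} ≤ Fintype.card α * p := by
  calc _ ≤ μ (⋃ a ∈ (Finset.univ : Finset α), {ω | η * (U.col a ⬝ᵥ U.col a) <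
        |(A ω *ᵥ U.col a) ⬝ᵥ (A ω *ᵥ U.col a) - U.col a ⬝ᵥ U.col a|}) := by
        refine measure_mono fun ω hω => ?_
        by_contra hn
        simp only [Set.mem_iUnion, Set.mem_ofPred_eq, not_exists, not_lt] at hn hω
        refine absurd hω (not_lt.2 ?_)
        rw [frobSq_eq_sum_dotProduct, frobSq_eq_sum_dotProduct, ← Finset.sum_sub_distrib,
          Finset.mul_sum]
        refine (Finset.abs_sum_le_sum_abs _ _).trans (Finset.sum_le_sum fun a ha => ?_)
        exact hn a ha
    _ ≤ ∑ a : α, p := (measure_biUnion_finset_le _ _).trans (Finset.sum_le_sum fun a _ => h _)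
    _ = _ := by simp

/-- The entries are inner products of pairs of columns, and the entrywise bounds sum to the product
of the two Frobenius norms. -/
lemma IsJL.approx_mul (h : IsJL μ A η p) {α β : Type*} [Fintype α] [Fintype β]
    (U : Matrix κ α ℝ) (V : Matrix κ β ℝ) :
    μ {ω | η ^ 2 * (frobSq U * frobSq V) < frobSq ((A ω * U)ᵀ * (A ω * V) - Uᵀ * V)} ≤
      Fintype.card α * Fintype.card β * (2 * p) := by
  calc _ ≤ μ (⋃ z ∈ (Finset.univ : Finset (α × β)),
        {ω | η ^ 2 * ((U.col z.1 ⬝ᵥ U.col z.1) * (V.col z.2 ⬝ᵥ V.col z.2)) <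
          ((A ω *ᵥ U.col z.1) ⬝ᵥ (A ω *ᵥ V.col z.2) - U.col z.1 ⬝ᵥ V.col z.2) ^ 2}) := by
        refine measure_mono fun ω hω => ?_
        by_contra hn
        simp only [Set.mem_iUnion, Set.mem_ofPred_eq, not_exists, not_lt] at hn hω
        refine absurd hω (not_lt.2 ?_)
        rw [frobSq_eq_sum_dotProduct U, frobSq_eq_sum_dotProduct V, Finset.sum_mul_sum,
          Finset.mul_sum]
        refine Finset.sum_le_sum fun a _ => ?_
        rw [Finset.mul_sum]
        exact Finset.sum_le_sum fun b _ => hn (a, b) (Finset.mem_univ _)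
    _ ≤ ∑ _z : α × β, 2 * p :=
        (measure_biUnion_finset_le _ _).trans (Finset.sum_le_sum fun z _ => h.pair _ _)
    _ = _ := by simp [Fintype.card_prod]

end IsJL

/-! ### A net of the Euclidean unit ball -/

/-- Counting by exponential weights: every counted point has weight `2 ^ (16 r - ∑)` at least 1, and
the total weight factorizes over coordinates. Each coordinate contributes at most 4, a geometric sum
times two signs, and `2 ^ 18 ≤ 12 ^ 6`. -/
lemma card_filter_sum_le (r : ℕ) :
    (Finset.univ.filter fun g : Fin r → Fin (16 * r + 1) × Bool =>
      ∑ i, ((g i).1 : ℕ) ≤ 16 * r).card ≤ 12 ^ (6 * r) := by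
  have h2 : ∑ z : Fin (16 * r + 1) × Bool, ((1 : ℝ) / 2) ^ (z.1 : ℕ) ≤ 4 := by
    rw [Fintype.sum_prod_type]
    simp only [Finset.sum_const, Finset.card_univ, Fintype.card_bool, nsmul_eq_mul]
    rw [← Finset.mul_sum, Fin.sum_univ_eq_sum_range (fun a => ((1 : ℝ) / 2) ^ a)]
    have := sum_geometric_two_le (16 * r + 1)
    push_cast
    linarith
  have h3 : ((Finset.univ.filter fun g : Fin r → Fin (16 * r + 1) × Bool =>
      ∑ i, ((g i).1 : ℕ) ≤ 16 * r).card : ℝ) ≤ 2 ^ (16 * r) * 4 ^ r := by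
    calc _ = ∑ g ∈ Finset.univ.filter fun g : Fin r → Fin (16 * r + 1) × Bool =>
          ∑ i, ((g i).1 : ℕ) ≤ 16 * r, (1 : ℝ) := by simp
      _ ≤ ∑ g ∈ Finset.univ.filter fun g : Fin r → Fin (16 * r + 1) × Bool =>
          ∑ i, ((g i).1 : ℕ) ≤ 16 * r, 2 ^ (16 * r) * ∏ i, ((1 : ℝ) / 2) ^ ((g i).1 : ℕ) := by
          refine Finset.sum_le_sum fun g hg => ?_
          rw [Finset.prod_pow_eq_pow_sum, one_div, inv_pow, ← div_eq_mul_inv,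
            one_le_div (by positivity)]
          exact pow_le_pow_right₀ one_le_two (Finset.mem_filter.1 hg).2
      _ ≤ ∑ g : Fin r → Fin (16 * r + 1) × Bool,
            2 ^ (16 * r) * ∏ i, ((1 : ℝ) / 2) ^ ((g i).1 : ℕ) :=
          Finset.sum_le_sum_of_subset_of_nonneg (Finset.subset_univ _)
            fun _ _ _ => by positivity
      _ = 2 ^ (16 * r) * (∑ z : Fin (16 * r + 1) × Bool, ((1 : ℝ) / 2) ^ (z.1 : ℕ)) ^ r := by
          rw [← Finset.mul_sum, Fintype.sum_pow]
      _ ≤ _ := by gcongr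
  have h4 : (2 : ℝ) ^ (16 * r) * 4 ^ r ≤ 12 ^ (6 * r) := by
    rw [pow_mul, pow_mul, ← mul_pow]
    gcongr
    norm_num
  exact_mod_cast h3.trans h4

/-- The net is a grid of mesh `1 / (4√r)`, and points are rounded towards zero so that they stay in
the ball. The integer coordinates `k` satisfy `∑ k² ≤ 16 r`, hence `∑ |k| ≤ 16 r`, which is what the
counting lemma needs. -/
lemma exists_net (r : ℕ) : ∃ T : Finset (Fin r → ℝ), T.card ≤ 12 ^ (6 * r) ∧
    (∀ t ∈ T, t ⬝ᵥ t ≤ 1) ∧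
    ∀ y : Fin r → ℝ, y ⬝ᵥ y ≤ 1 → ∃ t ∈ T, (y - t) ⬝ᵥ (y - t) ≤ 1 / 16 := by
  classical
  rcases Nat.eq_zero_or_pos r with rfl | hr
  · exact ⟨{0}, by simp, by simp, fun y _ => ⟨0, by simp, by simp [dotProduct]⟩⟩
  have hr' : (0 : ℝ) < r := by exact_mod_cast hr
  set s : ℝ := 4 * √r with hs
  have hs0 : 0 < s := by positivity
  have hs2 : s ^ 2 = 16 * r := by rw [hs, mul_pow, Real.sq_sqrt hr'.le]; norm_num
  let pt : (Fin r → Fin (16 * r + 1) × Bool) → Fin r → ℝ := fun g i =>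
    (if (g i).2 then ((g i).1 : ℝ) else -((g i).1 : ℝ)) / s
  let T0 := (Finset.univ.filter fun g : Fin r → Fin (16 * r + 1) × Bool =>
      ∑ i, ((g i).1 : ℕ) ≤ 16 * r).image pt
  refine ⟨T0.filter fun t => t ⬝ᵥ t ≤ 1, ?_, fun t ht => (Finset.mem_filter.1 ht).2,
    fun y hy => ?_⟩
  · exact (Finset.card_filter_le _ _).trans (Finset.card_image_le.trans (card_filter_sum_le r))
  · have hfl : ∀ i, ((⌊s * |y i|⌋₊ : ℕ) : ℝ) ≤ s * |y i| := fun i =>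
      Nat.floor_le (by positivity)
    have hsq : ∑ i, (s * |y i|) ^ 2 ≤ 16 * r := by
      calc ∑ i, (s * |y i|) ^ 2 = s ^ 2 * (y ⬝ᵥ y) := by
            rw [dotProduct, Finset.mul_sum]
            exact Finset.sum_congr rfl fun i _ => by rw [mul_pow, sq_abs, sq (y i)]
        _ ≤ s ^ 2 * 1 := by gcongr
        _ = _ := by rw [mul_one, hs2]
    have hsum : ∑ i, ⌊s * |y i|⌋₊ ^ 2 ≤ 16 * r := by
      have : ((∑ i, ⌊s * |y i|⌋₊ ^ 2 : ℕ) : ℝ) ≤ (16 * r : ℕ) := by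
        push_cast
        refine le_trans (Finset.sum_le_sum fun i _ => ?_) hsq
        exact pow_le_pow_left₀ (by positivity) (hfl i) 2
      exact_mod_cast this
    have hlin : ∑ i, ⌊s * |y i|⌋₊ ≤ 16 * r :=
      (Finset.sum_le_sum fun i _ => Nat.le_self_pow two_ne_zero _).trans hsum
    have hlt : ∀ i, ⌊s * |y i|⌋₊ < 16 * r + 1 := fun i =>
      Nat.lt_succ_of_le ((Finset.single_le_sum (f := fun i => ⌊s * |y i|⌋₊)
        (fun _ _ => Nat.zero_le _) (Finset.mem_univ i)).trans hlin)
    let g : Fin r → Fin (16 * r + 1) × Bool := fun i =>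
      (⟨⌊s * |y i|⌋₊, hlt i⟩, decide (0 ≤ y i))
    have hself : pt g ⬝ᵥ pt g ≤ 1 := by
      have : pt g ⬝ᵥ pt g = ∑ i, ((⌊s * |y i|⌋₊ : ℕ) : ℝ) ^ 2 / s ^ 2 := by
        refine Finset.sum_congr rfl fun i _ => ?_
        by_cases hi : 0 ≤ y i <;> simp [pt, g, hi] <;> ring
      rw [this, ← Finset.sum_div, div_le_one (by positivity), hs2]
      exact_mod_cast hsum
    refine ⟨pt g, Finset.mem_filter.2 ⟨Finset.mem_image.2 ⟨g, ?_, rfl⟩, hself⟩, ?_⟩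
    · simpa [g] using hlin
    · have hi : ∀ i, (y - pt g) i * (y - pt g) i ≤ 1 / s ^ 2 := by
        intro i
        have h1 := hfl i
        have h2 := Nat.lt_floor_add_one (s * |y i|)
        have h3 : (y - pt g) i * (y - pt g) i =
            (s * |y i| - ((⌊s * |y i|⌋₊ : ℕ) : ℝ)) ^ 2 / s ^ 2 := by
          by_cases hi : 0 ≤ y i
          · simp only [pt, g, Pi.sub_apply, hi, decide_true, if_true, abs_of_nonneg hi]
            field_simp
          · simp only [pt, g, Pi.sub_apply, hi, decide_false, Bool.false_eq_true, if_false,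
              abs_of_neg (not_le.1 hi)]
            field_simp
            ring
        rw [h3]
        gcongr
        rw [sq_le_one_iff_abs_le_one, abs_le]
        constructor <;> linarith
      calc (y - pt g) ⬝ᵥ (y - pt g) ≤ ∑ _i : Fin r, 1 / s ^ 2 :=
            Finset.sum_le_sum fun i _ => hi i
        _ = 1 / 16 := by
            rw [hs2]; simp; field_simp

/-- Replacing each argument of the bilinear form by a net point at distance at most 1/4 gives `‖L‖ ≤
η + ‖L‖ / 2`, hence `‖L‖ ≤ 2 η`. -/
lemma abs_dotProduct_mulVec_le_of_net {r : ℕ} {T : Finset (Fin r → ℝ)}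
    (hT1 : ∀ t ∈ T, t ⬝ᵥ t ≤ 1)
    (hT : ∀ y : Fin r → ℝ, y ⬝ᵥ y ≤ 1 → ∃ t ∈ T, (y - t) ⬝ᵥ (y - t) ≤ 1 / 16)
    {E : Matrix (Fin r) (Fin r) ℝ} {η : ℝ} (hη : 0 ≤ η)
    (hE : ∀ t ∈ T, ∀ t' ∈ T, |t ⬝ᵥ (E *ᵥ t')| ≤ η) (z : Fin r → ℝ) :
    |z ⬝ᵥ (E *ᵥ z)| ≤ 2 * η * (z ⬝ᵥ z) := by
  let L : EuclideanSpace ℝ (Fin r) →L[ℝ] EuclideanSpace ℝ (Fin r) :=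
    Matrix.toEuclideanCLM (𝕜 := ℝ) E
  have hin : ∀ u v : EuclideanSpace ℝ (Fin r), inner ℝ u v = u.ofLp ⬝ᵥ v.ofLp := by
    intro u v
    simp [PiLp.inner_apply, dotProduct, mul_comm]
  have hno : ∀ u : EuclideanSpace ℝ (Fin r), u.ofLp ⬝ᵥ u.ofLp = ‖u‖ ^ 2 := by
    intro u
    rw [← hin, real_inner_self_eq_norm_sq]
  have hL : ∀ u : EuclideanSpace ℝ (Fin r), (L u).ofLp = E *ᵥ u.ofLp := fun u => rfl
  have happ : ∀ y : EuclideanSpace ℝ (Fin r), ‖y‖ ≤ 1 →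
      ∃ t : EuclideanSpace ℝ (Fin r), t.ofLp ∈ T ∧ ‖y - t‖ ≤ 1 / 4 ∧ ‖t‖ ≤ 1 := by
    intro y hy
    obtain ⟨t, ht, h1⟩ := hT y.ofLp (by rw [hno]; nlinarith [norm_nonneg y])
    refine ⟨WithLp.toLp 2 t, ht, ?_, ?_⟩
    · have h2 : ‖y - WithLp.toLp 2 t‖ ^ 2 ≤ (1 / 4) ^ 2 := by
        rw [← hno]; norm_num at h1 ⊢; exact h1
      exact (pow_le_pow_iff_left₀ (norm_nonneg _) (by norm_num) two_ne_zero).1 h2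
    · have h2 : ‖WithLp.toLp 2 t‖ ^ 2 ≤ 1 ^ 2 := by
        rw [← hno]; simpa using hT1 t ht
      exact (pow_le_pow_iff_left₀ (norm_nonneg _) (by norm_num) two_ne_zero).1 h2
  have hbil : ∀ u y : EuclideanSpace ℝ (Fin r), ‖u‖ ≤ 1 → ‖y‖ ≤ 1 →
      inner ℝ u (L y) ≤ η + ‖L‖ / 2 := by
    intro u y hu hy
    obtain ⟨t, ht, htu, ht1⟩ := happ u hu
    obtain ⟨t', ht', hty, -⟩ := happ y hy
    have e : inner ℝ u (L y) =
        inner ℝ t (L t') + inner ℝ (u - t) (L y) + inner ℝ t (L (y - t')) := by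
      rw [map_sub, inner_sub_left, inner_sub_right]; ring
    have h1 : inner ℝ t (L t') ≤ η := by
      rw [hin, hL]; exact (le_abs_self _).trans (hE _ ht _ ht')
    have h2 : inner ℝ (u - t) (L y) ≤ 1 / 4 * (‖L‖ * 1) :=
      (real_inner_le_norm _ _).trans
        (mul_le_mul htu ((L.le_opNorm y).trans (by gcongr)) (norm_nonneg _) (by norm_num))
    have h3 : inner ℝ t (L (y - t')) ≤ 1 * (‖L‖ * (1 / 4)) :=
      (real_inner_le_norm _ _).trans
        (mul_le_mul ht1 ((L.le_opNorm _).trans (by gcongr)) (norm_nonneg _) (by norm_num))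
    rw [e]; linarith
  have hunit : ∀ y : EuclideanSpace ℝ (Fin r), ‖y‖ = 1 → ‖L y‖ ≤ η + ‖L‖ / 2 := by
    intro y hy
    rcases eq_or_ne (L y) 0 with h0 | h0
    · rw [h0, norm_zero]; positivity
    · have hpos := norm_pos_iff.2 h0
      have := hbil (‖L y‖⁻¹ • L y) y (by rw [norm_smul, norm_inv, norm_norm,
        inv_mul_cancel₀ hpos.ne']) hy.le
      rw [inner_smul_left, real_inner_self_eq_norm_sq] at this
      simp only [conj_trivial] at this
      rwa [sq, inv_mul_cancel_left₀ hpos.ne'] at this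
  have hN : ‖L‖ ≤ η + ‖L‖ / 2 := L.opNorm_le_of_unit_norm (by positivity) hunit
  have hz : |inner ℝ (WithLp.toLp 2 z) (L (WithLp.toLp 2 z))| ≤
      ‖WithLp.toLp 2 z‖ * (‖L‖ * ‖WithLp.toLp 2 z‖) :=
    (abs_real_inner_le_norm _ _).trans (by gcongr; exact L.le_opNorm _)
  rw [hin, hL] at hz
  have hzz := hno (WithLp.toLp 2 z)
  simp only at hz hzz
  rw [hzz]
  nlinarith [sq_nonneg ‖WithLp.toLp 2 z‖]

/-- The form of `(A V)ᵀ (A V) - 1` is controlled on all pairs from the net. There are at most `12 ^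
(12 r)` pairs, and passing from the net to the whole space doubles `η`. -/
lemma IsJL.subspace_embedding {κ κ' : Type*} [Fintype κ] [Fintype κ'] {A : S → Matrix κ' κ ℝ}
    {η : ℝ} {p : ENNReal} (h : IsJL μ A η p) (hη : 0 ≤ η) {r : ℕ} {V : Matrix κ (Fin r) ℝ}
    (hV : Vᵀ * V = 1) :
    μ {ω | ¬ ∀ z, |(A ω *ᵥ (V *ᵥ z)) ⬝ᵥ (A ω *ᵥ (V *ᵥ z)) - z ⬝ᵥ z| ≤ 2 * η * (z ⬝ᵥ z)} ≤
      12 ^ (12 * r) * (2 * p) := by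
  obtain ⟨T, hTc, hT1, hT⟩ := exists_net r
  have hVV : ∀ z w, (V *ᵥ z) ⬝ᵥ (V *ᵥ w) = z ⬝ᵥ w := by
    intro z w
    rw [Matrix.dotProduct_mulVec, Matrix.vecMul_mulVec, ← Matrix.dotProduct_mulVec, hV,
      Matrix.one_mulVec]
  calc _ ≤ μ (⋃ t ∈ T ×ˢ T,
        {ω | η ^ 2 * (((V *ᵥ t.1) ⬝ᵥ (V *ᵥ t.1)) * ((V *ᵥ t.2) ⬝ᵥ (V *ᵥ t.2))) <
          ((A ω *ᵥ (V *ᵥ t.1)) ⬝ᵥ (A ω *ᵥ (V *ᵥ t.2)) - (V *ᵥ t.1) ⬝ᵥ (V *ᵥ t.2)) ^ 2}) := by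
        refine measure_mono fun ω hω => ?_
        by_contra hn
        simp only [Set.mem_iUnion, Set.mem_ofPred_eq, not_exists, not_lt] at hn
        refine hω fun z => ?_
        have hform : ∀ z w, z ⬝ᵥ (((A ω * V)ᵀ * (A ω * V) - 1) *ᵥ w) =
            (A ω *ᵥ (V *ᵥ z)) ⬝ᵥ (A ω *ᵥ (V *ᵥ w)) - z ⬝ᵥ w := by
          intro z w
          rw [Matrix.sub_mulVec, Matrix.one_mulVec, dotProduct_sub, ← Matrix.mulVec_mulVec,
            Matrix.dotProduct_mulVec, Matrix.vecMul_transpose, Matrix.mulVec_mulVec,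
            Matrix.mulVec_mulVec]
        rw [← hform]
        refine abs_dotProduct_mulVec_le_of_net hT1 hT hη (fun t ht t' ht' => ?_) z
        have h1 := hn (t, t') (Finset.mem_product.2 ⟨ht, ht'⟩)
        rw [hVV, hVV, hVV] at h1
        rw [hform]
        refine abs_le_of_sq_le_sq (h1.trans ?_) hη
        have h2 := mul_le_one₀ (hT1 t ht) (dotProduct_self_nonneg' t') (hT1 t' ht')
        nlinarith [sq_nonneg η]
    _ ≤ ∑ _t ∈ T ×ˢ T, 2 * p :=
        (measure_biUnion_finset_le _ _).trans (Finset.sum_le_sum fun t _ => h.pair _ _)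
    _ ≤ _ := by
        rw [Finset.sum_const, nsmul_eq_mul, Finset.card_product]
        gcongr
        have : T.card * T.card ≤ 12 ^ (12 * r) := by
          rw [show 12 * r = 6 * r + 6 * r by ring, pow_add]
          exact Nat.mul_le_mul hTc hTc
        exact_mod_cast this

/-! ### Sub-gaussian matrices and their Kronecker products preserve norms -/

lemma frobSq_single_row {κ : Type*} [Fintype κ] (x : κ → ℝ) :
    frobSq (Matrix.of fun (_ : Unit) k => x k) = x ⬝ᵥ x := by
  simp [frobSq, dotProduct, sq]

lemma isJL_subgaussian {m n : ℕ} (hm : 0 < m) {K : ℝ≥0} (hK : 1 ≤ K)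
    {W : S → Matrix (Fin m) (Fin n) ℝ}
    (hind : iIndepFun (fun (p : Fin m × Fin n) ω => W ω p.1 p.2) μ)
    (hW : ∀ a b, IsNormalizedSubgaussian μ K m fun ω => W ω a b)
    {η : ℝ} (hη : 0 < η) (hη1 : η ≤ 1) :
    IsJL μ W η (ENNReal.ofReal (2 * Real.exp (-(η ^ 2 * m / (2048 * K ^ 2))))) := by
  intro x
  refine le_trans (measure_mono fun ω hω => ?_)
    (frobSq_mul_concentration hm hK hind hW (Matrix.of fun k (_ : Unit) => x k) hη hη1)
  have e1 : frobSq (Matrix.of fun k (_ : Unit) => x k) = x ⬝ᵥ x := by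
    simp [frobSq, dotProduct, sq]
  have e2 : frobSq (W ω * Matrix.of fun k (_ : Unit) => x k) = (W ω *ᵥ x) ⬝ᵥ (W ω *ᵥ x) := by
    simp [frobSq, dotProduct, sq, Matrix.mul_apply, Matrix.mulVec]
  simp only [Set.mem_ofPred_eq] at hω ⊢
  rwa [e1, e2]

lemma kroneckerFamily_mulVec_comp_equiv {q p n : ℕ} {κ : Type*} [Fintype κ] [DecidableEq κ] (σ : Fin q ≃ κ)
    (A : κ → Matrix (Fin p) (Fin n) ℝ) (x : (κ → Fin n) → ℝ) (a : κ → Fin p) :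
    (kroneckerFamily A *ᵥ x) a =
      (kroneckerFamily (fun k => A (σ k)) *ᵥ fun f => x fun k => f (σ.symm k)) fun k => a (σ k) := by
  simp only [Matrix.mulVec, dotProduct, kroneckerFamily, Matrix.of_apply]
  rw [← (σ.arrowCongr (Equiv.refl (Fin n))).sum_comp]
  refine Finset.sum_congr rfl fun f _ => ?_
  rw [← σ.prod_comp]
  simp [Equiv.arrowCongr, Function.comp_def]

lemma one_add_div_pow_sub_one_le {α : ℝ} (hα : 0 < α) (hα1 : α ≤ 1) {q : ℕ} (hq : 0 < q) :
    (1 + α / (2 * q)) ^ q - 1 ≤ α := by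
  have hq' : (0 : ℝ) < q := by exact_mod_cast hq
  have h1 : (1 + α / (2 * q)) ^ q ≤ Real.exp (α / 2) := by
    calc (1 + α / (2 * q)) ^ q ≤ Real.exp (α / (2 * q)) ^ q := by
          gcongr
          linarith [Real.add_one_le_exp (α / (2 * q))]
      _ = _ := by rw [← Real.exp_nat_mul]; congr 1; field_simp
  have h2 := Real.abs_exp_sub_one_sub_id_le (x := α / 2) (by rw [abs_of_pos] <;> linarith)
  have h3 := (abs_le.1 h2).2
  nlinarith

/-- The vector is treated as a one-row matrix, and the tolerance is split evenly: each factor gets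
`α / (2q)`, since `(1 + α / (2q)) ^ q - 1 ≤ α`. -/
lemma isJL_kroneckerFamily {ι : Type*} [Fintype ι] {ξ : ι → S → ℝ}
    (hind : iIndepFun ξ μ) (hξ : ∀ i, Measurable (ξ i)) {K : ℝ≥0} (hK : 1 ≤ K)
    {m n : ℕ} (hm : 0 < m) {κ : Type*} [Fintype κ] [DecidableEq κ] [Nonempty κ]
    (e : κ → Fin m × Fin n → ι)
    (he : Function.Injective fun z : κ × (Fin m × Fin n) => e z.1 z.2)
    (hs : ∀ k z, IsNormalizedSubgaussian μ K m (ξ (e k z)))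
    {α : ℝ} (hα : 0 < α) (hα1 : α ≤ 1) :
    IsJL μ (fun ω => kroneckerFamily fun k => coordMatrix (e k) fun i => ξ i ω) α
      (ENNReal.ofReal (Fintype.card κ * (2 * Real.exp
        (-((α / (2 * Fintype.card κ)) ^ 2 * m / (2048 * K ^ 2)))))) := by
  intro x
  have hq : 0 < Fintype.card κ := Fintype.card_pos
  set q := Fintype.card κ
  have hq' : (1 : ℝ) ≤ q := by exact_mod_cast hq
  let σ : Fin q ≃ κ := (Fintype.equivFin κ).symm
  rw [ENNReal.ofReal_mul (by positivity), ENNReal.ofReal_natCast]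
  have hη1 : α / (2 * q) ≤ 1 := by rw [div_le_one (by positivity)]; linarith
  let x' : (Fin q → Fin n) → ℝ := fun f => x fun k => f (σ.symm k)
  refine le_trans (measure_mono fun ω hω => ?_)
    (kroneckerFamily_concentration hind hξ hK hm (by positivity) hη1 q (fun k => e (σ k))
    (fun z w hzw => by simpa [Prod.ext_iff] using @he (σ z.1, z.2) (σ w.1, w.2) hzw)
    (fun k z => hs _ _)
    (Matrix.of fun (_ : Unit) f => x' f))
  simp only [Set.mem_ofPred_eq] at hω ⊢
  have e1 : x' ⬝ᵥ x' = x ⬝ᵥ x := by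
    simp only [dotProduct]
    rw [← (σ.arrowCongr (Equiv.refl (Fin n))).sum_comp]
    rfl
  set A : κ → Matrix (Fin m) (Fin n) ℝ := fun k => coordMatrix (e k) fun i => ξ i ω
  have e2 : frobSq ((Matrix.of fun (_ : Unit) f => x' f) *
      (kroneckerFamily fun k => A (σ k)).transpose) =
      (kroneckerFamily A *ᵥ x) ⬝ᵥ (kroneckerFamily A *ᵥ x) := by
    have e3 : (kroneckerFamily A *ᵥ x) ⬝ᵥ (kroneckerFamily A *ᵥ x) =
        (kroneckerFamily (fun k => A (σ k)) *ᵥ x') ⬝ᵥ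
          (kroneckerFamily (fun k => A (σ k)) *ᵥ x') := by
      simp only [dotProduct]
      rw [← (σ.arrowCongr (Equiv.refl (Fin m))).sum_comp]
      refine Finset.sum_congr rfl fun f _ => ?_
      rw [kroneckerFamily_mulVec_comp_equiv σ A x]
      simp [Equiv.arrowCongr, Function.comp_def, x']
    rw [e3]
    simp [frobSq, dotProduct, sq, Matrix.mul_apply, Matrix.mulVec, mul_comm]
  rw [frobSq_single_row, e1]
  change _ < |frobSq ((Matrix.of fun (_ : Unit) f => x' f) *
      (kroneckerFamily fun k => A (σ k)).transpose) - _|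
  rw [e2]
  refine lt_of_le_of_lt ?_ hω
  gcongr
  · exact dotProduct_self_nonneg' x
  · exact one_add_div_pow_sub_one_le hα hα1 hq

/-! ### Frobenius norms and orthogonal projections -/

section Frobenius

variable {α β γ δ : Type*} [Fintype α] [Fintype β] [Fintype γ] [Fintype δ]

lemma frobSq_eq_trace (A : Matrix α β ℝ) : frobSq A = (A * Aᵀ).trace := by
  simp [frobSq, Matrix.trace, Matrix.mul_apply, sq]

lemma frobSq_transpose (A : Matrix α β ℝ) : frobSq Aᵀ = frobSq A := Finset.sum_comm

lemma frobSq_add (A B : Matrix α β ℝ) :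
    frobSq (A + B) = frobSq A + 2 * (A * Bᵀ).trace + frobSq B := by
  have : (B * Aᵀ).trace = (A * Bᵀ).trace := by
    rw [← Matrix.trace_transpose]; simp
  rw [frobSq_eq_trace, frobSq_eq_trace, frobSq_eq_trace]
  simp only [Matrix.transpose_add, Matrix.add_mul, Matrix.mul_add, Matrix.trace_add, this]
  ring

lemma trace_mul_sq_le (A : Matrix α β ℝ) (B : Matrix β α ℝ) :
    (A * B).trace ^ 2 ≤ frobSq A * frobSq B := by
  have h : (A * B).trace = ∑ z : α × β, A z.1 z.2 * B z.2 z.1 := by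
    rw [Fintype.sum_prod_type]
    simp [Matrix.trace, Matrix.mul_apply]
  have h1 : frobSq A = ∑ z : α × β, A z.1 z.2 ^ 2 := by rw [Fintype.sum_prod_type]; rfl
  have h2 : frobSq B = ∑ z : α × β, B z.2 z.1 ^ 2 := by
    rw [Fintype.sum_prod_type, ← frobSq_transpose]; rfl
  rw [h, h1, h2]
  exact Finset.sum_mul_sq_le_sq_mul_sq _ _ _

lemma frobSq_mul_of_transpose_mul_self [DecidableEq β] {V : Matrix α β ℝ} (hV : Vᵀ * V = 1)
    (C : Matrix β γ ℝ) : frobSq (V * C) = frobSq C := by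
  rw [← frobSq_transpose, frobSq_eq_trace, ← frobSq_transpose C, frobSq_eq_trace]
  simp only [Matrix.transpose_mul, Matrix.transpose_transpose]
  rw [Matrix.mul_assoc, ← Matrix.mul_assoc Vᵀ, hV, Matrix.one_mul]

/-- Pythagoras for an orthogonal projection acting on the rows. -/
lemma frobSq_eq_add_of_isProj {P : Matrix α α ℝ} (hs : Pᵀ = P) (hi : P * P = P)
    (A : Matrix α β ℝ) : frobSq A = frobSq (A - P * A) + frobSq (P * A) := by
  have h := frobSq_add (A - P * A) (P * A)
  have h0 : ((A - P * A) * (P * A)ᵀ).trace = 0 := by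
    rw [Matrix.transpose_mul, hs, ← Matrix.mul_assoc, Matrix.trace_mul_comm, ← Matrix.mul_assoc,
      Matrix.mul_sub, ← Matrix.mul_assoc, hi, sub_self, Matrix.zero_mul, Matrix.trace_zero]
  rw [h0, sub_add_cancel] at h
  linarith

lemma diag_mem_Icc_of_isProj {P : Matrix α α ℝ} (hs : Pᵀ = P) (hi : P * P = P) (a : α) :
    0 ≤ P a a ∧ P a a ≤ 1 := by
  have h : P a a = ∑ b, P a b ^ 2 := by
    conv_lhs => rw [← hi]
    rw [Matrix.mul_apply]
    refine Finset.sum_congr rfl fun b _ => ?_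
    rw [sq]
    congr 1
    conv_lhs => rw [← hs]
    rfl
  have h0 : 0 ≤ P a a := h ▸ Finset.sum_nonneg fun _ _ => sq_nonneg _
  have h1 : P a a ^ 2 ≤ P a a := by
    conv_rhs => rw [h]
    exact Finset.single_le_sum (f := fun b => P a b ^ 2) (fun _ _ => sq_nonneg _)
      (Finset.mem_univ a)
  exact ⟨h0, by nlinarith⟩

lemma frobSq_mul_eq_trace_of_isProj {P : Matrix α α ℝ} (hs : Pᵀ = P) (hi : P * P = P)
    (A : Matrix α β ℝ) : frobSq (P * A) = (P * (A * Aᵀ)).trace := by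
  rw [frobSq_eq_trace, Matrix.transpose_mul, hs, ← Matrix.mul_assoc, Matrix.trace_mul_comm]
  simp only [← Matrix.mul_assoc, hi]

end Frobenius

/-! ### Optimality of the leading singular vectors -/

/-- Weights in `[0, 1]` of total mass at most `r` gain most on the `r` largest values: the
difference is compared termwise with the threshold value `c`. -/
lemma sum_mul_le_sum_ite {n r : ℕ} (hr : 0 < r) (hrn : r ≤ n) {l p : Fin n → ℝ} (hl : Antitone l)
    (hl0 : ∀ a, 0 ≤ l a) (hp0 : ∀ a, 0 ≤ p a) (hp1 : ∀ a, p a ≤ 1) (hp : ∑ a, p a ≤ r) :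
    ∑ a, p a * l a ≤ ∑ a : Fin n, if (a : ℕ) < r then l a else 0 := by
  -- The `r`-th largest value has index `r - 1`, hence the need for `0 < r`.
  set c := l ⟨r - 1, by omega⟩ with hc
  have h1 : ∀ a : Fin n, p a * l a - (if (a : ℕ) < r then l a else 0) ≤
      (p a - if (a : ℕ) < r then 1 else 0) * c := by
    intro a
    split_ifs with h
    · have : c ≤ l a := hl (by rw [Fin.le_def]; simp only; omega)
      nlinarith [hp1 a]
    · have : l a ≤ c := hl (by rw [Fin.le_def]; simp only; omega)
      nlinarith [hp0 a]
  have h2 := Finset.sum_le_sum fun a (_ : a ∈ Finset.univ) => h1 a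
  have h3 : ∑ a : Fin n, (if (a : ℕ) < r then (1 : ℝ) else 0) = r := by
    rw [Fin.sum_univ_eq_sum_range (fun a => if a < r then (1 : ℝ) else 0), ← Finset.sum_filter]
    have : (Finset.range n).filter (fun a => a < r) = Finset.range r := by
      ext a; simp; omega
    simp [this]
  rw [Finset.sum_sub_distrib, ← Finset.sum_mul, Finset.sum_sub_distrib, h3] at h2
  nlinarith [hl0 ⟨r - 1, by omega⟩]

section

variable {n r : ℕ} {κ : Type*} [Fintype κ] [DecidableEq κ] {F : Matrix (Fin n) κ ℝ}
  {Q : Matrix (Fin n) (Fin r) ℝ}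

lemma IsLeadingLeftSingularVectors.orthonormal (hQ : IsLeadingLeftSingularVectors F Q)
    (hrn : r ≤ n) : Qᵀ * Q = 1 := by
  obtain ⟨U, V, σ, hU, -, -, -, -, -, hQU⟩ := hQ
  ext k l
  have h := congrFun (congrFun hU (Fin.castLE hrn k)) (Fin.castLE hrn l)
  rw [Matrix.mul_apply] at h ⊢
  simp only [Matrix.transpose_apply] at h ⊢
  simp only [hQU _ k (Fin.castLE hrn k) rfl, hQU _ l (Fin.castLE hrn l) rfl]
  rw [h]
  simp [Matrix.one_apply, Fin.ext_iff]

lemma isProj_mul_transpose (hQ : Qᵀ * Q = 1) :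
    (Q * Qᵀ)ᵀ = Q * Qᵀ ∧ (Q * Qᵀ) * (Q * Qᵀ) = Q * Qᵀ := by
  refine ⟨by simp, ?_⟩
  rw [Matrix.mul_assoc, ← Matrix.mul_assoc Qᵀ, hQ, Matrix.one_mul]

/-- Projecting on the leading left singular vectors is the best approximation of rank `r`. -/
theorem IsLeadingLeftSingularVectors.frobSq_sub_le (hQ : IsLeadingLeftSingularVectors F Q)
    (hr : 0 < r) (hrn : r ≤ n) (G : Matrix (Fin n) (Fin r) ℝ) (H : Matrix (Fin r) κ ℝ) :
    frobSq (F - Q * Qᵀ * F) ≤ frobSq (F - G * H) := by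
  have hQQ := hQ.orthonormal hrn
  obtain ⟨hQs, hQi⟩ := isProj_mul_transpose hQQ
  obtain ⟨U, V, σ, hU, hV, -, hσ, hσ0, hF, hQU⟩ := hQ
  have hUU : U * Uᵀ = 1 := mul_eq_one_comm.1 hU
  -- The eigenvalues of `F Fᵀ`; those beyond the number of columns are zero, whatever `σ` is there.
  set l : Fin n → ℝ := fun a => if (a : ℕ) < Fintype.card κ then σ a ^ 2 else 0 with hl
  have hFF : F * Fᵀ = U * Matrix.diagonal l * Uᵀ := by
    set D : Matrix (Fin n) (Fin (Fintype.card κ)) ℝ := Matrix.of fun a b =>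
      if a.val = b.val then σ a.val else 0
    have hD : D * Dᵀ = Matrix.diagonal l := by
      ext a b
      rw [Matrix.mul_apply, Matrix.diagonal_apply]
      simp only [D, Matrix.transpose_apply, Matrix.of_apply, hl]
      by_cases ha : (a : ℕ) < Fintype.card κ
      · rw [Finset.sum_eq_single ⟨a, ha⟩]
        · by_cases hab : a = b
          · subst hab; simp [ha, sq]
          · have : (b : ℕ) ≠ a := fun h => hab (Fin.ext h.symm)
            simp [hab, this]
        · intro c _ hc
          have : (a : ℕ) ≠ c := fun h => hc (Fin.ext h.symm)
          simp [this]
        · simp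
      · rw [Finset.sum_eq_zero]
        · simp [ha]
        · intro c _
          have : (a : ℕ) ≠ c := fun h => ha (h ▸ c.2)
          simp [this]
    rw [hF, Matrix.transpose_mul, Matrix.transpose_mul, Matrix.transpose_transpose,
      Matrix.mul_assoc (U * D), ← Matrix.mul_assoc Vᵀ, hV, Matrix.one_mul, ← hD]
    simp only [Matrix.mul_assoc]
  have htr : ∀ P : Matrix (Fin n) (Fin n) ℝ,
      (P * (F * Fᵀ)).trace = ∑ a, (Uᵀ * P * U) a a * l a := by
    intro P
    rw [hFF, ← Matrix.mul_assoc, Matrix.trace_mul_comm]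
    simp only [← Matrix.mul_assoc, Matrix.trace, Matrix.diag_apply, Matrix.mul_diagonal]
  have hconj : ∀ P : Matrix (Fin n) (Fin n) ℝ, Pᵀ = P → P * P = P →
      (Uᵀ * P * U)ᵀ = Uᵀ * P * U ∧ (Uᵀ * P * U) * (Uᵀ * P * U) = Uᵀ * P * U := by
    intro P hs hi
    refine ⟨by simp [Matrix.transpose_mul, hs, Matrix.mul_assoc], ?_⟩
    calc (Uᵀ * P * U) * (Uᵀ * P * U) = Uᵀ * P * (U * Uᵀ) * P * U := by
          simp only [Matrix.mul_assoc]
      _ = Uᵀ * (P * P) * U := by rw [hUU, Matrix.mul_one]; simp only [Matrix.mul_assoc]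
      _ = _ := by rw [hi]
  obtain ⟨hG1, hG2, hG3, hG4⟩ := pinv_spec G
  -- The orthogonal projection on the range of `G` does at least as well as any `G * H`. By
  -- Pythagoras the claim becomes a comparison of the captured energies `tr (P F Fᵀ)`.
  set P := G * pinv G with hP
  have hPi : P * P = P := by rw [hP, ← Matrix.mul_assoc, hG1]
  -- Cyclicity moves the trace to the `r × r` projection `pinv G * G`, whose diagonal entries are at
  -- most 1.
  have hPtr : P.trace ≤ r := by
    rw [hP, Matrix.trace_mul_comm]
    have hi : (pinv G * G) * (pinv G * G) = pinv G * G := by rw [← Matrix.mul_assoc, hG2]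
    calc (pinv G * G).trace ≤ ∑ _k : Fin r, (1 : ℝ) :=
          Finset.sum_le_sum fun k _ => (diag_mem_Icc_of_isProj hG4 hi k).2
      _ = r := by simp
  have h1 : frobSq (F - P * F) ≤ frobSq (F - G * H) := by
    have h2 := frobSq_eq_add_of_isProj hG3 hPi (F - G * H)
    have h3 : F - G * H - P * (F - G * H) = F - P * F := by
      rw [Matrix.mul_sub, ← Matrix.mul_assoc P, hP, hG1]; abel
    rw [h3] at h2
    linarith [frobSq_nonneg (P * (F - G * H))]
  refine le_trans ?_ h1
  have h2 := frobSq_eq_add_of_isProj hG3 hPi F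
  have h3 := frobSq_eq_add_of_isProj hQs hQi F
  have h4 : frobSq (P * F) ≤ frobSq (Q * Qᵀ * F) := by
    rw [frobSq_mul_eq_trace_of_isProj hG3 hPi, frobSq_mul_eq_trace_of_isProj hQs hQi, htr, htr]
    obtain ⟨hs, hi⟩ := hconj P hG3 hPi
    refine (sum_mul_le_sum_ite hr hrn ?_ ?_ (fun a => (diag_mem_Icc_of_isProj hs hi a).1)
      (fun a => (diag_mem_Icc_of_isProj hs hi a).2) ?_).trans (le_of_eq ?_)
    · intro a b hab
      simp only [hl]
      have hab' : (a : ℕ) ≤ b := hab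
      split_ifs with h5 h6 h6
      · exact pow_le_pow_left₀ (hσ0 _) (hσ hab') 2
      · omega
      · positivity
      · rfl
    · intro a
      simp only [hl]
      split_ifs <;> positivity
    · have : ∑ a, (Uᵀ * P * U) a a = P.trace := by
        change (Uᵀ * P * U).trace = _
        rw [Matrix.trace_mul_comm, ← Matrix.mul_assoc, hUU, Matrix.one_mul]
      rw [this]; exact hPtr
    · refine Finset.sum_congr rfl fun a _ => ?_
      have hUQ : ∀ k : Fin r, (Uᵀ * Q) a k = if (a : ℕ) = k then 1 else 0 := by
        intro k
        have h := congrFun (congrFun hU a) (Fin.castLE hrn k)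
        rw [Matrix.mul_apply] at h ⊢
        simp only [hQU _ k (Fin.castLE hrn k) rfl]
        rw [h]
        simp [Matrix.one_apply, Fin.ext_iff]
      have : (Uᵀ * (Q * Qᵀ) * U) a a = if (a : ℕ) < r then 1 else 0 := by
        have e : Uᵀ * (Q * Qᵀ) * U = (Uᵀ * Q) * (Uᵀ * Q)ᵀ := by
          simp [Matrix.transpose_mul, Matrix.mul_assoc]
        rw [e, Matrix.mul_apply]
        simp only [Matrix.transpose_apply, hUQ]
        split_ifs with h
        · rw [Finset.sum_eq_single ⟨a, h⟩]
          · simp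
          · intro k _ hk
            have : (a : ℕ) ≠ k := fun h => hk (Fin.ext h.symm)
            simp [this]
          · simp
        · refine Finset.sum_eq_zero fun k _ => ?_
          have : (a : ℕ) ≠ k := fun h' => h (h' ▸ k.2)
          simp [this]
      rw [this]
      split_ifs <;> simp
  linarith

end

/-! ### Right singular vectors and the tail energy -/

lemma frobSq_eq_sum_orthonormalBasis {α κ : Type*} [Fintype α] [Fintype κ] {N : ℕ}
    (b : OrthonormalBasis (Fin N) ℝ (EuclideanSpace ℝ κ)) (M : Matrix α κ ℝ) :
    frobSq M = ∑ i, (M *ᵥ (b i).ofLp) ⬝ᵥ (M *ᵥ (b i).ofLp) := by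
  have h : ∀ a, ∑ k, M a k ^ 2 = ∑ i, ((M *ᵥ (b i).ofLp) a) ^ 2 := by
    intro a
    have h1 := b.sum_sq_norm_inner_right (WithLp.toLp 2 (M a))
    rw [EuclideanSpace.norm_sq_eq] at h1
    simp only [Real.norm_eq_abs, sq_abs] at h1
    rw [← h1]
    refine Finset.sum_congr rfl fun i _ => ?_
    simp [PiLp.inner_apply, Matrix.mulVec, dotProduct]
  simp only [frobSq, h]
  rw [Finset.sum_comm]
  simp [dotProduct, sq]

/-- The columns of `V` are the top `r` eigenvectors of `A* A`. In the full eigenbasis `A - A V Vᵀ`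
kills these and agrees with `A` on the others, where the squared norms are the squared singular
values. -/
lemma exists_right_singular_vectors {n r : ℕ} {κ : Type*} [Fintype κ] [DecidableEq κ]
    (A : Matrix (Fin n) κ ℝ) (hr : r ≤ Fintype.card κ) :
    ∃ V : Matrix κ (Fin r) ℝ, Vᵀ * V = 1 ∧ frobSq (A - A * V * Vᵀ) ≤
      ∑ i ∈ Finset.Ico r (min n (Fintype.card κ)),
        (Matrix.toEuclideanLin A).singularValues i ^ 2 := by
  set N := Fintype.card κ with hN
  set T := Matrix.toEuclideanLin A with hT
  have hfin : Module.finrank ℝ (EuclideanSpace ℝ κ) = N := by simp [hN]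
  have hsym := T.isSymmetric_adjoint_comp_self
  set b := hsym.eigenvectorBasis hfin with hb
  have hTb : ∀ i, T (b i) = WithLp.toLp 2 (A *ᵥ (b i).ofLp) := fun i => rfl
  have hnorm : ∀ i, (A *ᵥ (b i).ofLp) ⬝ᵥ (A *ᵥ (b i).ofLp) = T.singularValues i ^ 2 := by
    intro i
    have h1 : inner ℝ (T (b i)) (T (b i)) =
        (A *ᵥ (b i).ofLp) ⬝ᵥ (A *ᵥ (b i).ofLp) := by
      rw [hTb, PiLp.inner_apply]; simp [dotProduct, sq]
    rw [← h1, T.sq_singularValues_fin hfin, ← LinearMap.adjoint_inner_right]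
    have h2 := hsym.apply_eigenvectorBasis hfin i
    simp only [LinearMap.comp_apply] at h2
    rw [h2, inner_smul_right]
    simp [← hb]
  let V : Matrix κ (Fin r) ℝ := Matrix.of fun k i => b (Fin.castLE hr i) k
  have hVb : ∀ (i : Fin r) (j : Fin N), (Vᵀ *ᵥ (b j).ofLp) i =
      if Fin.castLE hr i = j then 1 else 0 := by
    intro i j
    have h1 := b.orthonormal
    rw [orthonormal_iff_ite] at h1
    rw [← h1 (Fin.castLE hr i) j]
    simp [PiLp.inner_apply, Matrix.mulVec, dotProduct, V, mul_comm]
  refine ⟨V, ?_, ?_⟩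
  · ext i j
    have h1 := hVb i (Fin.castLE hr j)
    rw [Matrix.mul_apply]
    simp only [Matrix.mulVec, dotProduct] at h1
    refine Eq.trans ?_ (h1.trans ?_)
    · rfl
    · simp [Matrix.one_apply, Fin.ext_iff]
  · have hcol : ∀ j : Fin N, (A - A * V * Vᵀ) *ᵥ (b j).ofLp =
        if (j : ℕ) < r then 0 else A *ᵥ (b j).ofLp := by
      intro j
      have h1 : V *ᵥ (Vᵀ *ᵥ (b j).ofLp) = if (j : ℕ) < r then (b j).ofLp else 0 := by
        ext k
        rw [Matrix.mulVec, dotProduct]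
        simp only [hVb]
        split_ifs with hj
        · rw [Finset.sum_eq_single ⟨j, hj⟩]
          · simp [V]
          · intro i _ hi
            have : Fin.castLE hr i ≠ j := fun h => hi (by ext; simp [← h])
            simp [this]
          · simp
        · refine Finset.sum_eq_zero fun i _ => ?_
          have : Fin.castLE hr i ≠ j := fun h => hj (by rw [← h]; exact i.2)
          simp [this]
      rw [Matrix.sub_mulVec, Matrix.mul_assoc, ← Matrix.mulVec_mulVec, ← Matrix.mulVec_mulVec, h1]
      split_ifs <;> simp
    -- The rank is at most `n`, which cuts the sum over `N` indices down to `min n N`.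
    have hrank : ∀ i, n ≤ i → T.singularValues i = 0 := by
      intro i hi
      rw [LinearMap.singularValues_eq_zero_iff_le_finrank_range]
      exact ((Submodule.finrank_le _).trans (by simp)).trans hi
    rw [frobSq_eq_sum_orthonormalBasis b]
    have h2 : ∀ j : Fin N, ((A - A * V * Vᵀ) *ᵥ (b j).ofLp) ⬝ᵥ
        ((A - A * V * Vᵀ) *ᵥ (b j).ofLp) =
        if (j : ℕ) < r then 0 else T.singularValues j ^ 2 := by
      intro j
      rw [hcol, ← hnorm]
      split_ifs <;> simp
    simp only [h2]
    rw [Fin.sum_univ_eq_sum_range (fun j => if j < r then 0 else T.singularValues j ^ 2),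
      ← Finset.sum_filter_add_sum_filter_not (Finset.range N) (fun j => j < min n N ∧ r ≤ j)]
    have h3 : ∑ j ∈ (Finset.range N).filter (fun j => ¬ (j < min n N ∧ r ≤ j)),
        (if j < r then 0 else T.singularValues j ^ 2) = 0 := by
      refine Finset.sum_eq_zero fun j hj => ?_
      simp only [Finset.mem_filter, Finset.mem_range, lt_min_iff, not_and, not_le] at hj
      split_ifs with h
      · rfl
      · rw [hrank j (by by_contra h'; exact h (hj.2 ⟨not_le.1 h', hj.1⟩)), sq, zero_mul]
    rw [h3, add_zero]
    refine le_of_eq (Finset.sum_congr ?_ fun j hj => ?_)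
    · ext j; simp; omega
    · rw [Finset.mem_Ico] at hj
      simp [not_lt.2 hj.1]

lemma exists_frobSq_unfold_sub_le_tailEnergy {d n r : ℕ} (hd : 2 ≤ d) (hrn : r ≤ n)
    (X : Tensor d n) (j : Fin d) :
    ∃ V : Matrix (OtherModes j n) (Fin r) ℝ, Vᵀ * V = 1 ∧
      frobSq (unfold j X - unfold j X * V * Vᵀ) ≤ tailEnergy X r j := by
  have hc : Fintype.card (OtherModes j n) = n ^ (d - 1) := by
    simp [OtherModes, Fintype.card_subtype_compl]
  have h := exists_right_singular_vectors (r := r) (unfold j X) (by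
    rw [hc]; exact hrn.trans (Nat.le_self_pow (by omega) _))
  rwa [hc] at h

/-! ### Sketched low rank approximation -/

/-- If the sketch `A` satisfies the four stated conditions, then the best approximation of rank
`r` of the sketched matrix is almost optimal for the matrix itself. -/
theorem frobSq_sub_le_of_sketch {n r : ℕ} (hr : 0 < r) {κ κ' : Type*} [Fintype κ] [Fintype κ']
    {Y : Matrix (Fin n) κ ℝ} {A : Matrix κ' κ ℝ} {V : Matrix κ (Fin r) ℝ} (hV : Vᵀ * V = 1)
    {Q : Matrix (Fin n) (Fin r) ℝ} (hQ : Qᵀ * Q = 1) {ε : ℝ} (hε : 0 < ε) (hε1 : ε < 1)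
    (h1 : ∀ z, |(A *ᵥ (V *ᵥ z)) ⬝ᵥ (A *ᵥ (V *ᵥ z)) - z ⬝ᵥ z| ≤ ε / 4 * (z ⬝ᵥ z))
    (h2 : frobSq ((A * V)ᵀ * (A * (Y - Y * V * Vᵀ)ᵀ) - Vᵀ * (Y - Y * V * Vᵀ)ᵀ) ≤
      (ε / 4) ^ 2 * frobSq (Y - Y * V * Vᵀ))
    (h3 : |frobSq (A * (Y - Y * V * Vᵀ)ᵀ) - frobSq (Y - Y * V * Vᵀ)| ≤
      ε / 4 * frobSq (Y - Y * V * Vᵀ))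
    (h4 : frobSq ((A * (Y - Y * V * Vᵀ)ᵀ)ᵀ * (A * (Y - Y * V * Vᵀ)ᵀ) -
      (Y - Y * V * Vᵀ) * (Y - Y * V * Vᵀ)ᵀ) ≤
      (ε / 4) ^ 2 / r * frobSq (Y - Y * V * Vᵀ) ^ 2)
    (hopt : frobSq (Y * Aᵀ - Q * Qᵀ * (Y * Aᵀ)) ≤ frobSq ((Y - Y * V * Vᵀ) * Aᵀ)) :
    frobSq (Y - Q * Qᵀ * Y) ≤ (1 + ε) / (1 - ε) * frobSq (Y - Y * V * Vᵀ) := by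
  set e := ε / 4 with he
  have he0 : 0 < e := by positivity
  set Y₂ := Y - Y * V * Vᵀ with hY₂
  obtain ⟨hQs, hQi⟩ := isProj_mul_transpose hQ
  set P := Q * Qᵀ with hP
  set R := 1 - P with hR
  have hRs : Rᵀ = R := by rw [hR, Matrix.transpose_sub, hQs, Matrix.transpose_one]
  have hRi : R * R = R := by
    rw [hR, Matrix.sub_mul, Matrix.one_mul, Matrix.mul_sub, hQi, Matrix.mul_one]; simp
  have hRmul : ∀ M : Matrix (Fin n) κ ℝ, M - P * M = R * M := by
    intro M; rw [hR, Matrix.sub_mul, Matrix.one_mul]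
  have hRmul' : ∀ M : Matrix (Fin n) κ' ℝ, M - P * M = R * M := by
    intro M; rw [hR, Matrix.sub_mul, Matrix.one_mul]
  have hY₂V : Y₂ * V = 0 := by
    rw [hY₂, Matrix.sub_mul, Matrix.mul_assoc (Y * V), hV, Matrix.mul_one, sub_self]
  have hVY₂ : Vᵀ * Y₂ᵀ = 0 := by rw [← Matrix.transpose_mul, hY₂V, Matrix.transpose_zero]
  -- The residual `R Y` splits into `C Vᵀ` and `R Y₂`, which are orthogonal because `Y₂ V = 0`. The
  -- sketch is compared on the two parts and on their cross term.
  set C := R * (Y * V) with hC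
  have hRY : R * Y = C * Vᵀ + R * Y₂ := by
    rw [hC, Matrix.mul_assoc R, ← Matrix.mul_add, hY₂]; simp
  have hfC : frobSq (C * Vᵀ) = frobSq C := by
    rw [← frobSq_transpose, Matrix.transpose_mul, Matrix.transpose_transpose,
      frobSq_mul_of_transpose_mul_self hV, frobSq_transpose]
  have hsplit : frobSq (R * Y) = frobSq C + frobSq (R * Y₂) := by
    rw [hRY, frobSq_add, hfC, Matrix.transpose_mul, Matrix.mul_assoc C, ← Matrix.mul_assoc Vᵀ,
      hVY₂]
    simp
  have hA1 : (1 - e) * frobSq C ≤ frobSq (C * Vᵀ * Aᵀ) := by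
    have e1 : frobSq (C * Vᵀ * Aᵀ) = frobSq (A * (V * Cᵀ)) := by
      rw [← frobSq_transpose]; simp [Matrix.transpose_mul, Matrix.mul_assoc]
    rw [e1, ← frobSq_transpose C, frobSq_eq_sum_dotProduct, frobSq_eq_sum_dotProduct,
      Finset.mul_sum]
    refine Finset.sum_le_sum fun a _ => ?_
    have h := (abs_le.1 (h1 (Cᵀ.col a))).1
    have e2 : (A * (V * Cᵀ)).col a = A *ᵥ (V *ᵥ (Cᵀ.col a)) := rfl
    rw [e2]
    linarith
  -- Cyclicity and `R C = C` remove the `Q`-dependent `R` from the second factor. What remains is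
  -- the sketched product of `V` and `Y₂ᵀ`, whose exact value is 0.
  have hcross : |2 * ((C * Vᵀ * Aᵀ) * (R * Y₂ * Aᵀ)ᵀ).trace| ≤ e * frobSq C + e * frobSq Y₂ := by
    have e1 : ((C * Vᵀ * Aᵀ) * (R * Y₂ * Aᵀ)ᵀ).trace =
        (C * ((A * V)ᵀ * (A * Y₂ᵀ) - Vᵀ * Y₂ᵀ)).trace := by
      rw [hVY₂, sub_zero]
      have : (C * Vᵀ * Aᵀ) * (R * Y₂ * Aᵀ)ᵀ = (C * ((A * V)ᵀ * (A * Y₂ᵀ))) * R := by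
        simp only [Matrix.transpose_mul, Matrix.transpose_transpose, hRs, Matrix.mul_assoc]
      rw [this, Matrix.trace_mul_comm, ← Matrix.mul_assoc, hC, ← Matrix.mul_assoc R R, hRi]
    rw [e1]
    set W := (A * V)ᵀ * (A * Y₂ᵀ) - Vᵀ * Y₂ᵀ
    have h5 := trace_mul_sq_le C W
    have h6 : (C * W).trace ^ 2 ≤ (e * frobSq C) * (e * frobSq Y₂) := by
      refine h5.trans ?_
      calc frobSq C * frobSq W ≤ frobSq C * (e ^ 2 * frobSq Y₂) := by
            gcongr; exact frobSq_nonneg C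
        _ = _ := by ring
    have hc0 : 0 ≤ e * frobSq C := mul_nonneg he0.le (frobSq_nonneg _)
    have hy0 : 0 ≤ e * frobSq Y₂ := mul_nonneg he0.le (frobSq_nonneg _)
    refine abs_le_of_sq_le_sq ?_ (by positivity)
    nlinarith [sq_nonneg (e * frobSq C - e * frobSq Y₂)]
  -- `R` depends on the sketch and may have large rank, so Pythagoras passes to `P`. Since `frobSq P
  -- = r`, Cauchy–Schwarz costs a factor `r`, which the `1 / r` in `h4` compensates.
  have hA2 : frobSq (R * Y₂) - 2 * e * frobSq Y₂ ≤ frobSq (R * Y₂ * Aᵀ) := by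
    have e1 := frobSq_eq_add_of_isProj hQs hQi (Y₂ * Aᵀ)
    have e2 := frobSq_eq_add_of_isProj hQs hQi Y₂
    rw [hRmul'] at e1
    rw [hRmul] at e2
    rw [← Matrix.mul_assoc R] at e1
    have e3 : frobSq (P * (Y₂ * Aᵀ)) - frobSq (P * Y₂) =
        (P * ((A * Y₂ᵀ)ᵀ * (A * Y₂ᵀ) - Y₂ * Y₂ᵀ)).trace := by
      rw [frobSq_mul_eq_trace_of_isProj hQs hQi, frobSq_mul_eq_trace_of_isProj hQs hQi,
        ← Matrix.trace_sub, ← Matrix.mul_sub]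
      simp [Matrix.transpose_mul]
    have e4 := trace_mul_sq_le P ((A * Y₂ᵀ)ᵀ * (A * Y₂ᵀ) - Y₂ * Y₂ᵀ)
    have e5 : frobSq P = r := by
      rw [hP, frobSq_mul_of_transpose_mul_self hQ, frobSq_eq_trace, Matrix.transpose_transpose, hQ]
      simp
    have hr' : (0 : ℝ) < r := by exact_mod_cast hr
    have e6 : (P * ((A * Y₂ᵀ)ᵀ * (A * Y₂ᵀ) - Y₂ * Y₂ᵀ)).trace ^ 2 ≤ (e * frobSq Y₂) ^ 2 := by
      refine e4.trans ?_
      rw [e5]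
      calc (r : ℝ) * frobSq _ ≤ r * (e ^ 2 / r * frobSq Y₂ ^ 2) := by gcongr
        _ = _ := by field_simp
    have e7 := abs_le_of_sq_le_sq e6 (mul_nonneg he0.le (frobSq_nonneg _))
    have e8 := (abs_le.1 e7).2
    have e9 : frobSq (Y₂ * Aᵀ) = frobSq (A * Y₂ᵀ) := by
      rw [← frobSq_transpose]; simp [Matrix.transpose_mul]
    have e10 := (abs_le.1 h3).1
    linarith
  have hsum : frobSq (R * (Y * Aᵀ)) = frobSq (C * Vᵀ * Aᵀ) +
      2 * ((C * Vᵀ * Aᵀ) * (R * Y₂ * Aᵀ)ᵀ).trace + frobSq (R * Y₂ * Aᵀ) := by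
    rw [← frobSq_add, ← Matrix.add_mul, ← hRY, Matrix.mul_assoc]
  rw [hRmul'] at hopt
  rw [hRmul]
  have hopt2 : frobSq (Y₂ * Aᵀ) ≤ (1 + e) * frobSq Y₂ := by
    have e9 : frobSq (Y₂ * Aᵀ) = frobSq (A * Y₂ᵀ) := by
      rw [← frobSq_transpose]; simp [Matrix.transpose_mul]
    linarith [(abs_le.1 h3).2]
  have hc := (abs_le.1 hcross).1
  have hRY0 := frobSq_nonneg (R * Y₂)
  have hC0 := frobSq_nonneg C
  have hY0 := frobSq_nonneg Y₂
  have hfinal : (1 - 2 * e) * frobSq (R * Y) ≤ (1 + 4 * e) * frobSq Y₂ := by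
    rw [hsplit]
    nlinarith
  rw [div_mul_eq_mul_div, le_div_iff₀ (by linarith)]
  have : ε = 4 * e := by rw [he]; ring
  rw [this]
  nlinarith [frobSq_nonneg (R * Y)]

/-! ### Recovery of one factor -/

lemma frobSq_of_transpose_mul_self {κ : Type*} [Fintype κ] {r : ℕ} {V : Matrix κ (Fin r) ℝ}
    (hV : Vᵀ * V = 1) : frobSq V = r := by
  rw [← frobSq_transpose, frobSq_eq_trace, Matrix.transpose_transpose, hV]
  simp

/-- The four sketch conditions do not involve `Q`, so one event serves every `Q`, including those
computed from the sketch. The tolerance `ε / 8` is doubled by the net; `ε / (4√r)` offsets `frobSq V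
= r` and supplies the `1 / r` of the last condition. -/
theorem IsJL.factor_recovery {n r : ℕ} (hr : 0 < r) (hrn : r ≤ n) {κ κ' : Type*} [Fintype κ]
    [Fintype κ'] [DecidableEq κ'] {A : S → Matrix κ' κ ℝ} {ε : ℝ} (hε : 0 < ε) (hε1 : ε < 1)
    {p₀ p₁ : ENNReal} (h₀ : IsJL μ A (ε / 8) p₀) (h₁ : IsJL μ A (ε / (4 * √r)) p₁)
    (Y : Matrix (Fin n) κ ℝ) {V : Matrix κ (Fin r) ℝ} (hV : Vᵀ * V = 1) :
    μ {ω | ¬ ∀ Q : Matrix (Fin n) (Fin r) ℝ, IsLeadingLeftSingularVectors (Y * (A ω)ᵀ) Q →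
        frobSq (Y - Q * Qᵀ * Y) ≤ (1 + ε) / (1 - ε) * frobSq (Y - Y * V * Vᵀ)} ≤
      12 ^ (12 * r) * (2 * p₀) + (r * n * (2 * p₁) + (n * p₁ + n * n * (2 * p₁))) := by
  have hr' : (1 : ℝ) ≤ r := by exact_mod_cast hr
  set Y₂ := Y - Y * V * Vᵀ with hY₂
  have hsq : (ε / (4 * √r)) ^ 2 = (ε / 4) ^ 2 / r := by
    rw [div_pow, mul_pow, Real.sq_sqrt (by positivity)]; field_simp
  have hle : ε / (4 * √r) ≤ ε / 4 := by
    have : 1 ≤ √(r : ℝ) := Real.one_le_sqrt.2 hr'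
    gcongr
    linarith
  have e1 := h₀.subspace_embedding (by positivity) hV
  have e2 := h₁.approx_mul V Y₂ᵀ
  have e3 := h₁.frobSq_mul Y₂ᵀ
  have e4 := h₁.approx_mul Y₂ᵀ Y₂ᵀ
  simp only [Fintype.card_fin] at e2 e3 e4
  refine (measure_mono ?_).trans ((measure_union_le _ _).trans (add_le_add e1
    ((measure_union_le _ _).trans (add_le_add e2
      ((measure_union_le _ _).trans (add_le_add e3 e4))))))
  intro ω hω
  by_contra hn
  simp only [Set.mem_union, Set.mem_ofPred_eq, not_or, not_lt, not_not] at hn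
  obtain ⟨h1, h2, h3, h4⟩ := hn
  refine hω fun Q hQ => ?_
  rw [hsq, frobSq_of_transpose_mul_self hV, frobSq_transpose] at h2
  rw [frobSq_transpose] at h3
  rw [hsq, frobSq_transpose, Matrix.transpose_transpose] at h4
  refine frobSq_sub_le_of_sketch hr hV (hQ.orthonormal hrn) hε hε1 (A := A ω) ?_ ?_ ?_ ?_ ?_
  · intro z
    refine (h1 z).trans (le_of_eq ?_)
    ring
  · refine h2.trans (le_of_eq ?_)
    rw [← hY₂]
    field_simp
  · exact h3.trans (mul_le_mul_of_nonneg_right hle (frobSq_nonneg _))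
  · exact h4.trans (le_of_eq (by rw [sq (frobSq Y₂)]))
  · have := hQ.frobSq_sub_le hr hrn (Y * V) (Vᵀ * (A ω)ᵀ)
    rw [← hY₂]
    rwa [← Matrix.mul_assoc (Y * V), ← Matrix.sub_mul] at this

/-! ### Least squares for one mode -/

/-- The oblique projection onto the range of `Q` given by the least squares problem with design
matrix `Φ Q`. -/
def leastSquares {p n r : ℕ} (Φ : Matrix (Fin p) (Fin n) ℝ) (Q : Matrix (Fin n) (Fin r) ℝ) :
    Matrix (Fin n) (Fin n) ℝ :=
  Q * (((Φ * Q)ᵀ * (Φ * Q))⁻¹ * ((Φ * Q)ᵀ * Φ))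

section leastSquares

variable {p n r : ℕ} {Φ : Matrix (Fin p) (Fin n) ℝ} {Q : Matrix (Fin n) (Fin r) ℝ}

lemma leastSquares_mul (h : ((Φ * Q)ᵀ * (Φ * Q)).det ≠ 0) : leastSquares Φ Q * Q = Q := by
  rw [leastSquares, Matrix.mul_assoc, Matrix.mul_assoc, Matrix.mul_assoc (Φ * Q)ᵀ,
    Matrix.nonsing_inv_mul _ (isUnit_iff_ne_zero.2 h), Matrix.mul_one]

lemma pinv_eq_of_det_ne_zero {G : Matrix (Fin p) (Fin r) ℝ} (h : (Gᵀ * G).det ≠ 0) :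
    pinv G = (Gᵀ * G)⁻¹ * Gᵀ := by
  obtain ⟨h1, -, h3, -⟩ := pinv_spec G
  have h5 : Gᵀ * (G * pinv G) = Gᵀ := by
    rw [← h3, ← Matrix.transpose_mul, h1]
  calc pinv G = (Gᵀ * G)⁻¹ * (Gᵀ * G) * pinv G := by
        rw [Matrix.nonsing_inv_mul _ (isUnit_iff_ne_zero.2 h), Matrix.one_mul]
    _ = (Gᵀ * G)⁻¹ * (Gᵀ * (G * pinv G)) := by simp only [Matrix.mul_assoc]
    _ = _ := by rw [h5]

lemma mul_pinv_mul_eq_leastSquares (h : ((Φ * Q)ᵀ * (Φ * Q)).det ≠ 0) :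
    Q * (pinv (Φ * Q) * Φ) = leastSquares Φ Q := by
  rw [pinv_eq_of_det_ne_zero h, leastSquares, Matrix.mul_assoc _ (Φ * Q)ᵀ]

lemma dotProduct_le_of_quadratic_form {M : Matrix (Fin r) (Fin r) ℝ}
    (hM : ∀ z, 1 / 2 * (z ⬝ᵥ z) ≤ z ⬝ᵥ (M *ᵥ z)) (w : Fin r → ℝ) :
    w ⬝ᵥ w ≤ 4 * ((M *ᵥ w) ⬝ᵥ (M *ᵥ w)) := by
  have h1 := hM w
  have h2 : w ⬝ᵥ (M *ᵥ w) ≤ 1 / 4 * (w ⬝ᵥ w) + (M *ᵥ w) ⬝ᵥ (M *ᵥ w) := by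
    simp only [dotProduct]
    rw [Finset.mul_sum, ← Finset.sum_add_distrib]
    refine Finset.sum_le_sum fun i _ => ?_
    nlinarith [sq_nonneg (w i / 2 - (M *ᵥ w) i)]
  linarith

/-- Least squares reproduces the part of `Z` in the range of `Q`; the orthogonal part `Zp` leaks in
as `W = M⁻¹ Gᵀ Φ Zp`. Since `M ≥ 1/2`, it is invertible with inverse of norm at most 2, and `Gᵀ Φ
Zp` is small because `Qᵀ Zp = 0`. -/
lemma leastSquares_stable {γ : Type*} [Fintype γ] {Z : Matrix (Fin n) γ ℝ} (hQ : Qᵀ * Q = 1)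
    {τ : ℝ} (hτ : 0 < τ)
    (h1 : ∀ z, |(Φ *ᵥ (Q *ᵥ z)) ⬝ᵥ (Φ *ᵥ (Q *ᵥ z)) - z ⬝ᵥ z| ≤ 1 / 2 * (z ⬝ᵥ z))
    (h2 : frobSq ((Φ * Q)ᵀ * (Φ * (Z - Q * Qᵀ * Z)) - Qᵀ * (Z - Q * Qᵀ * Z)) ≤
      (τ / 2) ^ 2 * frobSq (Z - Q * Qᵀ * Z)) :
    ((Φ * Q)ᵀ * (Φ * Q)).det ≠ 0 ∧
      frobSq (leastSquares Φ Q * Z) ≤ (1 + τ) ^ 2 * frobSq Z := by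
  set G := Φ * Q with hG
  set M := Gᵀ * G with hM
  have hMz : ∀ z, 1 / 2 * (z ⬝ᵥ z) ≤ z ⬝ᵥ (M *ᵥ z) := by
    intro z
    have e : z ⬝ᵥ (M *ᵥ z) = (Φ *ᵥ (Q *ᵥ z)) ⬝ᵥ (Φ *ᵥ (Q *ᵥ z)) := by
      rw [hM, ← Matrix.mulVec_mulVec, Matrix.dotProduct_mulVec, Matrix.vecMul_transpose, hG,
        Matrix.mulVec_mulVec]
    rw [e]
    linarith [(abs_le.1 (h1 z)).1]
  have hdet : M.det ≠ 0 := by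
    intro h0
    obtain ⟨v, hv, hv0⟩ := Matrix.exists_mulVec_eq_zero_iff.2 h0
    have h3 := hMz v
    rw [hv0, dotProduct_zero] at h3
    exact hv (dotProduct_self_eq_zero.1 (le_antisymm (by linarith) (dotProduct_self_nonneg' v)))
  refine ⟨hdet, ?_⟩
  have hMu := isUnit_iff_ne_zero.2 hdet
  set Zp := Z - Q * Qᵀ * Z with hZp
  have hQZp : Qᵀ * Zp = 0 := by
    rw [hZp, Matrix.mul_sub, ← Matrix.mul_assoc, ← Matrix.mul_assoc, hQ, Matrix.one_mul, sub_self]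
  rw [hQZp, sub_zero] at h2
  set W := M⁻¹ * (Gᵀ * (Φ * Zp)) with hW
  have hMW : M * W = Gᵀ * (Φ * Zp) := by
    rw [hW, ← Matrix.mul_assoc, Matrix.mul_nonsing_inv _ hMu, Matrix.one_mul]
  have hWle : frobSq W ≤ τ ^ 2 * frobSq Zp := by
    have h3 : frobSq W ≤ 4 * frobSq (M * W) := by
      rw [frobSq_eq_sum_dotProduct, frobSq_eq_sum_dotProduct, Finset.mul_sum]
      exact Finset.sum_le_sum fun a _ => dotProduct_le_of_quadratic_form hMz (W.col a)
    rw [hMW] at h3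
    linarith
  have hsplit : leastSquares Φ Q * Z = Q * (Qᵀ * Z + W) := by
    have h3 : Z = Q * (Qᵀ * Z) + Zp := by rw [hZp, ← Matrix.mul_assoc]; abel
    have h4 : leastSquares Φ Q * Zp = Q * W := by
      rw [leastSquares, ← hG, ← hM, hW]; simp only [Matrix.mul_assoc]
    conv_lhs => rw [h3]
    rw [Matrix.mul_add, ← Matrix.mul_assoc, leastSquares_mul hdet, h4, Matrix.mul_add]
  obtain ⟨hQs, hQi⟩ := isProj_mul_transpose hQ
  have hpyth := frobSq_eq_add_of_isProj hQs hQi Z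
  rw [← hZp, Matrix.mul_assoc, frobSq_mul_of_transpose_mul_self hQ] at hpyth
  rw [hsplit, frobSq_mul_of_transpose_mul_self hQ, frobSq_add]
  have hcs := trace_mul_sq_le (Qᵀ * Z) Wᵀ
  rw [frobSq_transpose] at hcs
  set a := frobSq (Qᵀ * Z)
  set b := frobSq Zp
  have ha : 0 ≤ a := frobSq_nonneg _
  have hb : 0 ≤ b := frobSq_nonneg _
  have htr : (Qᵀ * Z * Wᵀ).trace ≤ τ * ((a + b) / 2) := by
    refine (abs_le_of_sq_le_sq' (a := (Qᵀ * Z * Wᵀ).trace) (b := τ * ((a + b) / 2)) ?_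
      (by positivity)).2
    calc _ ≤ a * frobSq W := hcs
      _ ≤ a * (τ ^ 2 * b) := by gcongr
      _ ≤ _ := by nlinarith [mul_nonneg (sq_nonneg τ) (sq_nonneg (a - b))]
  rw [hpyth]
  nlinarith [mul_nonneg (sq_nonneg τ) ha]

end leastSquares

/-- Here `Q` and `Z` are deterministic. The tolerance `1 / 4` becomes `1 / 2` through the net, and
`√r` offsets `frobSq Q = r`. -/
theorem IsJL.leastSquares_stable {p n r N : ℕ} (hr : 0 < r) {Φ : S → Matrix (Fin p) (Fin n) ℝ}
    {τ : ℝ} (hτ : 0 < τ) {p₀ p₁ : ENNReal} (h₀ : IsJL μ Φ (1 / 4) p₀)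
    (h₁ : IsJL μ Φ (τ / (2 * √r)) p₁) {γ : Type*} [Fintype γ] (hγ : Fintype.card γ = N)
    (Z : Matrix (Fin n) γ ℝ) {Q : Matrix (Fin n) (Fin r) ℝ} (hQ : Qᵀ * Q = 1) :
    μ {ω | ¬ (((Φ ω * Q)ᵀ * (Φ ω * Q)).det ≠ 0 ∧
        frobSq (leastSquares (Φ ω) Q * Z) ≤ (1 + τ) ^ 2 * frobSq Z)} ≤
      12 ^ (12 * r) * (2 * p₀) + r * N * (2 * p₁) := by
  have hr' : (0 : ℝ) < r := by exact_mod_cast hr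
  have hsq : (τ / (2 * √r)) ^ 2 = (τ / 2) ^ 2 / r := by
    rw [div_pow, mul_pow, Real.sq_sqrt (by positivity)]; field_simp
  have e1 := h₀.subspace_embedding (by positivity) hQ
  have e2 := h₁.approx_mul Q (Z - Q * Qᵀ * Z)
  simp only [Fintype.card_fin, hγ] at e2
  refine (measure_mono ?_).trans ((measure_union_le _ _).trans (add_le_add e1 e2))
  intro ω hω
  by_contra hn
  simp only [Set.mem_union, Set.mem_ofPred_eq, not_or, not_lt, not_not] at hn
  obtain ⟨h1, h2⟩ := hn
  refine hω (OnePassTucker.leastSquares_stable hQ hτ (fun z => (h1 z).trans (le_of_eq ?_)) ?_)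
  · ring
  · rw [hsq, frobSq_of_transpose_mul_self hQ] at h2
    refine h2.trans (le_of_eq ?_)
    field_simp

/-! ### Numerical estimates -/

/-- The factor `r` in the exponent pays for the net, as `12 r log 12 + 3 L ≤ 15 r L`. -/
lemma twelve_pow_mul_exp_le {r : ℕ} (hr : 0 < r) {L : ℝ} (hL : Real.log 12 ≤ L) :
    (12 : ℝ) ^ (12 * r) * Real.exp (-(40 * r * L)) ≤ Real.exp (-(3 * L)) := by
  have hr' : (1 : ℝ) ≤ r := by exact_mod_cast hr
  have h0 : 0 ≤ Real.log 12 := Real.log_nonneg (by norm_num)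
  rw [← Real.exp_log (show (0 : ℝ) < 12 by norm_num), ← Real.exp_nat_mul, ← Real.exp_add,
    Real.exp_le_exp]
  push_cast
  nlinarith

/-- With `y` the reciprocal of the argument of the logarithm, every exponential, including the net
size, is at most `y³`. One `y` turns `d² n²` into `δ`, and `y² ≤ 1 / 144` absorbs the numerical
constant. -/
lemma factor_failure_le {d n r m : ℕ} {K ε δ : ℝ} (hK : 1 ≤ K) (hd : 2 ≤ d) (hr : 0 < r)
    (hrn : r ≤ n) (hε : 0 < ε) (hδ : 0 < δ) (hδ1 : δ < 1 / 3)
    (hm : 40 * 256 * 2048 * K ^ 2 * r * ((d : ℝ) - 1) ^ 2 / ε ^ 2 *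
      Real.log ((n : ℝ) ^ d * (d : ℝ) ^ 2 / δ) ≤ m) :
    d * (12 ^ (12 * r) * (2 * (((d : ℝ) - 1) * (2 * Real.exp
        (-((ε / 8 / (2 * ((d : ℝ) - 1))) ^ 2 * m / (2048 * K ^ 2)))))) +
      (r * n * (2 * (((d : ℝ) - 1) * (2 * Real.exp
        (-((ε / (4 * √r) / (2 * ((d : ℝ) - 1))) ^ 2 * m / (2048 * K ^ 2)))))) +
      (n * (((d : ℝ) - 1) * (2 * Real.exp
        (-((ε / (4 * √r) / (2 * ((d : ℝ) - 1))) ^ 2 * m / (2048 * K ^ 2))))) +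
      n * n * (2 * (((d : ℝ) - 1) * (2 * Real.exp
        (-((ε / (4 * √r) / (2 * ((d : ℝ) - 1))) ^ 2 * m / (2048 * K ^ 2))))))))) ≤ δ := by
  have hd' : (2 : ℝ) ≤ d := by exact_mod_cast hd
  have hr' : (1 : ℝ) ≤ r := by exact_mod_cast hr
  have hrn' : (r : ℝ) ≤ n := by exact_mod_cast hrn
  have hn' : (1 : ℝ) ≤ n := hr'.trans hrn'
  set q : ℝ := (d : ℝ) - 1 with hq
  have hq1 : 1 ≤ q := by linarith
  set x := (n : ℝ) ^ d * (d : ℝ) ^ 2 / δ with hx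
  set L := Real.log x with hL
  have hnd : (n : ℝ) ^ 2 ≤ (n : ℝ) ^ d := pow_le_pow_right₀ hn' hd
  have hx12 : 12 ≤ x := by
    rw [hx, le_div_iff₀ hδ]
    nlinarith [one_le_pow₀ hn' (n := d)]
  have hL12 : Real.log 12 ≤ L := Real.log_le_log (by norm_num) hx12
  have hL0 : 0 ≤ L := (Real.log_nonneg (by norm_num)).trans hL12
  have hexp : Real.exp (-(3 * L)) = (x⁻¹) ^ 3 := by
    rw [Real.exp_neg, show 3 * L = (3 : ℕ) * L by norm_num, Real.exp_nat_mul, hL,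
      Real.exp_log (by linarith), inv_pow]
  -- The 256 in the constant is `(8 * 2) ^ 2`, from `ε / 8` split among `q` factors.
  have h0 : 40 * r * L ≤ (ε / 8 / (2 * q)) ^ 2 * m / (2048 * K ^ 2) := by
    rw [le_div_iff₀ (by positivity)]
    calc 40 * r * L * (2048 * K ^ 2) = (ε / 8 / (2 * q)) ^ 2 *
          (40 * 256 * 2048 * K ^ 2 * r * q ^ 2 / ε ^ 2 * L) := by field_simp; ring
      _ ≤ _ := by gcongr
  have h1 : 3 * L ≤ (ε / (4 * √r) / (2 * q)) ^ 2 * m / (2048 * K ^ 2) := by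
    rw [le_div_iff₀ (by positivity)]
    have hsq : (ε / (4 * √r) / (2 * q)) ^ 2 = ε ^ 2 / (64 * r * q ^ 2) := by
      rw [div_pow, div_pow, mul_pow, Real.sq_sqrt (by positivity)]; field_simp; ring
    rw [hsq]
    calc 3 * L * (2048 * K ^ 2) ≤ 160 * L * (2048 * K ^ 2) := by gcongr; norm_num
      _ = ε ^ 2 / (64 * r * q ^ 2) *
          (40 * 256 * 2048 * K ^ 2 * r * q ^ 2 / ε ^ 2 * L) := by field_simp; ring
      _ ≤ _ := by gcongr
  set E₀ := Real.exp (-((ε / 8 / (2 * q)) ^ 2 * m / (2048 * K ^ 2))) with hE₀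
  set E₁ := Real.exp (-((ε / (4 * √r) / (2 * q)) ^ 2 * m / (2048 * K ^ 2))) with hE₁
  have hE0 : 12 ^ (12 * r) * E₀ ≤ (x⁻¹) ^ 3 := by
    rw [← hexp]
    exact (mul_le_mul_of_nonneg_left (Real.exp_le_exp.2 (neg_le_neg h0)) (by positivity)).trans
      (twelve_pow_mul_exp_le hr hL12)
  have hE1 : E₁ ≤ (x⁻¹) ^ 3 := by
    rw [← hexp]
    exact Real.exp_le_exp.2 (neg_le_neg h1)
  have hx0 : 0 < x := by linarith
  set y := x⁻¹ with hy
  have hy0 : 0 < y := by positivity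
  have hy12 : y ≤ 1 / 12 := by rw [hy, inv_eq_one_div]; gcongr
  have hyδ : d ^ 2 * n ^ 2 * y ≤ δ := by
    rw [hy, ← div_eq_mul_inv, div_le_iff₀ hx0, hx, mul_div_cancel₀ _ hδ.ne']
    nlinarith [sq_nonneg (d : ℝ)]
  have hE1p : 0 < E₁ := Real.exp_pos _
  calc _ = d * q * (4 * (12 ^ (12 * r) * E₀) + (4 * (r * n) + 2 * n + 4 * n ^ 2) * E₁) := by ring
    _ ≤ d * d * (4 * y ^ 3 + (4 * (n * n) + 2 * (n * n) + 4 * n ^ 2) * y ^ 3) := by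
        gcongr
        · linarith
        · nlinarith
    _ ≤ d * d * (4 * (n ^ 2 * y ^ 3) + 10 * n ^ 2 * y ^ 3) := by
        have : y ^ 3 ≤ n ^ 2 * y ^ 3 := le_mul_of_one_le_left (by positivity) (one_le_pow₀ hn')
        gcongr
        nlinarith
    _ = 14 * (d ^ 2 * n ^ 2 * y) * y ^ 2 := by ring
    _ ≤ 14 * δ * (1 / 12) ^ 2 := by gcongr
    _ ≤ δ := by linarith

lemma core_failure_le {d r N mc : ℕ} {K ε δ : ℝ} (hK : 1 ≤ K) (hd : 2 ≤ d) (hr : 0 < r)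
    (hN : 0 < N) (hε : 0 < ε) (hε1 : ε < 1) (hδ : 0 < δ) (hδ1 : δ < 1 / 3)
    (hm : 40 * 16 * 2048 * K ^ 2 * r * (d : ℝ) ^ 2 / ε ^ 2 *
      Real.log ((d : ℝ) * ((r : ℝ) + N) ^ 2 / δ) ≤ mc) :
    d * (12 ^ (12 * r) * (2 * (2 * Real.exp (-((1 / 4) ^ 2 * mc / (2048 * K ^ 2))))) +
      r * N * (2 * (2 * Real.exp
        (-((ε / d / (2 * √r)) ^ 2 * mc / (2048 * K ^ 2)))))) ≤ δ := by
  have hd' : (2 : ℝ) ≤ d := by exact_mod_cast hd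
  have hr' : (1 : ℝ) ≤ r := by exact_mod_cast hr
  have hN' : (1 : ℝ) ≤ N := by exact_mod_cast hN
  set x := (d : ℝ) * ((r : ℝ) + N) ^ 2 / δ with hx
  set L := Real.log x with hL
  have hx12 : 24 ≤ x := by
    rw [hx, le_div_iff₀ hδ]
    have : (4 : ℝ) ≤ ((r : ℝ) + N) ^ 2 := by nlinarith
    nlinarith
  have hL12 : Real.log 12 ≤ L := Real.log_le_log (by norm_num) (by linarith)
  have hL0 : 0 ≤ L := (Real.log_nonneg (by norm_num)).trans hL12
  have hexp : Real.exp (-(3 * L)) = (x⁻¹) ^ 3 := by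
    rw [Real.exp_neg, show 3 * L = (3 : ℕ) * L by norm_num, Real.exp_nat_mul, hL,
      Real.exp_log (by linarith), inv_pow]
  have h0 : 40 * r * L ≤ (1 / 4) ^ 2 * mc / (2048 * K ^ 2) := by
    rw [le_div_iff₀ (by positivity)]
    have h1 : 1 ≤ (d : ℝ) ^ 2 / ε ^ 2 := by
      rw [one_le_div (by positivity)]
      nlinarith
    calc 40 * r * L * (2048 * K ^ 2) ≤ 40 * r * L * (2048 * K ^ 2) * ((d : ℝ) ^ 2 / ε ^ 2) :=
          le_mul_of_one_le_right (by positivity) h1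
      _ = (1 / 4) ^ 2 * (40 * 16 * 2048 * K ^ 2 * r * (d : ℝ) ^ 2 / ε ^ 2 * L) := by
          field_simp; ring
      _ ≤ _ := by gcongr
  have h1 : 3 * L ≤ (ε / d / (2 * √r)) ^ 2 * mc / (2048 * K ^ 2) := by
    rw [le_div_iff₀ (by positivity)]
    have hsq : (ε / d / (2 * √r)) ^ 2 = ε ^ 2 / (4 * r * (d : ℝ) ^ 2) := by
      rw [div_pow, div_pow, mul_pow, Real.sq_sqrt (by positivity)]; field_simp; ring
    rw [hsq]
    calc 3 * L * (2048 * K ^ 2) ≤ 160 * L * (2048 * K ^ 2) := by gcongr; norm_num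
      _ = ε ^ 2 / (4 * r * (d : ℝ) ^ 2) *
          (40 * 16 * 2048 * K ^ 2 * r * (d : ℝ) ^ 2 / ε ^ 2 * L) := by field_simp; ring
      _ ≤ _ := by gcongr
  set E₀ := Real.exp (-((1 / 4) ^ 2 * mc / (2048 * K ^ 2))) with hE₀
  set E₁ := Real.exp (-((ε / d / (2 * √r)) ^ 2 * mc / (2048 * K ^ 2))) with hE₁
  have hE0 : 12 ^ (12 * r) * E₀ ≤ (x⁻¹) ^ 3 := by
    rw [← hexp]
    exact (mul_le_mul_of_nonneg_left (Real.exp_le_exp.2 (neg_le_neg h0)) (by positivity)).trans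
      (twelve_pow_mul_exp_le hr hL12)
  have hE1 : E₁ ≤ (x⁻¹) ^ 3 := by
    rw [← hexp]
    exact Real.exp_le_exp.2 (neg_le_neg h1)
  have hx0 : 0 < x := by linarith
  set y := x⁻¹ with hy
  have hy0 : 0 < y := by positivity
  have hy24 : y ≤ 1 / 24 := by rw [hy, inv_eq_one_div]; gcongr
  have hyδ : d * ((r : ℝ) + N) ^ 2 * y ≤ δ := by
    rw [hy, ← div_eq_mul_inv, div_le_iff₀ hx0, hx, mul_div_cancel₀ _ hδ.ne']
  have hE1p : 0 < E₁ := Real.exp_pos _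
  have hrN : (r : ℝ) * N ≤ ((r : ℝ) + N) ^ 2 := by nlinarith
  have h1N : (1 : ℝ) ≤ ((r : ℝ) + N) ^ 2 := by nlinarith
  calc _ = d * (4 * (12 ^ (12 * r) * E₀) + 4 * (r * N) * E₁) := by ring
    _ ≤ d * (4 * y ^ 3 + 4 * ((r : ℝ) + N) ^ 2 * y ^ 3) := by gcongr
    _ ≤ d * (4 * (((r : ℝ) + N) ^ 2 * y ^ 3) + 4 * ((r : ℝ) + N) ^ 2 * y ^ 3) := by
        have : y ^ 3 ≤ ((r : ℝ) + N) ^ 2 * y ^ 3 := le_mul_of_one_le_left (by positivity) h1N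
        gcongr
    _ = 8 * (d * ((r : ℝ) + N) ^ 2 * y) * y ^ 2 := by ring
    _ ≤ 8 * δ * (1 / 24) ^ 2 := by gcongr
    _ ≤ δ := by linarith

/-! ### Modewise products -/

section Tensor

variable {d : ℕ}

lemma modeProd_modeProd {p q s : ℕ} (X : Tensor d s) (A : Fin d → Matrix (Fin q) (Fin s) ℝ)
    (B : Fin d → Matrix (Fin p) (Fin q) ℝ) :
    modeProd (modeProd X A) B = modeProd X fun j => B j * A j := by
  funext l
  simp only [modeProd, Finset.mul_sum, Matrix.mul_apply]
  rw [Finset.sum_comm]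
  refine Finset.sum_congr rfl fun k _ => ?_
  rw [Finset.prod_univ_sum, Fintype.piFinset_univ, Finset.sum_mul]
  refine Finset.sum_congr rfl fun i _ => ?_
  rw [Finset.prod_mul_distrib, mul_assoc]

lemma modeProd_sub {p q : ℕ} (X Y : Tensor d q) (A : Fin d → Matrix (Fin p) (Fin q) ℝ) :
    modeProd (X - Y) A = modeProd X A - modeProd Y A := by
  funext l
  simp [modeProd, mul_sub, Finset.sum_sub_distrib]

lemma prod_one_apply {n : ℕ} {ι : Type*} [Fintype ι] (a b : ι → Fin n) :
    ∏ j, (1 : Matrix (Fin n) (Fin n) ℝ) (a j) (b j) = if a = b then 1 else 0 := by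
  split_ifs with h
  · subst h; simp
  · obtain ⟨j, hj⟩ := Function.ne_iff.1 h
    exact Finset.prod_eq_zero (Finset.mem_univ j) (Matrix.one_apply_ne hj)

lemma modeProd_one {n : ℕ} (X : Tensor d n) : modeProd X (fun _ => 1) = X := by
  funext l
  simp [modeProd, prod_one_apply]

/-- The product of a tensor with a square matrix along mode `k`. -/
def modeMul {n : ℕ} (k : Fin d) (A : Matrix (Fin n) (Fin n) ℝ) (X : Tensor d n) : Tensor d n :=
  modeProd X (Function.update (fun _ => 1) k A)

lemma unfold_eq_funSplitAt {n : ℕ} (k : Fin d) (X : Tensor d n) (a : Fin n)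
    (b : OtherModes k n) : unfold k X a b = X ((Equiv.funSplitAt k (Fin n)).symm (a, b)) := by
  simp only [unfold, Matrix.of_apply]
  congr 1
  funext j
  by_cases h : j = k
  · subst h; simp [Equiv.funSplitAt, Equiv.piSplitAt]
  · simp [Equiv.funSplitAt, Equiv.piSplitAt, h]

lemma unfold_sub {n : ℕ} (k : Fin d) (X Y : Tensor d n) :
    unfold k (X - Y) = unfold k X - unfold k Y := rfl

lemma unfold_modeMul {n : ℕ} (k : Fin d) (A : Matrix (Fin n) (Fin n) ℝ) (X : Tensor d n) :
    unfold k (modeMul k A X) = A * unfold k X := by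
  ext a b
  rw [unfold_eq_funSplitAt, modeMul, modeProd, ← (Equiv.funSplitAt k (Fin n)).symm.sum_comp,
    Fintype.sum_prod_type, Matrix.mul_apply]
  refine Finset.sum_congr rfl fun a' _ => ?_
  have h : ∀ b' : OtherModes k n,
      (∏ j, Function.update (fun _ => (1 : Matrix (Fin n) (Fin n) ℝ)) k A j
        ((Equiv.funSplitAt k (Fin n)).symm (a, b) j)
        ((Equiv.funSplitAt k (Fin n)).symm (a', b') j)) = A a a' * if b = b' then 1 else 0 := by
    intro b'
    rw [Fintype.prod_eq_mul_prod_subtype_ne _ k, ← prod_one_apply]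
    congr 1
    · simp [Equiv.funSplitAt, Equiv.piSplitAt]
    · refine Finset.prod_congr rfl fun j _ => ?_
      have hb : ∀ (a : Fin n) (b : OtherModes k n),
          (Equiv.funSplitAt k (Fin n)).symm (a, b) j = b j := fun a b => by
        simp [Equiv.funSplitAt, Equiv.piSplitAt, j.2]
      rw [Function.update_of_ne j.2, hb, hb]
  simp only [h]
  simp [unfold_eq_funSplitAt]

/-- The sum of the squared entries of a tensor. -/
def tensorSq {n : ℕ} (X : Tensor d n) : ℝ := ∑ i, X i ^ 2

lemma tensorSq_nonneg {n : ℕ} (X : Tensor d n) : 0 ≤ tensorSq X :=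
  Finset.sum_nonneg fun _ _ => sq_nonneg _

lemma frobSq_unfold {n : ℕ} (k : Fin d) (X : Tensor d n) : frobSq (unfold k X) = tensorSq X := by
  rw [tensorSq, ← (Equiv.funSplitAt k (Fin n)).symm.sum_comp, Fintype.sum_prod_type]
  simp only [frobSq, unfold_eq_funSplitAt]

lemma tensorNorm_add_le {n : ℕ} (X Y : Tensor d n) :
    tensorNorm (X + Y) ≤ tensorNorm X + tensorNorm Y := by
  have h : ∀ Z : Tensor d n, tensorNorm Z = ‖WithLp.toLp 2 Z‖ := by
    intro Z
    rw [EuclideanSpace.norm_eq]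
    simp [tensorNorm]
  rw [h, h, h]
  exact norm_add_le (WithLp.toLp 2 X) (WithLp.toLp 2 Y)

/-- The common induction step for enlarging a set of treated modes, used with arbitrary finite sets
and with initial segments. -/
lemma modeMul_modeProd_ite {n : ℕ} (X : Tensor d n) (A : Fin d → Matrix (Fin n) (Fin n) ℝ)
    {p p' : Fin d → Prop} [DecidablePred p] [DecidablePred p'] {k : Fin d} (hk : ¬ p k)
    (hp : ∀ j, p' j ↔ j = k ∨ p j) :
    modeMul k (A k) (modeProd X fun j => if p j then A j else 1) =
      modeProd X fun j => if p' j then A j else 1 := by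
  rw [modeMul, modeProd_modeProd]
  congr 1
  funext j
  by_cases hj : j = k
  · subst hj; simp [hk, (hp j).2 (Or.inl rfl)]
  · rw [Function.update_of_ne hj, Matrix.one_mul]
    simp [hp j, hj]

/-- Projecting every mode costs at most the sum of the costs of the single projections. -/
lemma tensorSq_sub_modeProd_le {n : ℕ} (X : Tensor d n) {P : Fin d → Matrix (Fin n) (Fin n) ℝ}
    (hs : ∀ j, (P j)ᵀ = P j) (hi : ∀ j, P j * P j = P j) :
    tensorSq (X - modeProd X P) ≤ ∑ j, frobSq (unfold j X - P j * unfold j X) := by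
  have key : ∀ s : Finset (Fin d),
      tensorSq (X - modeProd X fun j => if j ∈ s then P j else 1) ≤
        ∑ j ∈ s, frobSq (unfold j X - P j * unfold j X) := by
    intro s
    induction s using Finset.induction_on with
    | empty => simp [modeProd_one, tensorSq]
    | insert k s hk ih =>
      rw [Finset.sum_insert hk, ← modeMul_modeProd_ite X P hk fun j => Finset.mem_insert,
        ← frobSq_unfold k, unfold_sub, unfold_modeMul]
      rw [← frobSq_unfold k, unfold_sub] at ih
      set U := unfold k X
      set W := unfold k (modeProd X fun j => if j ∈ s then P j else 1)
      -- The component of `U - P W` orthogonal to the range of `P` is the cost `U - P U` of the new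
      -- mode alone; the other one is `P (U - W)`, at most the old error.
      have h1 := frobSq_eq_add_of_isProj (hs k) (hi k) (U - P k * W)
      have h2 : U - P k * W - P k * (U - P k * W) = U - P k * U := by
        rw [Matrix.mul_sub, ← Matrix.mul_assoc, hi]; abel
      have h3 : P k * (U - P k * W) = P k * (U - W) := by
        rw [Matrix.mul_sub, ← Matrix.mul_assoc, hi, Matrix.mul_sub]
      have h4 := frobSq_eq_add_of_isProj (hs k) (hi k) (U - W)
      rw [h2, h3] at h1
      linarith [frobSq_nonneg (U - W - P k * (U - W))]
  have h := key Finset.univ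
  simpa using h

/-- The tensor obtained from `Y` by multiplying only the modes before the `k`-th one. -/
def partialModeProd {n : ℕ} (Y : Tensor d n) (R : Fin d → Matrix (Fin n) (Fin n) ℝ) (k : ℕ) :
    Tensor d n :=
  modeProd Y fun j => if (j : ℕ) < k then R j else 1

/-- The bound on `R k` is asked only on the one tensor it meets, since an operator norm bound of
this quality is not available. -/
lemma tensorSq_modeProd_le {n : ℕ} (Y : Tensor d n) (R : Fin d → Matrix (Fin n) (Fin n) ℝ)
    {c : ℝ} (hc : 0 ≤ c) (h : ∀ k : Fin d, frobSq (R k * unfold k (partialModeProd Y R k)) ≤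
      c * frobSq (unfold k (partialModeProd Y R k))) :
    tensorSq (modeProd Y R) ≤ c ^ d * tensorSq Y := by
  have key : ∀ k ≤ d, tensorSq (partialModeProd Y R k) ≤ c ^ k * tensorSq Y := by
    intro k
    induction k with
    | zero => intro _; simp [partialModeProd, modeProd_one]
    | succ k ih =>
      intro hk
      have e : partialModeProd Y R (k + 1) =
          modeMul ⟨k, hk⟩ (R ⟨k, hk⟩) (partialModeProd Y R k) := by
        rw [partialModeProd, partialModeProd, modeMul_modeProd_ite Y R
          (p := fun j => (j : ℕ) < k) (p' := fun j => (j : ℕ) < k + 1) (by simp)]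
        intro j
        rw [Fin.ext_iff]
        simp only
        omega
      rw [e, ← frobSq_unfold ⟨k, hk⟩, unfold_modeMul]
      refine (h ⟨k, hk⟩).trans ?_
      rw [frobSq_unfold, pow_succ', mul_assoc]
      exact mul_le_mul_of_nonneg_left (ih (Nat.le_of_succ_le hk)) hc
  have h2 := key d le_rfl
  have e : partialModeProd Y R d = modeProd Y R := by simp [partialModeProd]
  rwa [e] at h2

end Tensor

/-! ### The error of the algorithm on a good event -/

/-- Full rank makes `Di` invertible, so solving the system undoes it and the SVD sees the plain
Kronecker sketch. -/
lemma recoverFactor_looMeasurement {d n m r : ℕ} (X : Tensor d n) (i : Fin d)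
    {Di : Matrix (Fin n) (Fin n) ℝ} (hD : Di.rank = n)
    (svd : Matrix (Fin n) (OtherModes i m) ℝ → Matrix (Fin n) (Fin r) ℝ)
    (Ωi : {j : Fin d // j ≠ i} → Matrix (Fin m) (Fin n) ℝ) :
    recoverFactor svd Di (looMeasurement X i Di Ωi) =
      svd (unfold i X * (kroneckerFamily Ωi)ᵀ) := by
  have hu : IsUnit Di.det := by
    rw [← Matrix.isUnit_iff_isUnit_det, ← Matrix.linearIndependent_cols_iff_isUnit,
      linearIndependent_iff_card_eq_finrank_span, Set.finrank, ← Matrix.rank_eq_finrank_span_cols, hD]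
    simp
  rw [recoverFactor, looMeasurement, Matrix.mul_assoc Di, ← Matrix.mul_assoc Di⁻¹,
    Matrix.nonsing_inv_mul _ hu, Matrix.one_mul]

/-- Least squares fixes the range of each `Q i`, so only the residual `Y` is distorted and the error
is `Y` multiplied by all the `R i`, minus `Y`. The two terms give `exp ε` and 1. -/
theorem tensorNorm_modeProd_sub_le {d n r mc : ℕ} (X : Tensor d n)
    {Q : Fin d → Matrix (Fin n) (Fin r) ℝ} {Φ : Fin d → Matrix (Fin mc) (Fin n) ℝ}
    (hQ : ∀ i, (Q i)ᵀ * Q i = 1) {ε B : ℝ} (hε : 0 < ε) (hd : 0 < d)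
    (hfac : ∑ i, frobSq (unfold i X - Q i * (Q i)ᵀ * unfold i X) ≤ B)
    (hcore : ∀ k, ((Φ k * Q k)ᵀ * (Φ k * Q k)).det ≠ 0 ∧
      frobSq (leastSquares (Φ k) (Q k) *
        unfold k (partialModeProd (X - modeProd X fun i => Q i * (Q i)ᵀ)
          (fun i => leastSquares (Φ i) (Q i)) k)) ≤
      (1 + ε / d) ^ 2 * frobSq (unfold k (partialModeProd (X - modeProd X fun i => Q i * (Q i)ᵀ)
          (fun i => leastSquares (Φ i) (Q i)) k))) :
    tensorNorm (modeProd (recoverCore (coreMeasurement X Φ) Φ Q) Q - X) ≤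
      (1 + Real.exp ε) * √B := by
  set P : Fin d → Matrix (Fin n) (Fin n) ℝ := fun i => Q i * (Q i)ᵀ with hP
  set R : Fin d → Matrix (Fin n) (Fin n) ℝ := fun i => leastSquares (Φ i) (Q i) with hR
  set Y := X - modeProd X P with hY
  have hd' : (0 : ℝ) < d := by exact_mod_cast hd
  have h1 : modeProd (recoverCore (coreMeasurement X Φ) Φ Q) Q = modeProd X R := by
    rw [recoverCore, coreMeasurement, modeProd_modeProd, modeProd_modeProd]
    congr 1
    funext i
    rw [Matrix.mul_assoc]
    exact mul_pinv_mul_eq_leastSquares (hcore i).1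
  have h2 : modeProd (modeProd X P) R = modeProd X P := by
    rw [modeProd_modeProd]
    congr 1
    funext i
    simp only [hR, hP]
    rw [← Matrix.mul_assoc, leastSquares_mul (hcore i).1]
  have h3 : modeProd X R - X = modeProd Y R + -Y := by
    rw [hY, modeProd_sub, h2]; abel
  have hYB : tensorSq Y ≤ B :=
    (tensorSq_sub_modeProd_le X (fun j => (isProj_mul_transpose (hQ j)).1)
      fun j => (isProj_mul_transpose (hQ j)).2).trans hfac
  have h4 := tensorSq_modeProd_le Y R (by positivity) fun k => (hcore k).2
  have h5 : ((1 + ε / d) ^ 2) ^ d ≤ Real.exp ε ^ 2 := by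
    rw [← pow_mul, mul_comm, pow_mul]
    gcongr
    calc (1 + ε / d) ^ d ≤ Real.exp (ε / d) ^ d := by
          gcongr
          linarith [Real.add_one_le_exp (ε / d)]
      _ = _ := by rw [← Real.exp_nat_mul]; congr 1; field_simp
  have h6 : tensorNorm (modeProd Y R) ≤ Real.exp ε * √B := by
    have : tensorSq (modeProd Y R) ≤ Real.exp ε ^ 2 * B :=
      h4.trans (mul_le_mul h5 hYB (tensorSq_nonneg _) (by positivity))
    calc tensorNorm (modeProd Y R) = √(tensorSq (modeProd Y R)) := rfl
      _ ≤ √(Real.exp ε ^ 2 * B) := Real.sqrt_le_sqrt this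
      _ = _ := by rw [Real.sqrt_mul (by positivity), Real.sqrt_sq (Real.exp_pos _).le]
  have h7 : tensorNorm (-Y) ≤ √B := by
    have : tensorNorm (-Y) = √(tensorSq Y) := by simp [tensorNorm, tensorSq]
    rw [this]
    exact Real.sqrt_le_sqrt hYB
  rw [h1, h3]
  refine (tensorNorm_add_le _ _).trans ?_
  linarith

/-! ### Measurability of the recovered quantities -/

section Measurability

variable {Ω : Type*} [MeasurableSpace Ω]

lemma measurable_det {r : ℕ} {A : Ω → Matrix (Fin r) (Fin r) ℝ}
    (hA : ∀ a b, Measurable fun ω => A ω a b) : Measurable fun ω => (A ω).det := by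
  simp only [Matrix.det_apply]
  refine Finset.measurable_sum _ fun σ _ => ?_
  exact (Finset.measurable_prod _ fun i _ => hA _ _).const_smul (Equiv.Perm.sign σ)

lemma measurable_inv_apply {r : ℕ} {A : Ω → Matrix (Fin r) (Fin r) ℝ}
    (hA : ∀ a b, Measurable fun ω => A ω a b) (a b : Fin r) :
    Measurable fun ω => (A ω)⁻¹ a b := by
  simp only [Matrix.inv_def, Matrix.smul_apply, Ring.inverse_eq_inv', Matrix.adjugate_apply,
    smul_eq_mul]
  refine (measurable_det hA).inv.mul (measurable_det fun c e => ?_)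
  by_cases h : c = b
  · subst h
    simp only [Matrix.updateRow_self]
    exact measurable_const
  · simp only [Matrix.updateRow_ne h]
    exact hA c e

/-- The explicit inverse, a determinant quotient, is Borel everywhere, which is why events are
phrased with `leastSquares` and not with the chosen `pinv`. -/
lemma measurable_leastSquares_apply {p n r : ℕ} {Φ : Ω → Matrix (Fin p) (Fin n) ℝ}
    {Q : Ω → Matrix (Fin n) (Fin r) ℝ} (hΦ : ∀ a b, Measurable fun ω => Φ ω a b)
    (hQ : ∀ a b, Measurable fun ω => Q ω a b) (a b : Fin n) :
    Measurable fun ω => leastSquares (Φ ω) (Q ω) a b := by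
  have hG := measurable_mul_apply hΦ hQ
  have hGt : ∀ a b, Measurable fun ω => (Φ ω * Q ω)ᵀ a b := fun a b => hG b a
  exact measurable_mul_apply hQ (measurable_mul_apply
    (measurable_inv_apply (measurable_mul_apply hGt hG)) (measurable_mul_apply hGt hΦ)) a b

lemma measurable_modeProd_apply {d p q : ℕ} {X : Ω → Tensor d q}
    {A : Ω → Fin d → Matrix (Fin p) (Fin q) ℝ} (hX : ∀ i, Measurable fun ω => X ω i)
    (hA : ∀ j a b, Measurable fun ω => A ω j a b) (l : Fin d → Fin p) :
    Measurable fun ω => modeProd (X ω) (A ω) l :=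
  Finset.measurable_sum _ fun i _ => (Finset.measurable_prod _ fun j _ => hA j _ _).mul (hX i)

end Measurability

/-! ### The quantities of the algorithm as functions of the entries of the random matrices -/

section Recovery

variable {d n r m mc : ℕ}

/-- The index type of the entries of all the random matrices. -/
abbrev EntryIndex (d n m mc : ℕ) : Type :=
  ((Σ i : Fin d, {j : Fin d // j ≠ i}) × Fin m × Fin n) ⊕ (Fin d × Fin mc × Fin n)

/-- The matrix `Ω_(i,j)` as a function of the entries. -/
def entriesOmega (x : EntryIndex d n m mc → ℝ) (i : Fin d) (j : {j : Fin d // j ≠ i}) :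
    Matrix (Fin m) (Fin n) ℝ :=
  coordMatrix (fun z => Sum.inl (⟨i, j⟩, z)) x

/-- The matrix `Φ_i` as a function of the entries. -/
def entriesPhi (x : EntryIndex d n m mc → ℝ) (i : Fin d) : Matrix (Fin mc) (Fin n) ℝ :=
  coordMatrix (fun z => Sum.inr (i, z)) x

variable (X : Tensor d n)
  (svd : ∀ i : Fin d, Matrix (Fin n) (OtherModes i m) ℝ → Matrix (Fin n) (Fin r) ℝ)

/-- The recovered factors as functions of the entries. -/
def entriesFactor (x : EntryIndex d n m mc → ℝ) (i : Fin d) : Matrix (Fin n) (Fin r) ℝ :=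
  svd i (unfold i X * (kroneckerFamily (entriesOmega x i))ᵀ)

/-- The part of the tensor that the recovered factors miss. -/
def entriesResidual (x : EntryIndex d n m mc → ℝ) : Tensor d n :=
  X - modeProd X fun i => entriesFactor X svd x i * (entriesFactor X svd x i)ᵀ

/-- The residual after least squares in the modes before the `k`-th one. -/
def entriesPartial (x : EntryIndex d n m mc → ℝ) (k : Fin d) : Tensor d n :=
  partialModeProd (entriesResidual X svd x)
    (fun i => leastSquares (entriesPhi x i) (entriesFactor X svd x i)) k

/-- Least squares in mode `k` is stable. -/
def coreGood (τ : ℝ) (k : Fin d) : Set (EntryIndex d n m mc → ℝ) :=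
  {x | ((entriesPhi x k * entriesFactor X svd x k)ᵀ *
      (entriesPhi x k * entriesFactor X svd x k)).det ≠ 0 ∧
    frobSq (leastSquares (entriesPhi x k) (entriesFactor X svd x k) *
      unfold k (entriesPartial X svd x k)) ≤
      (1 + τ) ^ 2 * frobSq (unfold k (entriesPartial X svd x k))}

variable {X svd}

lemma measurable_entriesPhi (i : Fin d) (a : Fin mc) (b : Fin n) :
    Measurable fun x : EntryIndex d n m mc → ℝ => entriesPhi x i a b :=
  measurable_pi_apply _

lemma measurable_entriesFactor (hsvd : ∀ i, IsSVDRoutine (svd i)) (i : Fin d) (a : Fin n)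
    (b : Fin r) :
    Measurable fun x : EntryIndex d n m mc → ℝ => entriesFactor X svd x i a b := by
  have h : Measurable fun x : EntryIndex d n m mc → ℝ => fun (a : Fin n) (c : OtherModes i m) =>
      (unfold i X * (kroneckerFamily (entriesOmega x i))ᵀ) a c := by
    refine measurable_pi_lambda _ fun a => measurable_pi_lambda _ fun c => ?_
    refine measurable_mul_apply (A := fun _ => unfold i X) (fun _ _ => measurable_const)
      (fun f g => ?_) a c
    exact measurable_kroneckerFamily_apply
      (A := fun (x : EntryIndex d n m mc → ℝ) => entriesOmega x i)
      (fun k a b => measurable_pi_apply _) g f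
  exact ((hsvd i).measurable a b).comp h

lemma measurable_entriesPartial (hsvd : ∀ i, IsSVDRoutine (svd i)) (k : Fin d)
    (l : Fin d → Fin n) :
    Measurable fun x : EntryIndex d n m mc → ℝ => entriesPartial X svd x k l := by
  have hF := fun i => measurable_entriesFactor (mc := mc) (X := X) hsvd i
  refine measurable_modeProd_apply (X := fun x => entriesResidual X svd x) (fun i => ?_)
    (fun j a b => ?_) l
  · refine measurable_const.sub (measurable_modeProd_apply (X := fun _ => X)
      (A := fun x j => entriesFactor X svd x j * (entriesFactor X svd x j)ᵀ)
      (fun _ => measurable_const) (fun j a b => ?_) i)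
    exact measurable_mul_apply (hF j) (fun a b => hF j b a) a b
  · split_ifs
    · exact measurable_leastSquares_apply (fun a b => measurable_entriesPhi j a b) (hF j) a b
    · exact measurable_const

lemma measurableSet_coreGood (hsvd : ∀ i, IsSVDRoutine (svd i)) (τ : ℝ) (k : Fin d) :
    MeasurableSet (coreGood (mc := mc) X svd τ k) := by
  have hF := measurable_entriesFactor (mc := mc) (X := X) hsvd k
  have hΦ := measurable_entriesPhi (n := n) (m := m) (mc := mc) k
  have hG := measurable_mul_apply hΦ hF
  have hZ : ∀ a b, Measurable fun x : EntryIndex d n m mc → ℝ =>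
      unfold k (entriesPartial X svd x k) a b := fun a b =>
    measurable_entriesPartial hsvd k _
  refine MeasurableSet.inter ?_ ?_
  · exact (measurableSet_eq_fun (measurable_det (measurable_mul_apply (fun a b => hG b a) hG))
      measurable_const).compl
  · exact measurableSet_le
      (measurable_frobSq (measurable_mul_apply (measurable_leastSquares_apply hΦ hF) hZ))
      ((measurable_frobSq hZ).const_mul _)

/-- All coordinates except the entries of `Φ_k` are frozen. The factors depend on the `Ω_(i,j)`
alone and the partial residual uses only earlier `Φ_j`, so both are constant while `Φ_k` still
varies. -/
theorem measure_coreGood_compl_le {ξ : EntryIndex d n m mc → S → ℝ} (hind : iIndepFun ξ μ)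
    (hξ : ∀ i, Measurable (ξ i)) {K : ℝ≥0} (hK : 1 ≤ K) (hmc : 0 < mc)
    (hs : ∀ z, IsNormalizedSubgaussian μ K mc (ξ (Sum.inr z)))
    (hsvd : ∀ i, IsSVDRoutine (svd i)) (hr : 0 < r) (hrn : r ≤ n) {τ : ℝ} (hτ : 0 < τ)
    (hτ1 : τ ≤ 1) (k : Fin d) :
    μ {ω | (fun i => ξ i ω) ∈ (coreGood X svd τ k)ᶜ} ≤
      12 ^ (12 * r) * (2 * ENNReal.ofReal (2 * Real.exp (-((1 / 4) ^ 2 * mc / (2048 * K ^ 2))))) +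
        r * ↑(n ^ (d - 1)) * (2 * ENNReal.ofReal (2 * Real.exp
          (-((τ / (2 * √r)) ^ 2 * mc / (2048 * K ^ 2))))) := by
  classical
  have hr' : (1 : ℝ) ≤ r := by exact_mod_cast hr
  refine measure_le_of_forall_piecewise hind hξ
    (Set.range fun z : Fin mc × Fin n => (Sum.inr (k, z) : EntryIndex d n m mc))
    (measurableSet_coreGood hsvd τ k).compl fun x => ?_
  set F := Set.range fun z : Fin mc × Fin n => (Sum.inr (k, z) : EntryIndex d n m mc) with hF
  have hfac : ∀ y i, entriesFactor X svd (F.piecewise y x) i = entriesFactor X svd x i := by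
    intro y i
    have : entriesOmega (F.piecewise y x) i = entriesOmega x i := by
      funext j
      ext a b
      simp only [entriesOmega, coordMatrix, Matrix.of_apply]
      refine Set.piecewise_eq_of_notMem _ _ _ ?_
      rintro ⟨z, hz⟩
      cases hz
    rw [entriesFactor, this]; rfl
  have hphi : ∀ y, ∀ i ≠ k, entriesPhi (F.piecewise y x) i = entriesPhi x i := by
    intro y i hik
    ext a b
    simp only [entriesPhi, coordMatrix, Matrix.of_apply]
    refine Set.piecewise_eq_of_notMem _ _ _ ?_
    rintro ⟨z, hz⟩
    simp only [Sum.inr.injEq, Prod.mk.injEq] at hz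
    exact hik hz.1.symm
  have hphik : ∀ y, entriesPhi (F.piecewise y x) k = entriesPhi y k := by
    intro y
    ext a b
    simp only [entriesPhi, coordMatrix, Matrix.of_apply]
    exact Set.piecewise_eq_of_mem _ _ _ ⟨(a, b), rfl⟩
  have hpart : ∀ y, entriesPartial X svd (F.piecewise y x) k = entriesPartial X svd x k := by
    intro y
    simp only [entriesPartial, entriesResidual, partialModeProd, hfac]
    congr 1
    funext j
    split_ifs with hj
    · rw [hphi y j fun h => by subst h; exact lt_irrefl _ hj]
    · rfl
  have hinj : Function.Injective fun z : Fin mc × Fin n =>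
      (Sum.inr (k, z) : EntryIndex d n m mc) := fun z w h => by simpa using h
  have hsq : 1 ≤ √(r : ℝ) := Real.one_le_sqrt.2 hr'
  have hJL : ∀ {η : ℝ}, 0 < η → η ≤ 1 → IsJL μ (fun ω => entriesPhi (fun i => ξ i ω) k) η
      (ENNReal.ofReal (2 * Real.exp (-(η ^ 2 * mc / (2048 * K ^ 2))))) := fun hη hη1 =>
    isJL_subgaussian hmc hK (hind.precomp hinj) (fun a b => hs _) hη hη1
  have hcard : Fintype.card (OtherModes k n) = n ^ (d - 1) := by
    simp [OtherModes, Fintype.card_subtype_compl]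
  have h := IsJL.leastSquares_stable hr hτ (hJL (by norm_num) (by norm_num))
    (hJL (η := τ / (2 * √r)) (by positivity) (by
      rw [div_le_one (by positivity)]; linarith)) hcard (unfold k (entriesPartial X svd x k))
    (((hsvd k).spec _).orthonormal hrn : (entriesFactor X svd x k)ᵀ * entriesFactor X svd x k = 1)
  refine le_trans (measure_mono fun ω hω => ?_) h
  simp only [Set.mem_ofPred_eq, coreGood, Set.mem_compl_iff] at hω ⊢
  rwa [hfac, hphik, hpart] at hω

theorem measure_factor_failure_le {ξ : EntryIndex d n m mc → S → ℝ} (hind : iIndepFun ξ μ)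
    (hξ : ∀ i, Measurable (ξ i)) {K : ℝ≥0} (hK : 1 ≤ K) (hm : 0 < m)
    (hs : ∀ z, IsNormalizedSubgaussian μ K m (ξ (Sum.inl z)))
    (hsvd : ∀ i, IsSVDRoutine (svd i)) (hd : 2 ≤ d) (hr : 0 < r) (hrn : r ≤ n) {ε : ℝ}
    (hε : 0 < ε) (hε1 : ε < 1) (i : Fin d) {p : ℝ → ENNReal}
    (hp : ∀ α, p α = ENNReal.ofReal (((d : ℝ) - 1) * (2 * Real.exp
      (-((α / (2 * ((d : ℝ) - 1))) ^ 2 * m / (2048 * K ^ 2)))))) :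
    μ {ω | ¬ frobSq (unfold i X - entriesFactor X svd (fun i => ξ i ω) i *
        (entriesFactor X svd (fun i => ξ i ω) i)ᵀ * unfold i X) ≤
        (1 + ε) / (1 - ε) * tailEnergy X r i} ≤
      12 ^ (12 * r) * (2 * p (ε / 8)) + (r * n * (2 * p (ε / (4 * √r))) +
        (n * p (ε / (4 * √r)) + n * n * (2 * p (ε / (4 * √r))))) := by
  have hr' : (1 : ℝ) ≤ r := by exact_mod_cast hr
  have hsq : 1 ≤ √(r : ℝ) := Real.one_le_sqrt.2 hr'
  obtain ⟨V, hV, hVle⟩ := exists_frobSq_unfold_sub_le_tailEnergy hd hrn X i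
  have hcard : Fintype.card {j : Fin d // j ≠ i} = d - 1 := by
    simp [Fintype.card_subtype_compl]
  have hcast : ((Fintype.card {j : Fin d // j ≠ i} : ℕ) : ℝ) = (d : ℝ) - 1 := by
    rw [hcard, Nat.cast_sub (by omega), Nat.cast_one]
  have hne : Nonempty {j : Fin d // j ≠ i} := by
    rw [← Fintype.card_pos_iff, hcard]; omega
  have hJL : ∀ {α : ℝ}, 0 < α → α ≤ 1 →
      IsJL μ (fun ω => kroneckerFamily (entriesOmega (fun i => ξ i ω) i)) α (p α) := by
    intro α hα hα1
    have h := isJL_kroneckerFamily hind hξ hK hm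
      (fun (j : {j : Fin d // j ≠ i}) z => (Sum.inl (⟨i, j⟩, z) : EntryIndex d n m mc))
      (fun z w h => by
        simp only [Sum.inl.injEq, Prod.mk.injEq, Sigma.mk.injEq, heq_eq_eq, true_and] at h
        exact Prod.ext h.1 h.2)
      (fun k z => hs _) hα hα1
    rw [hcast] at h
    rw [hp]
    exact h
  have h := IsJL.factor_recovery hr hrn hε hε1 (hJL (α := ε / 8) (by positivity) (by linarith))
    (hJL (α := ε / (4 * √r)) (by positivity) (by
      rw [div_le_one (by positivity)]; linarith)) (unfold i X) hV
  refine le_trans (measure_mono fun ω hω => ?_) h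
  simp only [Set.mem_ofPred_eq] at hω ⊢
  intro hall
  refine hω ((hall _ ((hsvd i).spec _)).trans ?_)
  exact mul_le_mul_of_nonneg_left hVle (div_nonneg (by linarith) (by linarith))

theorem tensorNorm_kroneckerOnePass_sub_le (hsvd : ∀ i, IsSVDRoutine (svd i))
    {D : Fin d → Matrix (Fin n) (Fin n) ℝ} (hD : ∀ i, (D i).rank = n) (hd : 2 ≤ d)
    (hrn : r ≤ n) {ε : ℝ} (hε : 0 < ε) {x : EntryIndex d n m mc → ℝ}
    (hfac : ∀ i, frobSq (unfold i X - entriesFactor X svd x i *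
        (entriesFactor X svd x i)ᵀ * unfold i X) ≤ (1 + ε) / (1 - ε) * tailEnergy X r i)
    (hcore : ∀ k, x ∈ coreGood X svd (ε / d) k) :
    tensorNorm (kroneckerOnePass svd D (fun i j => entriesOmega x i j)
        (fun i => entriesPhi x i) X - X) ≤
      (1 + Real.exp ε) * √((1 + ε) / (1 - ε) * ∑ j, tailEnergy X r j) := by
  have h := tensorNorm_modeProd_sub_le X (Q := entriesFactor X svd x) (Φ := entriesPhi x)
    (fun i => ((hsvd i).spec _).orthonormal hrn) hε (by omega)
    (B := (1 + ε) / (1 - ε) * ∑ j, tailEnergy X r j)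
    (by rw [Finset.mul_sum]; exact Finset.sum_le_sum fun i _ => hfac i) hcore
  have hQ : (fun i => recoverFactor (svd i) (D i)
      (looMeasurement X i (D i) fun j => entriesOmega x i j)) = entriesFactor X svd x := by
    funext i
    exact recoverFactor_looMeasurement X i (hD i) (svd i) _
  rw [kroneckerOnePass]
  simp only [hQ]
  exact h

end Recovery

/-! ### The probability of success -/

lemma ofReal_one_sub_le_measure {S : Type*} [MeasurableSpace S] {μ : Measure S}
    [IsProbabilityMeasure μ] {ι : Type*} [Fintype ι] {A B : ι → Set S} {a b : ENNReal} {δ : ℝ}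
    (hδ : 0 < δ) (hA : ∀ i, μ (A i) ≤ a) (hB : ∀ i, μ (B i) ≤ b)
    (ha : Fintype.card ι * a ≤ ENNReal.ofReal δ) (hb : Fintype.card ι * b ≤ ENNReal.ofReal δ)
    {good : Set S} (h : ∀ ω, (∀ i, ω ∉ A i) → (∀ i, ω ∉ B i) → ω ∈ good) :
    ENNReal.ofReal (1 - 3 * δ) ≤ μ good := by
  have hU : ∀ {A : ι → Set S} {a : ENNReal}, (∀ i, μ (A i) ≤ a) →
      Fintype.card ι * a ≤ ENNReal.ofReal δ → μ (⋃ i, A i) ≤ ENNReal.ofReal δ := by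
    intro A a hA ha
    refine (measure_iUnion_fintype_le _ _).trans ((Finset.sum_le_sum fun i _ => hA i).trans ?_)
    rwa [Finset.sum_const, Finset.card_univ, nsmul_eq_mul]
  have hbad : μ goodᶜ ≤ ENNReal.ofReal (3 * δ) := by
    have hsub : goodᶜ ⊆ (⋃ i, A i) ∪ ⋃ i, B i := by
      intro ω hω
      by_contra hn
      simp only [Set.mem_union, Set.mem_iUnion, not_or, not_exists] at hn
      exact hω (h ω hn.1 hn.2)
    calc μ goodᶜ ≤ ENNReal.ofReal δ + ENNReal.ofReal δ :=
          (measure_mono hsub).trans ((measure_union_le _ _).trans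
            (add_le_add (hU hA ha) (hU hB hb)))
      _ = ENNReal.ofReal (δ + δ) := (ENNReal.ofReal_add hδ.le hδ.le).symm
      _ ≤ _ := ENNReal.ofReal_le_ofReal (by linarith)
  -- Subadditivity on `good ∪ goodᶜ` gives the lower bound without measurability of `good`.
  rw [ENNReal.ofReal_sub _ (by positivity), ENNReal.ofReal_one, tsub_le_iff_right]
  calc (1 : ENNReal) = μ (good ∪ goodᶜ) := by rw [Set.union_compl_self, measure_univ]
    _ ≤ μ good + μ goodᶜ := measure_union_le _ _
    _ ≤ _ := by gcongr

lemma factor_failure_ennreal_le {K : ℝ≥0} (hK1 : 1 ≤ K) {d n r m : ℕ} {ε δ : ℝ} (hd : 2 ≤ d)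
    (hr : 1 ≤ r) (hrn : r ≤ n) (hε : 0 < ε) (hδ : 0 < δ) (hδ1 : δ < 1 / 3)
    (hm : 40 * 256 * 2048 * (K : ℝ) ^ 2 * r * ((d : ℝ) - 1) ^ 2 / ε ^ 2 *
      Real.log ((n : ℝ) ^ d * (d : ℝ) ^ 2 / δ) ≤ m) {p : ℝ → ENNReal}
    (hp : ∀ α, p α = ENNReal.ofReal (((d : ℝ) - 1) * (2 * Real.exp
      (-((α / (2 * ((d : ℝ) - 1))) ^ 2 * m / (2048 * K ^ 2)))))) :
    (d : ENNReal) * (12 ^ (12 * r) * (2 * p (ε / 8)) + (r * n * (2 * p (ε / (4 * √r))) +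
        (n * p (ε / (4 * √r)) + n * n * (2 * p (ε / (4 * √r)))))) ≤ ENNReal.ofReal δ := by
  have hd' : (2 : ℝ) ≤ d := by exact_mod_cast hd
  have h := factor_failure_le (K := (K : ℝ)) hK1 hd hr hrn hε hδ hδ1 hm
  have h3 : 0 ≤ (d : ℝ) - 1 := by linarith
  rw [hp, hp]
  generalize ha : ((d : ℝ) - 1) * (2 * Real.exp
    (-((ε / 8 / (2 * ((d : ℝ) - 1))) ^ 2 * m / (2048 * (K : ℝ) ^ 2)))) = a at h ⊢
  generalize hb : ((d : ℝ) - 1) * (2 * Real.exp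
    (-((ε / (4 * √r) / (2 * ((d : ℝ) - 1))) ^ 2 * m / (2048 * (K : ℝ) ^ 2)))) = b at h ⊢
  have ha0 : 0 ≤ a := by rw [← ha]; positivity
  have hb0 : 0 ≤ b := by rw [← hb]; positivity
  clear ha hb hp hm hδ1
  lift a to ℝ≥0 using ha0
  lift b to ℝ≥0 using hb0
  lift δ to ℝ≥0 using hδ.le
  simp only [ENNReal.ofReal_coe_nnreal]
  exact_mod_cast h

lemma core_failure_ennreal_le {K : ℝ≥0} (hK1 : 1 ≤ K) {d n r mc : ℕ} {ε δ : ℝ} (hd : 2 ≤ d)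
    (hr : 1 ≤ r) (hrn : r ≤ n) (hε : 0 < ε) (hε1 : ε < 1) (hδ : 0 < δ) (hδ1 : δ < 1 / 3)
    (hmc : 40 * 16 * 2048 * (K : ℝ) ^ 2 * r * (d : ℝ) ^ 2 / ε ^ 2 *
      Real.log ((d : ℝ) * ((r : ℝ) + (n : ℝ) ^ (d - 1)) ^ 2 / δ) ≤ mc) :
    (d : ENNReal) * (12 ^ (12 * r) * (2 * ENNReal.ofReal (2 * Real.exp
        (-((1 / 4) ^ 2 * mc / (2048 * (K : ℝ) ^ 2))))) +
        r * ↑(n ^ (d - 1)) * (2 * ENNReal.ofReal (2 * Real.exp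
          (-((ε / d / (2 * √r)) ^ 2 * mc / (2048 * (K : ℝ) ^ 2)))))) ≤ ENNReal.ofReal δ := by
  have h := core_failure_le (K := (K : ℝ)) (N := n ^ (d - 1)) hK1 hd hr
    (pow_pos (hr.trans hrn) _) hε hε1 hδ hδ1 (by push_cast; exact hmc)
  generalize ha : 2 * Real.exp (-((1 / 4) ^ 2 * mc / (2048 * (K : ℝ) ^ 2))) = a at h ⊢
  generalize hb : 2 * Real.exp
    (-((ε / d / (2 * √r)) ^ 2 * mc / (2048 * (K : ℝ) ^ 2))) = b at h ⊢
  have ha0 : 0 ≤ a := by rw [← ha]; positivity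
  have hb0 : 0 ≤ b := by rw [← hb]; positivity
  clear ha hb hmc hδ1
  lift a to ℝ≥0 using ha0
  lift b to ℝ≥0 using hb0
  lift δ to ℝ≥0 using hδ.le
  simp only [ENNReal.ofReal_coe_nnreal]
  exact_mod_cast h

theorem ofReal_one_sub_le_measure_entries {K : ℝ≥0} (hK1 : 1 ≤ K) {d n r m mc : ℕ} {ε δ : ℝ}
    (hd : 2 ≤ d) (hr : 1 ≤ r) (hrn : r ≤ n) (hε : 0 < ε) (hε1 : ε < 1) (hδ : 0 < δ)
    (hδ1 : δ < 1 / 3)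
    (hm : 40 * 256 * 2048 * (K : ℝ) ^ 2 * r * ((d : ℝ) - 1) ^ 2 / ε ^ 2 *
      Real.log ((n : ℝ) ^ d * (d : ℝ) ^ 2 / δ) ≤ m)
    (hmc : 40 * 16 * 2048 * (K : ℝ) ^ 2 * r * (d : ℝ) ^ 2 / ε ^ 2 *
      Real.log ((d : ℝ) * ((r : ℝ) + (n : ℝ) ^ (d - 1)) ^ 2 / δ) ≤ mc)
    {X : Tensor d n} {svd : ∀ i : Fin d, Matrix (Fin n) (OtherModes i m) ℝ →
      Matrix (Fin n) (Fin r) ℝ} (hsvd : ∀ i, IsSVDRoutine (svd i))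
    {D : Fin d → Matrix (Fin n) (Fin n) ℝ} (hD : ∀ i, (D i).rank = n)
    {S : Type*} [MeasurableSpace S] {μ : Measure S} [IsProbabilityMeasure μ]
    {ξ : EntryIndex d n m mc → S → ℝ} (hind : iIndepFun ξ μ)
    (hsl : ∀ z, IsNormalizedSubgaussian μ K m (ξ (Sum.inl z)))
    (hsr : ∀ z, IsNormalizedSubgaussian μ K mc (ξ (Sum.inr z))) :
    ENNReal.ofReal (1 - 3 * δ) ≤ μ {ω | tensorNorm
        (kroneckerOnePass svd D (fun i j => entriesOmega (fun i => ξ i ω) i j)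
          (fun i => entriesPhi (fun i => ξ i ω) i) X - X)
        ≤ (1 + Real.exp ε) * √((1 + ε) / (1 - ε) * ∑ j, tailEnergy X r j)} := by
  have hd' : (2 : ℝ) ≤ d := by exact_mod_cast hd
  have hr' : (1 : ℝ) ≤ r := by exact_mod_cast hr
  have hn' : (1 : ℝ) ≤ n := by exact_mod_cast hr.trans hrn
  have hK1' : (1 : ℝ) ≤ K := hK1
  -- The sample size is positive because the logarithm in its lower bound is.
  have hm0 : 0 < m := by
    have h1 : 1 < (n : ℝ) ^ d * (d : ℝ) ^ 2 / δ := by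
      rw [one_lt_div hδ]
      nlinarith [one_le_pow₀ hn' (n := d)]
    have h2 := Real.log_pos h1
    have h3 : 0 < (d : ℝ) - 1 := by linarith
    have : (0 : ℝ) < m := lt_of_lt_of_le (by positivity) hm
    exact_mod_cast this
  have hmc0 : 0 < mc := by
    have h1 : 1 < (d : ℝ) * ((r : ℝ) + (n : ℝ) ^ (d - 1)) ^ 2 / δ := by
      rw [one_lt_div hδ]
      have : (1 : ℝ) ≤ ((r : ℝ) + (n : ℝ) ^ (d - 1)) ^ 2 := by
        apply one_le_pow₀
        linarith [one_le_pow₀ hn' (n := d - 1)]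
      nlinarith
    have h2 := Real.log_pos h1
    have : (0 : ℝ) < mc := lt_of_lt_of_le (by positivity) hmc
    exact_mod_cast this
  have hξ : ∀ i, Measurable (ξ i) := by
    rintro (z | z)
    · exact (hsl z).measurable
    · exact (hsr z).measurable
  have hτ1 : ε / d ≤ 1 := by rw [div_le_one (by positivity)]; linarith
  refine ofReal_one_sub_le_measure hδ
    (fun i => measure_factor_failure_le (X := X) (svd := svd) hind hξ hK1 hm0
      hsl hsvd hd hr hrn hε hε1 i fun α => rfl)
    (fun k => measure_coreGood_compl_le (X := X) (svd := svd) hind hξ hK1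
      hmc0 hsr hsvd hr hrn (τ := ε / d) (by positivity) hτ1 k)
    ?_ ?_ fun ω hA hB => ?_
  · rw [Fintype.card_fin]
    exact factor_failure_ennreal_le hK1 hd hr hrn hε hδ hδ1 hm fun α => rfl
  · rw [Fintype.card_fin]
    exact core_failure_ennreal_le hK1 hd hr hrn hε hε1 hδ hδ1 hmc
  · exact tensorNorm_kroneckerOnePass_sub_le hsvd hD hd hrn hε (fun i => not_not.1 (hA i))
      fun k => not_not.1 (hB k)

end OnePassTucker

end

/-! ### The main theorem: choice of the constants. -/

theorem mainTheorem3 (K : ℝ≥0) :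
    ∃ C₁ C₂ C₃ C₄ : ℝ, 0 < C₁ ∧ 0 < C₂ ∧ 0 < C₃ ∧ 0 < C₄ ∧
      ∀ (d n r m mc : ℕ) (ε δ : ℝ), 2 ≤ d → 1 ≤ r → r ≤ n →
        0 < ε → ε < 1 → 0 < δ → δ < 1 / 3 →
        max (C₁ * r * ((d : ℝ) - 1) ^ 2 / ε ^ 2 * Real.log ((n : ℝ) ^ d * (d : ℝ) ^ 2 / δ))
            (C₂ * ((d : ℝ) - 1) ^ 2 / ε ^ 2 *
              Real.log ((141 / ε) ^ r * ((n : ℝ) ^ (d - 2) * (d : ℝ) ^ 2 / δ))) ≤ (m : ℝ) →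
        max (C₃ * Real.log ((94 : ℝ) ^ r * d / δ))
            (C₄ * r * (d : ℝ) ^ 2 / ε ^ 2 *
              Real.log ((d : ℝ) * ((r : ℝ) + (n : ℝ) ^ (d - 1)) ^ 2 / δ)) ≤ (mc : ℝ) →
        ∀ (X : OnePassTucker.Tensor d n)
          (svd : ∀ i : Fin d, Matrix (Fin n) (OnePassTucker.OtherModes i m) ℝ →
            Matrix (Fin n) (Fin r) ℝ)
          (D : Fin d → Matrix (Fin n) (Fin n) ℝ)
          (S : Type*) [MeasurableSpace S] (μ : Measure S) [IsProbabilityMeasure μ]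
          (Ω : ∀ i : Fin d, {j : Fin d // j ≠ i} → S → Matrix (Fin m) (Fin n) ℝ)
          (Φ : Fin d → S → Matrix (Fin mc) (Fin n) ℝ),
          (∀ i, OnePassTucker.IsSVDRoutine (svd i)) →
          (∀ i, (D i).rank = n) →
          (∀ i j a b, OnePassTucker.IsNormalizedSubgaussian μ K m fun ω => Ω i j ω a b) →
          (∀ i a b, OnePassTucker.IsNormalizedSubgaussian μ K mc fun ω => Φ i ω a b) →
          iIndepFun (OnePassTucker.allEntries Ω Φ) μ →
          ENNReal.ofReal (1 - 3 * δ) ≤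
            μ {ω | OnePassTucker.tensorNorm
                (OnePassTucker.kroneckerOnePass svd D (fun i j => Ω i j ω) (fun i => Φ i ω) X - X)
              ≤ (1 + Real.exp ε) * √((1 + ε) / (1 - ε) *
                  ∑ j, OnePassTucker.tailEnergy X r j)} := by
  have hK1 : 1 ≤ max K 1 := le_max_right _ _
  have hK1' : (1 : ℝ) ≤ (max K 1 : ℝ≥0) := hK1
  -- The parameter is raised to `max K 1` because the concentration bounds assume `1 ≤ K`. The first
  -- and last constants are those of `factor_failure_le` and `core_failure_le`.
  refine ⟨40 * 256 * 2048 * ((max K 1 : ℝ≥0) : ℝ) ^ 2, 1, 1,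
    40 * 16 * 2048 * ((max K 1 : ℝ≥0) : ℝ) ^ 2, by positivity, one_pos, one_pos, by positivity, ?_⟩
  intro d n r m mc ε δ hd hr hrn hε hε1 hδ hδ1 hm hmc X svd D S _ μ _ Ω Φ hsvd hD hΩ hΦ hind
  have h := OnePassTucker.ofReal_one_sub_le_measure_entries hK1 hd hr hrn hε hε1 hδ hδ1
    ((le_max_left _ _).trans hm) ((le_max_right _ _).trans hmc) (X := X) hsvd hD hind
    (fun ⟨⟨i, j⟩, a, b⟩ => (hΩ i j a b).mono (le_max_left _ _))
    (fun ⟨i, a, b⟩ => (hΦ i a b).mono (le_max_left _ _))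
  exact h
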